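/- Let $S^3=\{(z,w)\in\mathbb{C}^2 : |z|^2+|w|^2=1\}$ carry its standard open book, with binding $\{z=0\}$ and pages $H_\theta=\{(z,w)\in S^3 : z\neq 0,\ \arg z=\theta\}$ (in $\mathbb{R}^3=S^3\setminus\{\mathrm{pt}\}$, with the point taken on the binding, these are the $z$-axis and the half-planes of constant angle $\theta$ in cylindrical coordinates). A link is a smooth embedding of a nonempty finite disjoint union of circles in $S^3$; links are unoriented and are considered up to smooth isotopy. A booklink is a link disjoint from the binding on which $\theta$ has only non-degenerate critical points; it is a $(d,n)$-representative of its link type if $\theta$ has exactly $d$ pairs of critical points (that is, $2d$ critical points) on it and the minimum over all $\theta$ of its number of intersection points with $H_\theta$ is $n$. For a link type $L$ and an integer $d\ge 0$ let $b_d(L)$ be the minimal $n$ such that $L$ has a $(d,n)$-representative; the sequence $(b_0(L),b_1(L),b_2(L),\dots)$ is the bridge-braid spectrum of $L$. The bridge index of $L$ is the minimal number of local maxima of the standard height function of $S^3$ (a linear coordinate function) on a representative of $L$ on which this function is Morse. The braid index of $L$ is the minimal number of strands of a closed braid representing $L$, where a closed braid is a link disjoint from the binding on which $\theta$ has no critical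 points, and its number of strands is its number of intersection points with any page. Suppose that the bridge index and the braid index of $L$ are both equal to $\mathfrak d$. Then the bridge-braid spectrum of $L$ is $\{\mathfrak d,\mathfrak d-1,\dots,1,0\}$, all further terms being $0$; that is, $b_d(L)=\mathfrak d-d$ for $0\le d\le\mathfrak d$, and $b_d(L)=0$ for all $d>\mathfrak d$. -/

import Mathlib

open scoped ContDiff

/-- The unit three-sphere `{(z, w) : |z|² + |w|² = 1}` in `ℂ²`. -/
def threeSphere : Set (ℂ × ℂ) := {p | ‖p.1‖ ^ 2 + ‖p.2‖ ^ 2 = 1}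

/-- A smooth link with `m` components in the three-sphere: a smooth embedding of a disjoint union of
`m` circles `ℝ / ℤ`, given by `m` smooth immersed curves of period `1` that are jointly injective
modulo the period. Smoothness is tested in the ambient space `ℂ² = ℝ⁴`. -/
structure SmoothLink (m : ℕ) where
  /-- the parametrization of each component -/
  curve : Fin m → ℝ → ℂ × ℂ
  smooth : ∀ i, ContDiff ℝ ∞ (curve i)
  periodic : ∀ i t, curve i (t + 1) = curve i t
  mem_sphere : ∀ i t, curve i t ∈ threeSphere
  immersion : ∀ i t, deriv (curve i) t ≠ 0
  injective : ∀ i j s t, curve i s = curve j t → i = j ∧ ∃ k : ℤ, t = s + k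

namespace SmoothLink

variable {m : ℕ}

/-- The underlying subset of the three-sphere. -/
def carrier (K : SmoothLink m) : Set (ℂ × ℂ) := {p | ∃ i t, K.curve i t = p}

/-- Two links are isotopic if they are joined by a smooth one-parameter family `F s`, `s ∈ [0, 1]`,
of smooth links. -/
def Isotopic (K₀ K₁ : SmoothLink m) : Prop :=
  ∃ F : ℝ → SmoothLink m,
    (∀ i, ContDiffOn ℝ ∞ (fun p : ℝ × ℝ => (F p.1).curve i p.2) (Set.Icc 0 1 ×ˢ Set.univ)) ∧
    F 0 = K₀ ∧ F 1 = K₁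

/-! ### The classical bridge index -/

/-- The height of the link along its `i`-th component: the coordinate function `(z, w) ↦ Im z` of
`ℝ⁴ = ℂ²`, the standard height function on the three-sphere (two critical points; its choice among
the unit linear functions is immaterial up to rotation). -/
def height (K : SmoothLink m) (i : Fin m) (t : ℝ) : ℝ := (K.curve i t).1.im

/-- The height function restricted to the link is Morse: all its critical points are
non-degenerate. -/
def IsHeightMorse (K : SmoothLink m) : Prop :=
  ∀ i t, deriv (K.height i) t = 0 → deriv (deriv (K.height i)) t ≠ 0

/-- The number of local maxima of the height function on the link. Each point of the link has
exactly one parameter `(i, t)` with `t ∈ [0, 1)`. -/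
noncomputable def numMaxima (K : SmoothLink m) : ℕ∞ :=
  {q : Fin m × ℝ | q.2 ∈ Set.Ico (0 : ℝ) 1 ∧ IsLocalMax (K.height q.1) q.2}.encard

/-- The classical bridge index of the link type of `K`: the minimal number of local maxima of the
height function on a representative in Morse position. -/
noncomputable def bridgeIndex (K : SmoothLink m) : ℕ∞ :=
  sInf {b | ∃ K' : SmoothLink m, K.Isotopic K' ∧ K'.IsHeightMorse ∧ K'.numMaxima = b}

end SmoothLink

/-! ### The open book: binding `{z = 0}`, angle `θ = arg z` -/

/-- The page `H_θ` of the standard open book of the three-sphere: the points off the binding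
`{z = 0}` with `arg z = θ`. Under stereographic projection from a point of the binding, the binding
becomes the `z`-axis of `ℝ³` (together with `∞`), `θ` the angle of cylindrical coordinates and
`H_θ` an open half-plane bounded by the axis. -/
def page (θ : ℝ) : Set (ℂ × ℂ) :=
  {p | p ∈ threeSphere ∧ ∃ r : ℝ, 0 < r ∧ p.1 = r * Complex.exp (θ * Complex.I)}

namespace SmoothLink

variable {m : ℕ}

/-- The link is disjoint from the binding. -/
def AvoidsBinding (K : SmoothLink m) : Prop := ∀ i t, (K.curve i t).1 ≠ 0

/-- The derivative of the angle `θ` along the `i`-th component. If `z = r * exp (i θ)` with `r > 0`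
along the curve, then `z' / z = r' / r + i θ'`, so `θ' = Im (z' / z)`; this does not depend on
the branch of `θ`. -/
noncomputable def angleDeriv (K : SmoothLink m) (i : Fin m) (t : ℝ) : ℝ :=
  (deriv (fun u => (K.curve i u).1) t / (K.curve i t).1).im

/-- A booklink: a link in the complement of the binding on which the angle `θ` has only
non-degenerate critical points. -/
def IsBooklink (K : SmoothLink m) : Prop :=
  K.AvoidsBinding ∧ ∀ i t, K.angleDeriv i t = 0 → deriv (K.angleDeriv i) t ≠ 0

/-- The number of critical points of the angle `θ` on the link. -/
noncomputable def numCritical (K : SmoothLink m) : ℕ∞ :=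
  {q : Fin m × ℝ | q.2 ∈ Set.Ico (0 : ℝ) 1 ∧ K.angleDeriv q.1 q.2 = 0}.encard

/-- The geometric intersection number of the link with the page `H_θ`. -/
noncomputable def pageCount (K : SmoothLink m) (θ : ℝ) : ℕ∞ := (K.carrier ∩ page θ).encard

/-- `K` is a `(d, n)`-representative: a booklink with `d` pairs of critical points whose minimal
number of intersections with a page is `n`. -/
def IsRepresentative (K : SmoothLink m) (d : ℕ) (n : ℕ∞) : Prop :=
  K.IsBooklink ∧ K.numCritical = 2 * (d : ℕ∞) ∧ (⨅ θ : ℝ, K.pageCount θ) = n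

/-- The bridge-braid spectrum of the link type of `K`: its `d`-th term is the minimal `n` such that
the link type has a `(d, n)`-representative (`⊤` if there were none). -/
noncomputable def bridgeBraidSpectrum (K : SmoothLink m) (d : ℕ) : ℕ∞ :=
  sInf {n | ∃ K' : SmoothLink m, K.Isotopic K' ∧ K'.IsRepresentative d n}

/-! ### The classical braid index -/

/-- `K` is a closed braid with `n` strands about the binding: `θ` is strictly monotone along every
component and every page is met in exactly `n` points. Links are unoriented: the parametrization of
a component may traverse it in either direction. -/
def IsClosedBraid (K : SmoothLink m) (n : ℕ∞) : Prop :=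
  K.AvoidsBinding ∧ (∀ i t, K.angleDeriv i t ≠ 0) ∧ ∀ θ : ℝ, K.pageCount θ = n

/-- The classical braid index of the link type of `K`: the minimal number of strands of a closed
braid representing it. -/
noncomputable def braidIndex (K : SmoothLink m) : ℕ∞ :=
  sInf {n | ∃ K' : SmoothLink m, K.Isotopic K' ∧ K'.IsClosedBraid n}

end SmoothLink

/-! The braid index bounds the spectrum from above, the bridge index bounds it from below, and the
two bounds coincide when the indices do. All constructions take place with curves in `ℂ² \ {0}` up
to positive rescaling (`IsConeLink`); off the binding one may rescale to `|z| = 1` and describe the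
link by a lifted angle and the fibre coordinate `w / |z|` (`IsPolar`).

Upper bound (`SmoothLink.IsClosedBraid.exists_isRepresentative`). In a closed braid with `n` strands
make the angle linear, and make the fibre coordinate constant along each strand over the half-space
`Re z < 0`, with different strands in different directions (`IsPolar.exists_flat`). A strand can
then be pushed along the real axis across the binding by a thin finger. Strands moved this way never
meet each other, since their fibre directions differ, and they miss the unmoved part of the braid,
since a point pushed into `0 ≤ Re z` has a larger ratio `|w| / |z|` than any point there. Such a
finger removes the point of the strand on the page `θ = π` and creates one pair of critical points.
Further pairs come from bumps beside a finger, which do not touch that page. Hence `d` pairs leave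
at most `n - d` points, with truncated subtraction.

Lower bound (`SmoothLink.bridgeIndex_le_of_isRepresentative`). For a `(d, n)`-representative choose
a page with at most `n` points that contains no critical point of `θ` (`exists_regular_page`).
Contract the link towards the core circle `w = 0` and move the centre of the circle: in the limit
the height is a function of `θ` alone, with its maximum at the chosen page and its minimum shortly
after it, and `θ` has no critical value between the two (`exists_shift`). On the remaining arc the
height increases with `θ`. So the limiting maxima are the points on the page and the local maxima of
`θ`, at most `n + d` in all. Simple zeros are stable (`perturb_zeros`), so the count survives for a
sufficiently small contraction factor, and the bridge index is at most `n + d`. -/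

/-! ### Radial projection to the three-sphere -/

/-- The Euclidean norm on `ℂ²`. -/
noncomputable def euclideanNorm (p : ℂ × ℂ) : ℝ := √(‖p.1‖ ^ 2 + ‖p.2‖ ^ 2)

/-- The radial projection of `ℂ² \ {0}` onto the three-sphere. -/
noncomputable def toSphere (p : ℂ × ℂ) : ℂ × ℂ := (euclideanNorm p)⁻¹ • p

lemma euclideanNorm_sq (p : ℂ × ℂ) : euclideanNorm p ^ 2 = ‖p.1‖ ^ 2 + ‖p.2‖ ^ 2 :=
  Real.sq_sqrt (by positivity)

lemma euclideanNorm_pos {p : ℂ × ℂ} (hp : p ≠ 0) : 0 < euclideanNorm p := by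
  apply Real.sqrt_pos.2
  by_contra! h
  apply hp
  have h1 := sq_nonneg ‖p.1‖
  have h2 := sq_nonneg ‖p.2‖
  have h3 : ‖p.1‖ ^ 2 = 0 := by linarith
  have h4 : ‖p.2‖ ^ 2 = 0 := by linarith
  ext1
  · simpa using h3
  · simpa using h4

lemma euclideanNorm_smul {a : ℝ} (ha : 0 ≤ a) (p : ℂ × ℂ) :
    euclideanNorm (a • p) = a * euclideanNorm p := by
  unfold euclideanNorm
  rw [← Real.sqrt_sq ha, ← Real.sqrt_mul (sq_nonneg a), Real.sqrt_sq ha]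
  congr 1
  simp only [Prod.smul_fst, Prod.smul_snd, norm_smul, Real.norm_eq_abs, mul_pow, sq_abs]
  ring

lemma mem_threeSphere_iff {p : ℂ × ℂ} : p ∈ threeSphere ↔ euclideanNorm p = 1 := by
  unfold threeSphere euclideanNorm
  rw [Set.mem_ofPred_eq, Real.sqrt_eq_one]

lemma toSphere_mem {p : ℂ × ℂ} (hp : p ≠ 0) : toSphere p ∈ threeSphere := by
  have h := euclideanNorm_pos hp
  rw [mem_threeSphere_iff, toSphere, euclideanNorm_smul (by positivity),
    inv_mul_cancel₀ h.ne']

lemma toSphere_of_mem {p : ℂ × ℂ} (hp : p ∈ threeSphere) : toSphere p = p := by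
  rw [toSphere, mem_threeSphere_iff.1 hp, inv_one, one_smul]

lemma ne_zero_of_mem_threeSphere {p : ℂ × ℂ} (hp : p ∈ threeSphere) : p ≠ 0 := by
  rintro rfl
  simp [threeSphere] at hp

lemma toSphere_smul {a : ℝ} (ha : 0 < a) (p : ℂ × ℂ) : toSphere (a • p) = toSphere p := by
  rw [toSphere, toSphere, euclideanNorm_smul ha.le, smul_smul, mul_inv]
  congr 1
  field_simp

lemma exists_smul_of_toSphere_eq {p q : ℂ × ℂ} (hp : p ≠ 0) (hq : q ≠ 0)
    (h : toSphere p = toSphere q) : ∃ a : ℝ, 0 < a ∧ p = a • q := by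
  have h1 := euclideanNorm_pos hp
  have h2 := euclideanNorm_pos hq
  refine ⟨euclideanNorm p * (euclideanNorm q)⁻¹, by positivity, ?_⟩
  rw [mul_smul]
  change p = euclideanNorm p • toSphere q
  rw [← h, toSphere, smul_smul, mul_inv_cancel₀ h1.ne', one_smul]

lemma contDiffAt_euclideanNorm {p : ℂ × ℂ} (hp : p ≠ 0) :
    ContDiffAt ℝ ∞ euclideanNorm p := by
  have h := euclideanNorm_pos hp
  have h' : ‖p.1‖ ^ 2 + ‖p.2‖ ^ 2 ≠ 0 := by
    rw [← euclideanNorm_sq]; positivity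
  exact ContDiffAt.sqrt (((contDiff_fst.norm_sq ℝ).add (contDiff_snd.norm_sq ℝ)).contDiffAt) h'

lemma contDiffAt_toSphere {p : ℂ × ℂ} (hp : p ≠ 0) : ContDiffAt ℝ ∞ toSphere p :=
  ((contDiffAt_euclideanNorm hp).inv (euclideanNorm_pos hp).ne').smul contDiffAt_id

/-! ### Links up to radial rescaling -/

/-- A family of smooth closed curves in `ℂ² \ {0}` whose radial projection is a smooth link. -/
structure IsConeLink {m : ℕ} (c : Fin m → ℝ → ℂ × ℂ) : Prop where
  smooth : ∀ i, ContDiff ℝ ∞ (c i)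
  periodic : ∀ i t, c i (t + 1) = c i t
  ne_zero : ∀ i t, c i t ≠ 0
  immersion : ∀ i t (a : ℝ), deriv (c i) t ≠ a • c i t
  injective : ∀ i j s t (a : ℝ), 0 < a → c i s = a • c j t → i = j ∧ ∃ k : ℤ, t = s + k

namespace IsConeLink

variable {m : ℕ} {c : Fin m → ℝ → ℂ × ℂ}

lemma contDiff_norm (h : IsConeLink c) (i : Fin m) :
    ContDiff ℝ ∞ (fun t => euclideanNorm (c i t)) :=
  contDiff_iff_contDiffAt.2 fun t =>
    (contDiffAt_euclideanNorm (h.ne_zero i t)).comp t (h.smooth i).contDiffAt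

/-- The radial projection of a cone link. -/
noncomputable def toLink (h : IsConeLink c) : SmoothLink m where
  curve i t := toSphere (c i t)
  smooth i := contDiff_iff_contDiffAt.2 fun t =>
    (contDiffAt_toSphere (h.ne_zero i t)).comp t (h.smooth i).contDiffAt
  periodic i t := by rw [h.periodic]
  mem_sphere i t := toSphere_mem (h.ne_zero i t)
  immersion i t h0 := by
    have hN := euclideanNorm_pos (h.ne_zero i t)
    have h1 : HasDerivAt (fun t => (euclideanNorm (c i t))⁻¹)
        (deriv (fun t => (euclideanNorm (c i t))⁻¹) t) t :=
      (((h.contDiff_norm i).differentiable (by simp) t).inv hN.ne').hasDerivAt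
    have h2 := ((h.smooth i).differentiable (by simp) t).hasDerivAt
    have h3 := (h1.smul h2).deriv
    simp only [toSphere] at h0
    change deriv (fun t => (euclideanNorm (c i t))⁻¹ • c i t) t = _ at h3
    rw [h0] at h3
    -- By the product rule, a vanishing derivative of `N⁻¹ c` makes `c'` radial with coefficient `-N
    -- (N⁻¹)'`.
    apply h.immersion i t (-(euclideanNorm (c i t) * deriv (fun t => (euclideanNorm (c i t))⁻¹) t))
    have h4 := congrArg (fun x => euclideanNorm (c i t) • x) h3
    simp only [smul_add, smul_smul, mul_inv_cancel₀ hN.ne', one_smul, smul_zero] at h4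
    rw [neg_smul, eq_neg_iff_add_eq_zero]
    exact h4.symm
  injective i j s t hst := by
    obtain ⟨a, ha, h'⟩ := exists_smul_of_toSphere_eq (h.ne_zero i s) (h.ne_zero j t) hst
    exact h.injective i j s t a ha h'

@[simp] lemma toLink_curve (h : IsConeLink c) (i : Fin m) (t : ℝ) :
    h.toLink.curve i t = toSphere (c i t) := rfl

end IsConeLink

namespace SmoothLink

variable {m : ℕ}

lemma ext_curve {K K' : SmoothLink m} (h : ∀ i t, K.curve i t = K'.curve i t) : K = K' := by
  obtain ⟨c, _, _, _, _, _⟩ := K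
  obtain ⟨c', _, _, _, _, _⟩ := K'
  obtain rfl : c = c' := by funext i t; exact h i t
  rfl

lemma curve_ne_zero (K : SmoothLink m) (i : Fin m) (t : ℝ) : K.curve i t ≠ 0 :=
  ne_zero_of_mem_threeSphere (K.mem_sphere i t)

/-- The velocity of a curve on the sphere is orthogonal to its position, so a radial velocity would
be zero; and positively proportional points of the sphere are equal. -/
lemma isConeLink (K : SmoothLink m) : IsConeLink K.curve where
  smooth := K.smooth
  periodic := K.periodic
  ne_zero := K.curve_ne_zero
  immersion i t a ha := by
    have hd := ((K.smooth i).differentiable (by simp) t).hasDerivAt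
    have h1 : HasDerivAt (fun t => (K.curve i t).1) (deriv (K.curve i) t).1 t := hd.fst
    have h2 : HasDerivAt (fun t => (K.curve i t).2) (deriv (K.curve i) t).2 t := hd.snd
    have h3 := h1.norm_sq.add h2.norm_sq
    have h4 : (fun t => ‖(K.curve i t).1‖ ^ 2) + (fun t => ‖(K.curve i t).2‖ ^ 2) =
        fun _ => 1 := funext fun t => K.mem_sphere i t
    rw [h4] at h3
    have h5 := h3.unique (hasDerivAt_const t (1 : ℝ))
    rw [ha, Prod.smul_fst, Prod.smul_snd, inner_smul_right, inner_smul_right,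
      real_inner_self_eq_norm_sq, real_inner_self_eq_norm_sq] at h5
    have h6 : ‖(K.curve i t).1‖ ^ 2 + ‖(K.curve i t).2‖ ^ 2 = 1 := K.mem_sphere i t
    have h7 : a = 0 := by nlinarith
    rw [h7, zero_smul] at ha
    exact K.immersion i t ha
  injective i j s t a ha h := by
    apply K.injective i j s t
    have := congrArg toSphere h
    rwa [toSphere_smul ha, toSphere_of_mem (K.mem_sphere i s),
      toSphere_of_mem (K.mem_sphere j t)] at this

/-- A smooth family of cone links yields an isotopy between its ends. -/
lemma isotopic_of_isConeLink (C : ℝ → Fin m → ℝ → ℂ × ℂ)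
    (hC : ∀ s ∈ Set.Icc (0 : ℝ) 1, IsConeLink (C s))
    (hsm : ∀ i, ContDiff ℝ ∞ (fun p : ℝ × ℝ => C p.1 i p.2)) {K₀ K₁ : SmoothLink m}
    (h0 : ∀ i t, K₀.curve i t = toSphere (C 0 i t))
    (h1 : ∀ i t, K₁.curve i t = toSphere (C 1 i t)) : K₀.Isotopic K₁ := by
  classical
  -- Outside `[0, 1]` the family is unconstrained; `K₀` is a default value.
  refine ⟨fun s => if hs : s ∈ Set.Icc (0 : ℝ) 1 then (hC s hs).toLink else K₀, ?_, ?_, ?_⟩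
  · intro i
    have : ContDiffOn ℝ ∞ (fun p : ℝ × ℝ => toSphere (C p.1 i p.2))
        (Set.Icc 0 1 ×ˢ Set.univ) := by
      rintro ⟨s, t⟩ ⟨hs, -⟩
      exact ((contDiffAt_toSphere ((hC s hs).ne_zero i t)).comp (s, t)
        (hsm i).contDiffAt).contDiffWithinAt
    refine this.congr ?_
    rintro ⟨s, t⟩ ⟨hs, -⟩
    simp only at hs
    simp only [dif_pos hs, IsConeLink.toLink_curve]
  · apply ext_curve
    intro i t
    have hs : (0 : ℝ) ∈ Set.Icc (0 : ℝ) 1 := by simp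
    simp only [dif_pos hs, IsConeLink.toLink_curve, h0]
  · apply ext_curve
    intro i t
    have hs : (1 : ℝ) ∈ Set.Icc (0 : ℝ) 1 := by simp
    simp only [dif_pos hs, IsConeLink.toLink_curve, h1]

/-- Time is reparametrized by `Real.smoothTransition`, so that the family is smooth on the whole
line and stationary beyond both ends; such families can be concatenated smoothly. -/
lemma Isotopic.exists_contDiff {K₀ K₁ : SmoothLink m} (h : K₀.Isotopic K₁) :
    ∃ F : ℝ → SmoothLink m, (∀ i, ContDiff ℝ ∞ (fun p : ℝ × ℝ => (F p.1).curve i p.2)) ∧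
      (∀ s ≤ 0, F s = K₀) ∧ ∀ s, 1 ≤ s → F s = K₁ := by
  obtain ⟨F, hF, h0, h1⟩ := h
  refine ⟨fun s => F (Real.smoothTransition s), fun i => ?_, fun s hs => ?_, fun s hs => ?_⟩
  · rw [← contDiffOn_univ]
    refine (hF i).comp (f := fun p : ℝ × ℝ => (Real.smoothTransition p.1, p.2))
      (ContDiff.contDiffOn ?_) ?_
    · exact (Real.smoothTransition.contDiff.comp contDiff_fst).prodMk contDiff_snd
    · rintro ⟨s, t⟩ -
      exact ⟨⟨Real.smoothTransition.nonneg _, Real.smoothTransition.le_one _⟩, trivial⟩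
  · simp only [Real.smoothTransition.zero_of_nonpos hs, h0]
  · simp only [Real.smoothTransition.one_of_one_le hs, h1]

lemma Isotopic.trans {K₀ K₁ K₂ : SmoothLink m} (h : K₀.Isotopic K₁) (h' : K₁.Isotopic K₂) :
    K₀.Isotopic K₂ := by
  obtain ⟨F, hF, hF0, hF1⟩ := h.exists_contDiff
  obtain ⟨G, hG, hG0, hG1⟩ := h'.exists_contDiff
  -- The first isotopy is over at `s = 1/3` and the second starts at `s = 2/3`; in between both
  -- formulas give `K₁`, so the switch at `1/2` is smooth.
  refine ⟨fun s => if s ≤ 1 / 2 then F (3 * s) else G (3 * s - 2), fun i => ?_, ?_, ?_⟩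
  · apply ContDiff.contDiffOn
    rw [contDiff_iff_contDiffAt]
    rintro ⟨s, t⟩
    rcases lt_or_ge s (1 / 2) with hs | hs
    · have : ContDiffAt ℝ ∞ (fun p : ℝ × ℝ => (F (3 * p.1)).curve i p.2) (s, t) :=
        ((hF i).comp (g := fun p : ℝ × ℝ => (F p.1).curve i p.2)
          (f := fun p : ℝ × ℝ => (3 * p.1, p.2))
          ((contDiff_const.mul contDiff_fst).prodMk contDiff_snd)).contDiffAt
      refine this.congr_of_eventuallyEq ?_
      filter_upwards [(isOpen_Iio.preimage continuous_fst).mem_nhds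
        (show (s, t) ∈ Prod.fst ⁻¹' Set.Iio (1 / 2 : ℝ) from hs)] with p hp
      have hp' : p.1 ≤ 1 / 2 := le_of_lt hp
      simp only [if_pos hp']
    · have : ContDiffAt ℝ ∞ (fun p : ℝ × ℝ => (G (3 * p.1 - 2)).curve i p.2) (s, t) :=
        ((hG i).comp (g := fun p : ℝ × ℝ => (G p.1).curve i p.2)
          (f := fun p : ℝ × ℝ => (3 * p.1 - 2, p.2))
          (((contDiff_const.mul contDiff_fst).sub contDiff_const).prodMk
            contDiff_snd)).contDiffAt
      refine this.congr_of_eventuallyEq ?_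
      filter_upwards [(isOpen_Ioi.preimage continuous_fst).mem_nhds
        (show (s, t) ∈ Prod.fst ⁻¹' Set.Ioi (1 / 3 : ℝ) from lt_of_lt_of_le (by norm_num) hs)]
        with p hp
      have hp' : 1 / 3 < p.1 := hp
      by_cases h2 : p.1 ≤ 1 / 2
      · simp only [if_pos h2]
        rw [hF1 _ (by linarith), hG0 _ (by linarith)]
      · simp only [if_neg h2]
  · simp only [show (0 : ℝ) ≤ 1 / 2 by norm_num, if_true]
    exact hF0 _ (by norm_num)
  · simp only [show ¬ (1 : ℝ) ≤ 1 / 2 by norm_num, if_false]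
    exact hG1 _ (by norm_num)

/-! ### Pages and angles -/

/-- The points of the link in a set are counted by their parameters in `[0, 1)`. -/
lemma encard_carrier_inter (K : SmoothLink m) (S : Set (ℂ × ℂ)) :
    (K.carrier ∩ S).encard =
      {q : Fin m × ℝ | q.2 ∈ Set.Ico (0 : ℝ) 1 ∧ K.curve q.1 q.2 ∈ S}.encard := by
  have hper : ∀ i t (k : ℤ), K.curve i (t + k) = K.curve i t := fun i t k => by
    have := (show Function.Periodic (K.curve i) 1 from K.periodic i).int_mul k t
    simpa using this
  rw [← Set.InjOn.encard_image (f := fun q : Fin m × ℝ => K.curve q.1 q.2)]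
  · congr 1
    ext p
    constructor
    · rintro ⟨⟨i, t, rfl⟩, hS⟩
      have : K.curve i (Int.fract t) = K.curve i t := by
        rw [Int.fract, sub_eq_add_neg, ← Int.cast_neg, hper]
      refine ⟨(i, Int.fract t), ⟨⟨Int.fract_nonneg t, Int.fract_lt_one t⟩, ?_⟩, this⟩
      simpa only [this] using hS
    · rintro ⟨⟨i, t⟩, ⟨-, hS⟩, rfl⟩
      exact ⟨⟨i, t, rfl⟩, hS⟩
  · rintro ⟨i, s⟩ ⟨hs, -⟩ ⟨j, t⟩ ⟨ht, -⟩ h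
    obtain ⟨rfl, k, hk⟩ := K.injective i j s t h
    simp only [Set.mem_Ico] at hs ht
    have h1 : (k : ℝ) < 1 := by linarith
    have h2 : (-1 : ℝ) < k := by linarith
    have h3 : k < 1 := by exact_mod_cast h1
    have h4 : -1 < k := by exact_mod_cast h2
    have : k = 0 := by omega
    simp [hk, this]

end SmoothLink

lemma toSphere_mem_page_iff {p : ℂ × ℂ} (hp : p ≠ 0) (θ : ℝ) :
    toSphere p ∈ page θ ↔ ∃ r : ℝ, 0 < r ∧ p.1 = r * Complex.exp (θ * Complex.I) := by
  have hN := euclideanNorm_pos hp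
  simp only [page, Set.mem_ofPred_eq, toSphere_mem hp, true_and]
  constructor
  · rintro ⟨r, hr, h⟩
    refine ⟨euclideanNorm p * r, by positivity, ?_⟩
    have h2 : p.1 = euclideanNorm p • (toSphere p).1 := by
      rw [← Prod.smul_fst, toSphere, smul_smul, mul_inv_cancel₀ hN.ne', one_smul]
    rw [h2, h, Complex.real_smul]
    push_cast; ring
  · rintro ⟨r, hr, h⟩
    refine ⟨(euclideanNorm p)⁻¹ * r, by positivity, ?_⟩
    rw [toSphere, Prod.smul_fst, h, Complex.real_smul]
    push_cast; ring

/-- The angular velocity of a plane curve does not change when it is rescaled by a positive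
function. -/
lemma im_logDeriv_smul {r : ℝ → ℝ} {z : ℝ → ℂ} {t : ℝ} (hr : DifferentiableAt ℝ r t)
    (hz : DifferentiableAt ℝ z t) (hr0 : r t ≠ 0) :
    (deriv (fun u => r u • z u) t / (r t • z t)).im = (deriv z t / z t).im := by
  have := (hr.hasDerivAt.smul hz.hasDerivAt).deriv
  change deriv (fun u => r u • z u) t = _ at this
  rw [this]
  rcases eq_or_ne (z t) 0 with h0 | h0
  · simp [h0]
  have h1 : (r t • deriv z t + deriv r t • z t) / (r t • z t) =
      deriv z t / z t + ((deriv r t / r t : ℝ) : ℂ) := by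
    have : (r t : ℂ) ≠ 0 := by exact_mod_cast hr0
    simp only [Complex.real_smul]
    push_cast
    field_simp
  rw [h1, Complex.add_im, Complex.ofReal_im, add_zero]

namespace IsConeLink

variable {m : ℕ} {c : Fin m → ℝ → ℂ × ℂ}

lemma toLink_angleDeriv (h : IsConeLink c) (i : Fin m) (t : ℝ) :
    h.toLink.angleDeriv i t = (deriv (fun u => (c i u).1) t / (c i t).1).im := by
  have hN := euclideanNorm_pos (h.ne_zero i t)
  have := im_logDeriv_smul (r := fun t => (euclideanNorm (c i t))⁻¹) (z := fun u => (c i u).1)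
    (t := t) (((h.contDiff_norm i).differentiable (by simp) t).inv hN.ne')
    ((h.smooth i).differentiable (by simp) t).fst (inv_ne_zero hN.ne')
  rw [← this]
  rfl

lemma toLink_avoidsBinding (h : IsConeLink c) (h' : ∀ i t, (c i t).1 ≠ 0) :
    h.toLink.AvoidsBinding := by
  intro i t
  have hN := euclideanNorm_pos (h.ne_zero i t)
  simp [toSphere, hN.ne', h' i t]

lemma toLink_pageCount (h : IsConeLink c) (θ : ℝ) :
    h.toLink.pageCount θ = {q : Fin m × ℝ | q.2 ∈ Set.Ico (0 : ℝ) 1 ∧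
      ∃ r : ℝ, 0 < r ∧ (c q.1 q.2).1 = r * Complex.exp (θ * Complex.I)}.encard := by
  rw [SmoothLink.pageCount, SmoothLink.encard_carrier_inter]
  simp only [toLink_curve, toSphere_mem_page_iff (h.ne_zero _ _)]

end IsConeLink

/-! ### Polar form of a link in the complement of the binding -/

/-- Congruence of angles modulo `2π` is written as `cos (x - y) = 1` from here on: a closed,
periodic condition on a real-valued function. -/
lemma cos_sub_eq_one_iff_exp {x y : ℝ} :
    Real.cos (x - y) = 1 ↔ Complex.exp (x * Complex.I) = Complex.exp (y * Complex.I) := by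
  rw [Real.cos_eq_one_iff, Complex.exp_eq_exp_iff_exists_int]
  refine exists_congr fun n => ?_
  constructor
  · intro h
    have : x = y + n * (2 * Real.pi) := by linarith
    rw [this]; push_cast; ring
  · intro h
    have h2 : (x : ℂ) = y + n * (2 * Real.pi) := by
      have := congrArg (· * (-Complex.I)) h
      simp only [add_mul, mul_assoc] at this
      simpa using this
    have h3 : x = y + n * (2 * Real.pi) := by exact_mod_cast h2
    linarith

/-- Angles `Θ`, with winding numbers `p`, and fibre coordinates `u` of a link whose radial rescaling
to `|z| = 1` is `(exp (i Θ), u)`. -/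
structure IsPolar {m : ℕ} (Θ : Fin m → ℝ → ℝ) (u : Fin m → ℝ → ℂ) (p : Fin m → ℤ) : Prop where
  smooth_angle : ∀ i, ContDiff ℝ ∞ (Θ i)
  smooth_fibre : ∀ i, ContDiff ℝ ∞ (u i)
  angle_add_one : ∀ i t, Θ i (t + 1) = Θ i t + 2 * Real.pi * p i
  fibre_periodic : ∀ i t, u i (t + 1) = u i t
  immersion : ∀ i t, deriv (Θ i) t = 0 → deriv (u i) t ≠ 0
  injective : ∀ i j s t (k : ℤ), Θ i s = Θ j t + 2 * Real.pi * k → u i s = u j t →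
    i = j ∧ ∃ l : ℤ, t = s + l

/-- The curve `(exp (i Θ) + a, c u)`: polar coordinates about a shifted centre, with the fibre
rescaled. -/
noncomputable def polarCurve {m : ℕ} (Θ : Fin m → ℝ → ℝ) (u : Fin m → ℝ → ℂ) (a c : ℝ)
    (i : Fin m) (t : ℝ) : ℂ × ℂ :=
  (Complex.exp (Θ i t * Complex.I) + a, c • u i t)

lemma hasDerivAt_exp_angle {Θ : ℝ → ℝ} {Θ' t : ℝ} (h : HasDerivAt Θ Θ' t) :
    HasDerivAt (fun t => Complex.exp (Θ t * Complex.I))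
      (Θ' * Complex.I * Complex.exp (Θ t * Complex.I)) t := by
  have := (h.ofReal_comp.mul_const Complex.I).cexp
  convert this using 1
  ring

lemma contDiff_exp_angle {E : Type*} [NormedAddCommGroup E] [NormedSpace ℝ E] {Θ : E → ℝ}
    (h : ContDiff ℝ ∞ Θ) : ContDiff ℝ ∞ (fun t => Complex.exp (Θ t * Complex.I)) :=
  ((Complex.ofRealCLM.contDiff.comp h).mul contDiff_const).cexp

namespace IsPolar

variable {m : ℕ} {Θ : Fin m → ℝ → ℝ} {u : Fin m → ℝ → ℂ} {p : Fin m → ℤ}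

lemma fibre_add_int (h : IsPolar Θ u p) (i : Fin m) (t : ℝ) (k : ℤ) : u i (t + k) = u i t := by
  have := (show Function.Periodic (u i) 1 from h.fibre_periodic i).int_mul k t
  simpa using this

lemma sub_const (h : IsPolar Θ u p) (β : ℝ) : IsPolar (fun i t => Θ i t - β) u p where
  smooth_angle i := (h.smooth_angle i).sub contDiff_const
  smooth_fibre := h.smooth_fibre
  angle_add_one i t := by rw [h.angle_add_one]; ring
  fibre_periodic := h.fibre_periodic
  immersion i t h0 := by
    rw [deriv_sub_const] at h0
    exact h.immersion i t h0
  injective i j s t k hk := h.injective i j s t k (by linarith)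

/-- For `0 ≤ a < 1` the origin lies inside the unit circle about `a`, so every ray from the origin
meets that circle once and transversally. A point is thus determined up to rescaling by its angle
about the centre and its fibre coordinate, as for `a = 0`. -/
lemma isConeLink (h : IsPolar Θ u p) {a c : ℝ} (ha0 : 0 ≤ a) (ha1 : a < 1) (hc : 0 < c) :
    IsConeLink (polarCurve Θ u a c) where
  smooth i := ((contDiff_exp_angle (h.smooth_angle i)).add contDiff_const).prodMk
    ((h.smooth_fibre i).const_smul c)
  periodic i t := by
    have : Complex.exp (Θ i (t + 1) * Complex.I) = Complex.exp (Θ i t * Complex.I) := by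
      rw [← cos_sub_eq_one_iff_exp, h.angle_add_one, Real.cos_eq_one_iff]
      exact ⟨p i, by ring⟩
    rw [polarCurve, polarCurve, this, h.fibre_periodic]
  ne_zero i t h0 := by
    have h1 := congrArg Prod.fst h0
    simp only [polarCurve, Prod.fst_zero] at h1
    have h2 := congrArg norm (eq_neg_of_add_eq_zero_left h1)
    rw [Complex.norm_exp_ofReal_mul_I, norm_neg, Complex.norm_real, Real.norm_of_nonneg ha0] at h2
    linarith
  immersion i t b hb := by
    have h1 := ((h.smooth_angle i).differentiable (by simp) t).hasDerivAt
    have h2 := ((h.smooth_fibre i).differentiable (by simp) t).hasDerivAt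
    have h3 : HasDerivAt (polarCurve Θ u a c i) _ t :=
      ((hasDerivAt_exp_angle h1).add_const (a : ℂ)).prodMk (h2.const_smul c)
    rw [h3.deriv] at hb
    have hb1 := congrArg Prod.fst hb
    have hb2 := congrArg Prod.snd hb
    simp only [polarCurve, Prod.smul_fst, Prod.smul_snd, Complex.real_smul] at hb1 hb2
    have hre := congrArg Complex.re hb1
    have him := congrArg Complex.im hb1
    simp [Complex.exp_ofReal_mul_I_re, Complex.exp_ofReal_mul_I_im] at hre him
    have hsc := Real.sin_sq_add_cos_sq (Θ i t)
    -- The component along `exp (i Θ)`: the velocity of the circle is orthogonal to it.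
    have hb0 : b * (1 + a * Real.cos (Θ i t)) = 0 := by
      linear_combination Real.cos (Θ i t) * (-hre) - Real.sin (Θ i t) * him - b * hsc
    have hpos : 0 < 1 + a * Real.cos (Θ i t) := by
      nlinarith [Real.neg_one_le_cos (Θ i t)]
    have hb' : b = 0 := (mul_eq_zero.1 hb0).resolve_right hpos.ne'
    have hd : deriv (Θ i) t = 0 := by
      rw [hb'] at hre him
      linear_combination Real.cos (Θ i t) * him - Real.sin (Θ i t) * hre - deriv (Θ i) t * hsc
    apply h.immersion i t hd
    simp [hb', hc.ne'] at hb2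
    exact hb2
  injective i j s t b hb hst := by
    have h1 := congrArg Prod.fst hst
    have h2 := congrArg Prod.snd hst
    simp only [polarCurve, Prod.smul_fst, Prod.smul_snd, Complex.real_smul] at h1 h2
    -- If `b < 1`, then `exp (i Θ s) = b exp (i Θ t) - (1 - b) a` has norm at most `b + (1 - b) a <
    -- 1`; the case `b > 1` is symmetric.
    have hb1 : b = 1 := by
      rcases lt_trichotomy b 1 with hlt | heq | hgt
      · have h3 : Complex.exp (Θ i s * Complex.I) =
            b * Complex.exp (Θ j t * Complex.I) + ((-((1 - b) * a) : ℝ) : ℂ) := by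
          push_cast; linear_combination h1
        have h4 := norm_add_le ((b : ℂ) * Complex.exp (Θ j t * Complex.I))
          ((-((1 - b) * a) : ℝ) : ℂ)
        rw [← h3, norm_mul, Complex.norm_exp_ofReal_mul_I, Complex.norm_exp_ofReal_mul_I,
          Complex.norm_real, Complex.norm_real, Real.norm_of_nonneg hb.le, norm_neg,
          Real.norm_of_nonneg (mul_nonneg (by linarith) ha0)] at h4
        nlinarith
      · exact heq
      · have h3 : (b : ℂ) * Complex.exp (Θ j t * Complex.I) =
            Complex.exp (Θ i s * Complex.I) + ((-((b - 1) * a) : ℝ) : ℂ) := by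
          push_cast; linear_combination -h1
        have h4 := norm_add_le (Complex.exp (Θ i s * Complex.I)) ((-((b - 1) * a) : ℝ) : ℂ)
        rw [← h3, norm_mul, Complex.norm_exp_ofReal_mul_I, Complex.norm_exp_ofReal_mul_I,
          Complex.norm_real, Complex.norm_real, Real.norm_of_nonneg hb.le, norm_neg,
          Real.norm_of_nonneg (mul_nonneg (by linarith) ha0)] at h4
        nlinarith
    subst hb1
    simp only [Complex.ofReal_one, one_mul, add_left_inj] at h1 h2
    rw [← cos_sub_eq_one_iff_exp, Real.cos_eq_one_iff] at h1
    obtain ⟨k, hk⟩ := h1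
    refine h.injective i j s t k (by linarith) ?_
    have hc' : (c : ℂ) ≠ 0 := by exact_mod_cast hc.ne'
    exact mul_left_cancel₀ hc' h2

end IsPolar

/-- A smooth closed curve in `ℂ \ {0}` has a smooth angle function. -/
lemma exists_smooth_angle {z : ℝ → ℂ} (hz : ContDiff ℝ ∞ z) (hz0 : ∀ t, z t ≠ 0)
    (hper : ∀ t, z (t + 1) = z t) :
    ∃ (Θ : ℝ → ℝ) (p : ℤ), ContDiff ℝ ∞ Θ ∧ (∀ t, Θ (t + 1) = Θ t + 2 * Real.pi * p) ∧
      (∀ t, deriv Θ t = (deriv z t / z t).im) ∧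
      ∀ t, z t = ‖z t‖ * Complex.exp (Θ t * Complex.I) := by
  have hz' : ContDiff ℝ ∞ (deriv z) := (contDiff_infty_iff_deriv.1 hz).2
  have hq : ContDiff ℝ ∞ (fun t => deriv z t / z t) := by
    simp only [div_eq_mul_inv]
    exact hz'.mul (hz.inv hz0)
  have hqi : ContDiff ℝ ∞ (fun t => (deriv z t / z t).im) := Complex.imCLM.contDiff.comp hq
  have hqr : ContDiff ℝ ∞ (fun t => (deriv z t / z t).re) := Complex.reCLM.contDiff.comp hq
  -- The imaginary and real parts of `∫ z' / z` are the lifted angle and the logarithm of the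
  -- modulus, up to their initial values.
  set Θ : ℝ → ℝ := fun t => (z 0).arg + ∫ x in (0 : ℝ)..t, (deriv z x / z x).im with hΘ
  set R : ℝ → ℝ := fun t => ∫ x in (0 : ℝ)..t, (deriv z x / z x).re with hR
  have hΘd : ∀ t, HasDerivAt Θ (deriv z t / z t).im t := fun t =>
    (hqi.continuous.integral_hasStrictDerivAt 0 t).hasDerivAt.const_add _
  have hRd : ∀ t, HasDerivAt R (deriv z t / z t).re t := fun t =>
    (hqr.continuous.integral_hasStrictDerivAt 0 t).hasDerivAt
  have hΘs : ContDiff ℝ ∞ Θ := by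
    rw [contDiff_infty_iff_deriv]
    refine ⟨fun t => (hΘd t).differentiableAt, ?_⟩
    rw [show deriv Θ = fun t => (deriv z t / z t).im from funext fun t => (hΘd t).deriv]
    exact hqi
  have hmain : ∀ t, z t = (‖z 0‖ * Real.exp (R t) : ℝ) * Complex.exp (Θ t * Complex.I) := by
    have hconst : ∀ t, z t * Complex.exp (-(R t + Θ t * Complex.I)) =
        z 0 * Complex.exp (-(R 0 + Θ 0 * Complex.I)) := by
      have hd : ∀ t, HasDerivAt (fun t => z t * Complex.exp (-(R t + Θ t * Complex.I))) 0 t := by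
        intro t
        have h1 := (hz.differentiable (by simp) t).hasDerivAt
        have h2 := ((hRd t).ofReal_comp.add ((hΘd t).ofReal_comp.mul_const Complex.I)).neg.cexp
        have h3 := h1.mul h2
        rw [Complex.re_add_im (deriv z t / z t)] at h3
        refine HasDerivAt.congr_deriv h3 ?_
        have := hz0 t
        generalize Complex.exp _ = E
        field_simp
        ring
      intro t
      exact is_const_of_deriv_eq_zero (fun t => (hd t).differentiableAt) (fun t => (hd t).deriv) t 0
    intro t
    have h0 : z 0 * Complex.exp (-(R 0 + Θ 0 * Complex.I)) = ‖z 0‖ := by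
      have hR0 : R 0 = 0 := by simp [hR]
      have hΘ0 : Θ 0 = (z 0).arg := by simp [hΘ]
      rw [hR0, hΘ0]
      nth_rewrite 1 [← Complex.norm_mul_exp_arg_mul_I (z 0)]
      rw [mul_assoc, ← Complex.exp_add]
      simp
    have h1 := hconst t
    rw [h0, Complex.exp_neg, ← div_eq_mul_inv, div_eq_iff (Complex.exp_ne_zero _),
      Complex.exp_add] at h1
    rw [h1]
    push_cast
    ring
  have hnorm : ∀ t, ‖z t‖ = ‖z 0‖ * Real.exp (R t) := by
    intro t
    nth_rewrite 1 [hmain t]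
    rw [norm_mul, Complex.norm_exp_ofReal_mul_I, Complex.norm_real, mul_one,
      Real.norm_of_nonneg (by positivity)]
  have hmain' : ∀ t, z t = ‖z t‖ * Complex.exp (Θ t * Complex.I) := by
    intro t
    rw [hnorm t]
    exact hmain t
  have hp : ∃ p : ℤ, Θ 1 - Θ 0 = 2 * Real.pi * p := by
    have h1 := hmain' 1
    have h2 := hmain' 0
    have h3 : z 1 = z 0 := by simpa using hper 0
    have hn : (‖z 0‖ : ℂ) ≠ 0 := by
      exact_mod_cast (norm_pos_iff.2 (hz0 0)).ne'
    rw [h3, h2] at h1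
    simp only [norm_mul, Complex.norm_exp_ofReal_mul_I, mul_one, Complex.norm_real,
      norm_norm] at h1
    have h4 := (mul_left_cancel₀ hn h1).symm
    rw [← cos_sub_eq_one_iff_exp, Real.cos_eq_one_iff] at h4
    obtain ⟨n, hn⟩ := h4
    exact ⟨n, by linarith⟩
  obtain ⟨p, hp⟩ := hp
  refine ⟨Θ, p, hΘs, ?_, fun t => (hΘd t).deriv, hmain'⟩
  have hderper : ∀ t, deriv z (t + 1) = deriv z t := by
    intro t
    rw [← deriv_comp_add_const]
    congr 1
    exact funext hper
  -- The increment over a period does not depend on the starting point, because `z' / z` is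
  -- periodic.
  have hd : ∀ t, HasDerivAt (fun t => Θ (t + 1) - Θ t) 0 t := by
    intro t
    have := ((hΘd (t + 1)).comp_add_const t 1).sub (hΘd t)
    rw [hper, hderper, sub_self] at this
    exact this
  intro t
  have := is_const_of_deriv_eq_zero (fun t => (hd t).differentiableAt) (fun t => (hd t).deriv) t 0
  simp only [zero_add] at this
  linarith

namespace SmoothLink

variable {m : ℕ}

/-- A link in the complement of the binding has a polar form. -/
theorem exists_polar (K : SmoothLink m) (hK : K.AvoidsBinding) :
    ∃ Θ u p, IsPolar Θ u p ∧ (∀ i t, K.curve i t = toSphere (polarCurve Θ u 0 1 i t)) ∧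
      ∀ i t, K.angleDeriv i t = deriv (Θ i) t := by
  have hz : ∀ i, ContDiff ℝ ∞ (fun t => (K.curve i t).1) := fun i => contDiff_fst.comp (K.smooth i)
  have hw : ∀ i, ContDiff ℝ ∞ (fun t => (K.curve i t).2) := fun i => contDiff_snd.comp (K.smooth i)
  choose Θ p hΘs hΘ1 hΘd hΘz using fun i => exists_smooth_angle (hz i) (hK i)
    (fun t => by rw [K.periodic])
  have hn : ∀ i t, 0 < ‖(K.curve i t).1‖ := fun i t => norm_pos_iff.2 (hK i t)
  have hns : ∀ i, ContDiff ℝ ∞ (fun t => ‖(K.curve i t).1‖) := fun i => (hz i).norm ℝ (hK i)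
  set u : Fin m → ℝ → ℂ := fun i t => ‖(K.curve i t).1‖⁻¹ • (K.curve i t).2 with hu
  have hcurve : ∀ i t, K.curve i t = ‖(K.curve i t).1‖ • polarCurve Θ u 0 1 i t := by
    intro i t
    ext1
    · rw [Prod.smul_fst, polarCurve, Complex.real_smul]
      simpa using hΘz i t
    · rw [Prod.smul_snd, polarCurve]
      simp only [one_smul, hu]
      rw [smul_smul, mul_inv_cancel₀ (hn i t).ne', one_smul]
  have hsph : ∀ i t, K.curve i t = toSphere (polarCurve Θ u 0 1 i t) := by
    intro i t
    rw [← toSphere_smul (hn i t), ← hcurve, toSphere_of_mem (K.mem_sphere i t)]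
  have hus : ∀ i, ContDiff ℝ ∞ (u i) := fun i => ((hns i).inv fun t => (hn i t).ne').smul (hw i)
  refine ⟨Θ, u, p, ⟨hΘs, hus, hΘ1, ?_, ?_, ?_⟩, hsph, fun i t => (hΘd i t).symm⟩
  · intro i t
    simp only [hu, K.periodic]
  -- If both `Θ'` and `u'` vanished, only the factor `|z|` would vary to first order, and the
  -- velocity of the link would be radial.
  · intro i t h0 h1
    have hd1 := ((hΘs i).differentiable (by simp) t).hasDerivAt
    have hd2 := ((hus i).differentiable (by simp) t).hasDerivAt
    have hd3 := ((hns i).differentiable (by simp) t).hasDerivAt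
    rw [h0] at hd1
    rw [h1] at hd2
    have h3 : HasDerivAt (polarCurve Θ u 0 1 i) _ t :=
      ((hasDerivAt_exp_angle hd1).add_const ((0 : ℝ) : ℂ)).prodMk (hd2.const_smul (1 : ℝ))
    have h4 := (hd3.smul h3).deriv
    change deriv (fun t => ‖(K.curve i t).1‖ • polarCurve Θ u 0 1 i t) t = _ at h4
    rw [show (fun t => ‖(K.curve i t).1‖ • polarCurve Θ u 0 1 i t) = K.curve i from
      funext fun t => (hcurve i t).symm] at h4
    apply K.isConeLink.immersion i t
      (deriv (fun t => ‖(K.curve i t).1‖) t * ‖(K.curve i t).1‖⁻¹)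
    have h5 : polarCurve Θ u 0 1 i t = ‖(K.curve i t).1‖⁻¹ • K.curve i t := by
      calc polarCurve Θ u 0 1 i t = ‖(K.curve i t).1‖⁻¹ •
            (‖(K.curve i t).1‖ • polarCurve Θ u 0 1 i t) := by
            rw [smul_smul, inv_mul_cancel₀ (hn i t).ne', one_smul]
        _ = _ := by rw [← hcurve]
    rw [h4, h5, mul_smul]
    simp
  · intro i j s t k hk huu
    apply K.injective i j s t
    rw [hsph, hsph]
    congr 1
    simp only [polarCurve, huu]
    congr 2
    rw [← cos_sub_eq_one_iff_exp, Real.cos_eq_one_iff]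
    exact ⟨k, by linarith⟩

lemma pageCount_eq_of_polar {K : SmoothLink m} {Θ : Fin m → ℝ → ℝ} {u : Fin m → ℝ → ℂ}
    {p : Fin m → ℤ} (h : IsPolar Θ u p)
    (hK : ∀ i t, K.curve i t = toSphere (polarCurve Θ u 0 1 i t)) (θ : ℝ) :
    K.pageCount θ =
      {q : Fin m × ℝ | q.2 ∈ Set.Ico (0 : ℝ) 1 ∧ Real.cos (Θ q.1 q.2 - θ) = 1}.encard := by
  have hc := h.isConeLink le_rfl zero_lt_one zero_lt_one
  have hK' : K = hc.toLink := ext_curve hK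
  rw [hK', hc.toLink_pageCount]
  congr 1
  ext q
  simp only [Set.mem_ofPred_eq]
  refine and_congr_right fun _ => ?_
  rw [cos_sub_eq_one_iff_exp]
  simp only [polarCurve, Complex.ofReal_zero, add_zero]
  constructor
  · rintro ⟨r, hr, hrq⟩
    have := congrArg norm hrq
    rw [norm_mul, Complex.norm_exp_ofReal_mul_I, Complex.norm_exp_ofReal_mul_I,
      Complex.norm_real, Real.norm_of_nonneg hr.le] at this
    rw [hrq, show r = 1 by linarith]
    simp
  · intro hq
    exact ⟨1, one_pos, by simp [hq]⟩

end SmoothLink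

/-! ### Counting parameters of periodic conditions -/

/-- An injection principle for periodic conditions: `R` attaches to every `P`-point a `Q`-point that
serves no other `P`-point. The attached point may leave `[0, 1)`, so it is reduced modulo `1`;
translation invariance of `R` keeps the map injective. -/
lemma encard_Ico_le_of_rel {ι : Type*} {P Q : ι → ℝ → Prop} (R : ι → ℝ → ℝ → Prop)
    (hP : ∀ i t (k : ℤ), P i t → P i (t + k)) (hQ : ∀ i t (k : ℤ), Q i t → Q i (t + k))
    (hR : ∀ i t s (k : ℤ), R i t s → R i (t + k) (s + k))
    (hex : ∀ i t, P i t → ∃ s, Q i s ∧ R i t s)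
    (huniq : ∀ i t t' s, P i t → P i t' → Q i s → R i t s → R i t' s → t = t') :
    {q : ι × ℝ | q.2 ∈ Set.Ico (0 : ℝ) 1 ∧ P q.1 q.2}.encard ≤
      {q : ι × ℝ | q.2 ∈ Set.Ico (0 : ℝ) 1 ∧ Q q.1 q.2}.encard := by
  classical
  choose! f hfQ hfR using hex
  refine Set.encard_le_encard_of_injOn (f := fun q => (q.1, Int.fract (f q.1 q.2))) ?_ ?_
  · rintro ⟨i, t⟩ ⟨-, hPt⟩
    refine ⟨⟨Int.fract_nonneg _, Int.fract_lt_one _⟩, ?_⟩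
    have := hQ i _ (-⌊f i t⌋) (hfQ i t hPt)
    simpa [Int.fract, sub_eq_add_neg] using this
  · rintro ⟨i, t⟩ ⟨ht, hPt⟩ ⟨j, t'⟩ ⟨ht', hPt'⟩ h
    simp only [Prod.mk.injEq] at h
    obtain ⟨rfl, h⟩ := h
    obtain ⟨k, hk⟩ := Int.fract_eq_fract.1 h
    have hs : f i t' + k = f i t := by linarith
    have h1 := hR i _ _ k (hfR i t' hPt')
    rw [hs] at h1
    have h2 := huniq i t (t' + k) _ hPt (hP _ _ k hPt') (hfQ i t hPt) (hfR i t hPt) h1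
    simp only [Set.mem_Ico] at ht ht'
    have h3 : (k : ℝ) < 1 := by linarith
    have h4 : (-1 : ℝ) < k := by linarith
    have h5 : k < 1 := by exact_mod_cast h3
    have h6 : -1 < k := by exact_mod_cast h4
    have : k = 0 := by omega
    simp [h2, this]

/-! ### Simple zeros of periodic functions -/

lemma periodic_deriv {g : ℝ → ℝ} {c : ℝ} (hg : ∀ t, g (t + 1) = g t + c) (t : ℝ) :
    deriv g (t + 1) = deriv g t := by
  rw [← deriv_comp_add_const, funext hg, deriv_add_const]

lemma periodic_add_int {α : Type*} {g : ℝ → α} (hg : ∀ t, g (t + 1) = g t) (t : ℝ) (k : ℤ) :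
    g (t + k) = g t := by
  simpa using (show Function.Periodic g 1 from hg).int_mul k t

lemma eventually_lt_of_deriv_neg {g : ℝ → ℝ} {t : ℝ} (h0 : g t = 0) (hd : deriv g t < 0) :
    (∃ ε > 0, ∀ x, t < x → x < t + ε → g x < 0) ∧ ∃ ε > 0, ∀ x, t - ε < x → x < t → 0 < g x := by
  have hdiff : HasDerivAt g (deriv g t) t :=
    (differentiableAt_of_deriv_ne_zero hd.ne).hasDerivAt
  have h1 := (hasDerivAt_iff_tendsto_slope.1 hdiff).eventually (gt_mem_nhds hd)
  rw [eventually_nhdsWithin_iff, Metric.eventually_nhds_iff] at h1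
  obtain ⟨ε, hε, h1⟩ := h1
  constructor
  · refine ⟨ε, hε, fun x hx hx' => ?_⟩
    have := h1 (y := x) (by rw [Real.dist_eq, abs_lt]; constructor <;> linarith) hx.ne'
    rw [slope_def_field, h0, sub_zero, div_neg_iff] at this
    rcases this with h | h
    · linarith [h.2]
    · exact h.1
  · refine ⟨ε, hε, fun x hx hx' => ?_⟩
    have := h1 (y := x) (by rw [Real.dist_eq, abs_lt]; constructor <;> linarith) hx'.ne
    rw [slope_def_field, h0, sub_zero, div_neg_iff] at this
    rcases this with h | h
    · exact h.1
    · linarith [h.2]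

/-- The first zero `s` after `t` exists because `t + 1` is a zero. The function is negative just
after `t`; a second downward crossing at `s` would require positive values just before `s`, hence an
earlier zero. -/
lemma exists_next_zero {g : ℝ → ℝ} (hg : Differentiable ℝ g) (hper : ∀ t, g (t + 1) = g t)
    (hs : ∀ t, g t = 0 → deriv g t ≠ 0) {t : ℝ} (h0 : g t = 0) (hd : deriv g t < 0) :
    ∃ s, g s = 0 ∧ 0 < deriv g s ∧ t < s ∧ ∀ x, t < x → x < s → g x ≠ 0 := by
  obtain ⟨⟨ε, hε, h1⟩, -⟩ := eventually_lt_of_deriv_neg h0 hd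
  set e := min (ε / 2) (1 / 2) with he
  have he0 : 0 < e := by positivity
  have he1 : e ≤ ε / 2 := min_le_left _ _
  have he2 : e ≤ 1 / 2 := min_le_right _ _
  have hcomp : IsCompact (Set.Icc (t + e) (t + 1) ∩ g ⁻¹' {0}) :=
    isCompact_Icc.inter_right (isClosed_singleton.preimage hg.continuous)
  obtain ⟨s, ⟨⟨hs1, hs2⟩, hs0⟩, hmin⟩ := hcomp.exists_isLeast
    ⟨t + 1, ⟨by linarith, le_rfl⟩, by simp [hper, h0]⟩
  have hs0 : g s = 0 := hs0
  have hte : g (t + e) < 0 := h1 _ (by linarith) (by linarith)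
  have hlt : t + e < s := by
    refine lt_of_le_of_ne hs1 ?_
    rintro rfl
    linarith
  have hnz : ∀ x, t < x → x < s → g x ≠ 0 := by
    intro x hx hxs hx0
    rcases lt_or_ge x (t + e) with h | h
    · have := h1 x hx (by linarith)
      linarith
    · have := hmin ⟨⟨h, by linarith⟩, hx0⟩
      linarith
  refine ⟨s, hs0, ?_, by linarith, hnz⟩
  by_contra! hle
  obtain ⟨-, ε', hε', h2⟩ := eventually_lt_of_deriv_neg hs0 (lt_of_le_of_ne hle (hs s hs0))
  -- A point between `t + e` and `s` that is close enough to `s` for `g` to be positive there.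
  set y := max (s - ε' / 2) ((t + e + s) / 2) with hy
  have hy1 : s - ε' / 2 ≤ y := le_max_left _ _
  have hy2 : (t + e + s) / 2 ≤ y := le_max_right _ _
  have hys : y < s := max_lt (by linarith) (by linarith)
  have hgy := h2 y (by linarith) hys
  obtain ⟨x, ⟨hx1, hx2⟩, hx⟩ := intermediate_value_Icc (by linarith : t + e ≤ y)
    hg.continuous.continuousOn ⟨hte.le, hgy.le⟩
  exact hnz x (by linarith) (by linarith) hx

/-- On closed curves, sign changes from plus to minus are not more frequent than those from minus
to plus. -/
lemma encard_neg_zeros_le {ι : Type*} {g : ι → ℝ → ℝ} (hg : ∀ i, Differentiable ℝ (g i))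
    (hper : ∀ i t, g i (t + 1) = g i t) (hs : ∀ i t, g i t = 0 → deriv (g i) t ≠ 0) :
    {q : ι × ℝ | q.2 ∈ Set.Ico (0 : ℝ) 1 ∧ (g q.1 q.2 = 0 ∧ deriv (g q.1) q.2 < 0)}.encard ≤
    {q : ι × ℝ | q.2 ∈ Set.Ico (0 : ℝ) 1 ∧ (g q.1 q.2 = 0 ∧ 0 < deriv (g q.1) q.2)}.encard := by
  have hp : ∀ i t (k : ℤ), g i (t + k) = g i t := fun i => periodic_add_int (hper i)
  have hpd : ∀ i t (k : ℤ), deriv (g i) (t + k) = deriv (g i) t := fun i =>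
    periodic_add_int (periodic_deriv (c := 0) (by simpa using hper i))
  refine encard_Ico_le_of_rel (P := fun i t => g i t = 0 ∧ deriv (g i) t < 0)
    (Q := fun i t => g i t = 0 ∧ 0 < deriv (g i) t)
    (fun i t s => t < s ∧ ∀ x, t < x → x < s → g i x ≠ 0) ?_ ?_ ?_ ?_ ?_
  · intro i t k h; rwa [hp, hpd]
  · intro i t k h; rwa [hp, hpd]
  · rintro i t s k ⟨h1, h2⟩
    refine ⟨by linarith, fun x hx hx' => ?_⟩
    have := h2 (x + (-k : ℤ)) (by push_cast; linarith) (by push_cast; linarith)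
    rwa [hp] at this
  · rintro i t ⟨h1, h2⟩
    obtain ⟨s, hs1, hs2, hs3, hs4⟩ := exists_next_zero (hg i) (hper i) (hs i) h1 h2
    exact ⟨s, ⟨hs1, hs2⟩, hs3, hs4⟩
  · rintro i t t' s ⟨h1, -⟩ ⟨h1', -⟩ - ⟨h3, h4⟩ ⟨h3', h4'⟩
    rcases lt_trichotomy t t' with h | h | h
    · exact absurd h1' (h4 t' h h3')
    · exact h
    · exact absurd h1 (h4' t h h3)

lemma exists_pos_le_of_periodic {f : ℝ → ℝ} (hf : Continuous f) (hper : ∀ t, f (t + 1) = f t)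
    (hpos : ∀ t, 0 < f t) : ∃ c > 0, ∀ t, c ≤ f t := by
  have hc := (show Function.Periodic f 1 from hper).compact_of_continuous one_ne_zero hf
  obtain ⟨c, ⟨t, rfl⟩, hmin⟩ := hc.exists_isLeast (Set.range_nonempty f)
  exact ⟨f t, hpos t, fun s => hmin ⟨s, rfl⟩⟩

lemma exists_abs_le_of_periodic {f : ℝ → ℝ} (hf : Continuous f) (hper : ∀ t, f (t + 1) = f t) :
    ∃ B > 0, ∀ t, |f t| ≤ B := by
  -- A positive lower bound of `(1 + |f|)⁻¹` is an upper bound of `|f|`.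
  obtain ⟨c, hc, h⟩ := exists_pos_le_of_periodic (f := fun t => (1 + |f t|)⁻¹)
    (by
      have : ∀ t, 1 + |f t| ≠ 0 := fun t => by positivity
      fun_prop (disch := assumption)) (fun t => by rw [hper]) (fun t => by positivity)
  refine ⟨c⁻¹, by positivity, fun t => ?_⟩
  have := h t
  rw [le_inv_comm₀ hc (by positivity)] at this
  linarith

lemma uniformContinuous_of_periodic {f : ℝ → ℝ} (hf : Continuous f)
    (hper : ∀ t, f (t + 1) = f t) : UniformContinuous f := by
  have hp := periodic_add_int hper
  have h := isCompact_Icc.uniformContinuousOn_of_continuous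
    (hf.continuousOn (s := Set.Icc (-1 : ℝ) 2))
  rw [Metric.uniformContinuousOn_iff] at h
  rw [Metric.uniformContinuous_iff]
  intro ε hε
  obtain ⟨δ, hδ, h⟩ := h ε hε
  refine ⟨min δ 1, by positivity, fun {x y} hxy => ?_⟩
  have h1 : dist x y < δ := hxy.trans_le (min_le_left _ _)
  have h2 : dist x y < 1 := hxy.trans_le (min_le_right _ _)
  rw [Real.dist_eq, abs_lt] at h2
  have h3 := Int.floor_le x
  have h4 := Int.lt_floor_add_one x
  have := h (x + (-⌊x⌋ : ℤ)) (by push_cast; constructor <;> linarith) (y + (-⌊x⌋ : ℤ))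
    (by push_cast; constructor <;> linarith) (by rwa [dist_add_right])
  rwa [hp, hp] at this

/-- Zeros of a periodic function with simple zeros are stable under small perturbations. -/
lemma perturb_zeros {g k : ℝ → ℝ} (hg : ContDiff ℝ ∞ g) (hk : ContDiff ℝ ∞ k)
    (hgp : ∀ t, g (t + 1) = g t) (hkp : ∀ t, k (t + 1) = k t)
    (hs : ∀ t, g t = 0 → deriv g t ≠ 0) :
    ∃ ρ > 0, ∃ η₀ > 0, ∀ η, 0 < η → η < η₀ →
      (∀ t, g t + η * k t = 0 → deriv (fun t => g t + η * k t) t ≠ 0) ∧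
      (∀ t, g t + η * k t = 0 → deriv (fun t => g t + η * k t) t < 0 →
        ∃ s, (g s = 0 ∧ deriv g s < 0) ∧ |t - s| < ρ) ∧
      (∀ t t' s, g t + η * k t = 0 → g t' + η * k t' = 0 → g s = 0 → deriv g s < 0 →
        |t - s| < ρ → |t' - s| < ρ → t = t') := by
  have hg' : ContDiff ℝ ∞ (deriv g) := (contDiff_infty_iff_deriv.1 hg).2
  have hk' : ContDiff ℝ ∞ (deriv k) := (contDiff_infty_iff_deriv.1 hk).2
  have hg'p : ∀ t, deriv g (t + 1) = deriv g t := periodic_deriv (c := 0) (by simpa using hgp)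
  have hk'p : ∀ t, deriv k (t + 1) = deriv k t := periodic_deriv (c := 0) (by simpa using hkp)
  -- Simplicity of the zeros means that `|g|` and `|g'|` never vanish together; by compactness `|g'|
  -- ≥ 2c` wherever `|g| < 2c`.
  obtain ⟨c', hc', hcm⟩ := exists_pos_le_of_periodic (f := fun t => max |g t| |deriv g t|)
    (hg.continuous.abs.max hg'.continuous.abs) (fun t => by rw [hgp, hg'p]) (fun t => by
      by_cases h : g t = 0
      · exact lt_max_of_lt_right (abs_pos.2 (hs t h))
      · exact lt_max_of_lt_left (abs_pos.2 h))
  obtain ⟨c, rfl⟩ : ∃ c, c' = 2 * c := ⟨c' / 2, by ring⟩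
  have hc : 0 < c := by linarith
  obtain ⟨B₁, hB₁, hkB⟩ := exists_abs_le_of_periodic hk.continuous hkp
  obtain ⟨B₂, hB₂, hk'B⟩ := exists_abs_le_of_periodic hk'.continuous hk'p
  obtain ⟨ρ', hρ', huc⟩ := Metric.uniformContinuous_iff.1
    (uniformContinuous_of_periodic hg'.continuous hg'p) (c / 2) (by positivity)
  obtain ⟨ρ, rfl⟩ : ∃ ρ, ρ' = 2 * ρ := ⟨ρ' / 2, by ring⟩
  have hρ : 0 < ρ := by linarith
  have huc : ∀ x y, |x - y| ≤ ρ → |deriv g x - deriv g y| < c / 2 := fun x y h => by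
    have := huc (a := x) (b := y) (by rw [Real.dist_eq]; linarith)
    rwa [Real.dist_eq] at this
  -- With these bounds `η |k|` and `η |k'|` stay below `c / 2`, which preserves the sign of the
  -- derivative near zeros, and below `c ρ`, which is the least change of `g` over a distance `ρ`
  -- there.
  refine ⟨ρ, hρ, min (c / 2 / (B₁ + B₂)) (c * ρ / (B₁ + B₂)), by positivity, fun η hη hη' => ?_⟩
  have hη1 : η * (B₁ + B₂) < c / 2 := by
    rw [← lt_div_iff₀ (by positivity)]; exact hη'.trans_le (min_le_left _ _)
  have hη2 : η * (B₁ + B₂) < c * ρ := by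
    rw [← lt_div_iff₀ (by positivity)]; exact hη'.trans_le (min_le_right _ _)
  have hB1 : ∀ t, |η * k t| ≤ η * (B₁ + B₂) := fun t => by
    rw [abs_mul, abs_of_pos hη]
    exact mul_le_mul_of_nonneg_left (by linarith [hkB t]) hη.le
  have hB2 : ∀ t, |η * deriv k t| ≤ η * (B₁ + B₂) := fun t => by
    rw [abs_mul, abs_of_pos hη]
    exact mul_le_mul_of_nonneg_left (by linarith [hk'B t]) hη.le
  have hd : ∀ t, HasDerivAt (fun t => g t + η * k t) (deriv g t + η * deriv k t) t := fun t =>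
    (hg.differentiable (by simp) t).hasDerivAt.add
      ((hk.differentiable (by simp) t).hasDerivAt.const_mul η)
  have hbig : ∀ t, |g t| < 2 * c → 2 * c ≤ |deriv g t| := fun t h => by
    rcases le_max_iff.1 (hcm t) with h' | h'
    · linarith
    · exact h'
  have hzero : ∀ t, g t + η * k t = 0 → |g t| ≤ η * (B₁ + B₂) := fun t h => by
    rw [show g t = -(η * k t) by linarith, abs_neg]; exact hB1 t
  refine ⟨fun t ht h0 => ?_, fun t ht h0 => ?_, fun t t' s ht ht' hs0 hs1 h1 h2 => ?_⟩
  · rw [(hd t).deriv] at h0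
    have h1 := hbig t (by linarith [hzero t ht])
    rw [show deriv g t = -(η * deriv k t) by linarith, abs_neg] at h1
    linarith [hB2 t]
  · rw [(hd t).deriv] at h0
    have h1 := hbig t (by linarith [hzero t ht])
    have h2 := abs_le.1 (hB2 t)
    have h3 : deriv g t ≤ -(2 * c) := by
      rcases le_abs.1 h1 with h | h <;> linarith [h2.1]
    have hneg : ∀ x, |x - t| ≤ ρ → deriv g x ≤ -c := fun x hx => by
      have := (abs_lt.1 (huc x t hx)).2
      linarith
    have hgt := abs_le.1 (hzero t ht)
    have hdif : Differentiable ℝ g := hg.differentiable (by simp)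
    -- By the mean value theorem `g` falls by at least `c ρ > |g t|` on either side of `t`, so it
    -- changes sign within `ρ` of `t`.
    obtain ⟨x₁, hx₁, he₁⟩ := exists_deriv_eq_slope g (by linarith : t < t + ρ)
      hdif.continuous.continuousOn hdif.differentiableOn
    obtain ⟨x₂, hx₂, he₂⟩ := exists_deriv_eq_slope g (by linarith : t - ρ < t)
      hdif.continuous.continuousOn hdif.differentiableOn
    rw [eq_div_iff (by linarith)] at he₁ he₂
    have hn1 := hneg x₁ (abs_le.2 ⟨by linarith [hx₁.1], by linarith [hx₁.2]⟩)
    have hn2 := hneg x₂ (abs_le.2 ⟨by linarith [hx₂.1], by linarith [hx₂.2]⟩)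
    have hr : g (t + ρ) < 0 := by nlinarith
    have hl : 0 < g (t - ρ) := by nlinarith
    obtain ⟨s, ⟨hs1, hs2⟩, hs0⟩ := intermediate_value_Ioo' (by linarith : t - ρ ≤ t + ρ)
      hdif.continuous.continuousOn ⟨hr, hl⟩
    have hts : |t - s| < ρ := abs_lt.2 ⟨by linarith, by linarith⟩
    refine ⟨s, ⟨hs0, ?_⟩, hts⟩
    linarith [hneg s (by rw [abs_sub_comm]; exact hts.le)]
  · have h3 : deriv g s ≤ -(2 * c) := by
      have := hbig s (by rw [hs0, abs_zero]; positivity)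
      rw [abs_of_neg hs1] at this
      linarith
    -- The perturbed function is strictly decreasing within `ρ` of `s`, hence has at most one zero
    -- there.
    have hanti : StrictAntiOn (fun t => g t + η * k t) (Set.Icc (s - ρ) (s + ρ)) := by
      refine strictAntiOn_of_deriv_neg (convex_Icc _ _)
        (fun x _ => (hd x).continuousAt.continuousWithinAt) fun x hx => ?_
      rw [interior_Icc] at hx
      rw [(hd x).deriv]
      have h4 := (abs_lt.1 (huc x s (abs_le.2 ⟨by linarith [hx.1], by linarith [hx.2]⟩))).2
      have h5 := (abs_le.1 (hB2 x)).2
      linarith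
    have m1 := abs_lt.1 h1
    have m2 := abs_lt.1 h2
    exact hanti.injOn ⟨by linarith [m1.1], by linarith [m1.2]⟩
      ⟨by linarith [m2.1], by linarith [m2.2]⟩ (by simp only [ht, ht'])

/-! ### Averaging the number of intersections over nearby pages -/

section Levels

open Filter Topology

variable {ι : Type*} {Θ : ι → ℝ → ℝ} {p : ι → ℤ}

lemma cos_angle_add_one {f : ℝ → ℝ} {n : ℤ} (hf : ∀ t, f (t + 1) = f t + 2 * Real.pi * n)
    (x t : ℝ) : Real.cos (f (t + 1) - x) = Real.cos (f t - x) := by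
  rw [hf, ← Real.cos_add_int_mul_two_pi (f t - x) n]
  congr 1
  ring

lemma cos_angle_add_int {f : ℝ → ℝ} {n : ℤ} (hf : ∀ t, f (t + 1) = f t + 2 * Real.pi * n)
    (x t : ℝ) (k : ℤ) : Real.cos (f (t + k) - x) = Real.cos (f t - x) :=
  periodic_add_int (g := fun t => Real.cos (f t - x)) (cos_angle_add_one hf x) t k

lemma angle_sub_add_int {f : ℝ → ℝ} {n : ℤ} (hf : ∀ t, f (t + 1) = f t + 2 * Real.pi * n)
    (s t : ℝ) (k : ℤ) : f (t + k) - f (s + k) = f t - f s := by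
  have h := periodic_add_int (g := fun t => f t - 2 * Real.pi * n * t)
    (fun t => by simp only [hf]; ring)
  have h1 := h s k
  have h2 := h t k
  linarith

/-- By Rolle, `f` is injective on each closed side of `s` within the radius. Two points on one side
at distance `δ` from the level `f s` either have equal values or lie on opposite sides of that
level, and then `f` takes the value `f s` again between them. -/
lemma not_mem_same_side_of_level {f : ℝ → ℝ} (hf : Differentiable ℝ f) {s ρ δ t t' : ℝ}
    (hne : ∀ y, y ≠ s → |y - s| < ρ → deriv f y ≠ 0) (hts : |t - s| < ρ) (hts' : |t' - s| < ρ)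
    (hlt : t < t') (hside : s < t ∨ t' < s) (ht : f t - f s = δ ∨ f t - f s = -δ)
    (ht' : f t' - f s = δ ∨ f t' - f s = -δ) (hδ : 0 < δ) : False := by
  rw [abs_lt] at hts hts'
  have hinj : ∀ x y, x < y → |x - s| < ρ → |y - s| < ρ → (s ≤ x ∨ y ≤ s) →
      ¬ f x = f y := by
    intro x y hxy hx hy h hxy'
    rw [abs_lt] at hx hy
    obtain ⟨w, ⟨hw1, hw2⟩, hw⟩ := exists_deriv_eq_zero hxy hf.continuous.continuousOn hxy'
    refine hne w ?_ (abs_lt.2 ⟨by linarith, by linarith⟩) hw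
    rcases h with h | h
    · exact (by linarith : s < w).ne'
    · exact (by linarith : w < s).ne
  have hρ : 0 < ρ := by linarith
  have hss : |s - s| < ρ := by simpa using hρ
  have hzero : ∀ y ∈ Set.Icc t t', f y ≠ f s := by
    rintro y ⟨hy1, hy2⟩
    rcases hside with h | h
    · exact Ne.symm (hinj s y (by linarith) hss (abs_lt.2 ⟨by linarith, by linarith⟩)
        (Or.inl le_rfl))
    · exact hinj y s (by linarith) (abs_lt.2 ⟨by linarith, by linarith⟩) hss (Or.inr le_rfl)
  have htt : f t ≠ f t' := hinj t t' hlt (abs_lt.2 hts) (abs_lt.2 hts')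
    (hside.imp le_of_lt le_of_lt)
  have hcont := hf.continuous.continuousOn (s := Set.Icc t t')
  rcases ht with h | h <;> rcases ht' with h' | h'
  · exact htt (by linarith)
  · obtain ⟨y, hy, hy0⟩ := intermediate_value_Icc' hlt.le hcont
      (show f s ∈ Set.Icc (f t') (f t) from ⟨by linarith, by linarith⟩)
    exact hzero y hy hy0
  · obtain ⟨y, hy, hy0⟩ := intermediate_value_Icc hlt.le hcont
      (show f s ∈ Set.Icc (f t) (f t') from ⟨by linarith, by linarith⟩)
    exact hzero y hy hy0
  · exact htt (by linarith)

/-- The radius around the points of a page in which the angle is well controlled. -/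
lemma exists_radius (hΘ : ∀ i, ContDiff ℝ ∞ (Θ i))
    (hΘ1 : ∀ i t, Θ i (t + 1) = Θ i t + 2 * Real.pi * p i)
    (hs : ∀ i t, deriv (Θ i) t = 0 → deriv (deriv (Θ i)) t ≠ 0) (θ : ℝ)
    (hfin : {q : ι × ℝ | q.2 ∈ Set.Ico (0 : ℝ) 1 ∧ Real.cos (Θ q.1 q.2 - θ) = 1}.Finite) :
    ∃ ρ > 0, ∀ i s, Real.cos (Θ i s - θ) = 1 → ∀ t, |t - s| < ρ →
      |Θ i t - Θ i s| < Real.pi / 2 ∧ (t ≠ s → deriv (Θ i) t ≠ 0) := by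
  have hd : ∀ i, Differentiable ℝ (Θ i) := fun i => (hΘ i).differentiable (by simp)
  have hd' : ∀ i, Differentiable ℝ (deriv (Θ i)) := fun i =>
    (contDiff_infty_iff_deriv.1 (hΘ i)).2.differentiable (by simp)
  have key : ∀ q : ι × ℝ, ∀ᶠ ρ in 𝓝[>] (0 : ℝ), ∀ t, |t - q.2| < ρ →
      |Θ q.1 t - Θ q.1 q.2| < Real.pi / 2 ∧ (t ≠ q.2 → deriv (Θ q.1) t ≠ 0) := by
    rintro ⟨i, s⟩
    have h1 : ∀ᶠ t in 𝓝 s, |Θ i t - Θ i s| < Real.pi / 2 := by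
      have : ContinuousAt (fun t => |Θ i t - Θ i s|) s :=
        ((hd i).continuous.sub continuous_const).abs.continuousAt
      apply this.eventually (gt_mem_nhds _)
      simp [Real.pi_pos]
    -- Non-degenerate critical points are isolated.
    have h2 : ∀ᶠ t in 𝓝 s, t ≠ s → deriv (Θ i) t ≠ 0 := by
      by_cases h0 : deriv (Θ i) s = 0
      · have := (hd' i s).hasDerivAt.eventually_ne (c := 0) (hs i s h0)
        rwa [eventually_nhdsWithin_iff] at this
      · filter_upwards [(hd' i).continuous.continuousAt.eventually_ne h0] with t ht _ using ht
    obtain ⟨r, hr, h⟩ := Metric.eventually_nhds_iff.1 (h1.and h2)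
    filter_upwards [Ioo_mem_nhdsGT hr] with ρ hρ t ht
    exact h (by rw [Real.dist_eq]; linarith [hρ.2])
  obtain ⟨ρ, h, hρ⟩ :=
    (((eventually_all_finite hfin).2 fun q _ => key q).and self_mem_nhdsWithin).exists
  refine ⟨ρ, hρ, fun i s hs t ht => ?_⟩
  have hc := cos_angle_add_int (hΘ1 i) θ
  -- Translation by `⌊s⌋` reduces to the finitely many page points with parameter in `[0, 1)`.
  have h1 := h (i, s + (-⌊s⌋ : ℤ)) ⟨⟨by push_cast; linarith [Int.floor_le s],
    by push_cast; linarith [Int.lt_floor_add_one s]⟩, by simpa only [hc] using hs⟩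
    (t + (-⌊s⌋ : ℤ)) (by simpa using ht)
  have h2 := periodic_add_int (periodic_deriv (hΘ1 i)) t (-⌊s⌋)
  simp only at h1
  rw [angle_sub_add_int (hΘ1 i), h2] at h1
  exact ⟨h1.1, fun hne => h1.2 (by simpa using hne)⟩

/-- By compactness, `cos (Θ - θ)` is bounded away from `1` outside the `ρ`-neighbourhoods of the
points on the page. So nearby pages meet the link only close to its points on the given page. -/
lemma exists_gap [Finite ι] (hΘ : ∀ i, Continuous (Θ i))
    (hΘ1 : ∀ i t, Θ i (t + 1) = Θ i t + 2 * Real.pi * p i) (θ : ℝ) {ρ : ℝ} (hρ : 0 < ρ) :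
    ∃ κ < 1, ∀ i t, κ < Real.cos (Θ i t - θ) → ∃ s, Real.cos (Θ i s - θ) = 1 ∧ |t - s| < ρ := by
  have hone : ∀ i, ∀ᶠ κ in 𝓝[<] (1 : ℝ), ∀ t, κ < Real.cos (Θ i t - θ) →
      ∃ s, Real.cos (Θ i s - θ) = 1 ∧ |t - s| < ρ := by
    intro i
    have hc : Continuous fun t => Real.cos (Θ i t - θ) :=
      Real.continuous_cos.comp ((hΘ i).sub continuous_const)
    have hper := cos_angle_add_int (hΘ1 i) θ
    set K := Set.Icc (0 : ℝ) 1 ∩ {t | ∀ s, Real.cos (Θ i s - θ) = 1 → ρ ≤ |t - s|} with hK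
    have hKc : IsCompact K := by
      refine isCompact_Icc.inter_right ?_
      simp only [Set.ofPred_forall]
      exact isClosed_iInter fun s => isClosed_iInter fun _ =>
        isClosed_le continuous_const ((continuous_id.sub continuous_const).abs)
    obtain ⟨κ, hκ, hκK⟩ := hKc.exists_forall_le' (continuous_const.sub hc).continuousOn
      (f := fun t => 1 - Real.cos (Θ i t - θ)) (a := 0) (fun t ht => by
      refine sub_pos.2 (lt_of_le_of_ne (Real.cos_le_one _) fun h => ?_)
      have := ht.2 t h
      rw [sub_self, abs_zero] at this
      linarith)
    filter_upwards [Ioo_mem_nhdsLT (show 1 - κ < 1 by linarith)] with κ' hκ' t ht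
    by_contra! hcon
    have := hκK (t + (-⌊t⌋ : ℤ)) ⟨⟨by push_cast; linarith [Int.floor_le t],
      by push_cast; linarith [Int.lt_floor_add_one t]⟩, fun s hs => by
        have h1 := hcon (s + (⌊t⌋ : ℤ)) (by rwa [hper])
        push_cast
        rwa [show t + -(⌊t⌋ : ℝ) - s = t - (s + ⌊t⌋) by ring]⟩
    rw [hper] at this
    linarith [hκ'.1]
  obtain ⟨κ, hκ, hκ1⟩ := ((eventually_all.2 hone).and self_mem_nhdsWithin).exists
  exact ⟨κ, hκ1, hκ⟩

/-- On the average, the two pages on either side of a page have at most as many intersection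
points as the page itself. -/
lemma eventually_encard_pages_add_le [Finite ι] (hΘ : ∀ i, ContDiff ℝ ∞ (Θ i))
    (hΘ1 : ∀ i t, Θ i (t + 1) = Θ i t + 2 * Real.pi * p i)
    (hs : ∀ i t, deriv (Θ i) t = 0 → deriv (deriv (Θ i)) t ≠ 0) (θ : ℝ)
    (hfin : {q : ι × ℝ | q.2 ∈ Set.Ico (0 : ℝ) 1 ∧ Real.cos (Θ q.1 q.2 - θ) = 1}.Finite) :
    ∀ᶠ δ in 𝓝[>] (0 : ℝ),
      {q : ι × ℝ | q.2 ∈ Set.Ico (0 : ℝ) 1 ∧ Real.cos (Θ q.1 q.2 - (θ + δ)) = 1}.encard +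
      {q : ι × ℝ | q.2 ∈ Set.Ico (0 : ℝ) 1 ∧ Real.cos (Θ q.1 q.2 - (θ - δ)) = 1}.encard ≤
      2 * {q : ι × ℝ | q.2 ∈ Set.Ico (0 : ℝ) 1 ∧ Real.cos (Θ q.1 q.2 - θ) = 1}.encard := by
  have hd : ∀ i, Differentiable ℝ (Θ i) := fun i => (hΘ i).differentiable (by simp)
  obtain ⟨ρ, hρ, hrad⟩ := exists_radius hΘ hΘ1 hs θ hfin
  obtain ⟨κ, hκ, hgap⟩ := exists_gap (fun i => (hd i).continuous) hΘ1 θ hρ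
  have hcosδ : ∀ᶠ δ in 𝓝 (0 : ℝ), κ < Real.cos δ := by
    apply Real.continuous_cos.continuousAt.eventually (lt_mem_nhds _)
    simpa using hκ
  filter_upwards [hcosδ.filter_mono nhdsWithin_le_nhds, Ioo_mem_nhdsGT (half_pos Real.pi_pos)]
    with δ hδκ hδ
  obtain ⟨hδ0, hδ1⟩ := hδ
  have hδ2 : Real.cos δ ≠ 1 := by
    have := Real.cos_lt_cos_of_nonneg_of_le_pi le_rfl (by linarith [Real.pi_pos]) hδ0
    rw [Real.cos_zero] at this
    exact this.ne
  -- The two pages are distinct because `0 < 2δ < 2π`, so their counts may be added.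
  rw [← Set.encard_union_eq]
  swap
  · rw [Set.disjoint_left]
    rintro q ⟨-, h1⟩ ⟨-, h2⟩
    rw [Real.cos_eq_one_iff] at h1 h2
    obtain ⟨a, ha⟩ := h1
    obtain ⟨b, hb⟩ := h2
    have h3 : (2 * Real.pi) * ((b : ℝ) - a) = 2 * δ := by linarith
    have h4 : (0 : ℝ) < b - a := by
      by_contra! h
      nlinarith [Real.pi_pos]
    have h5 : (b : ℝ) - a < 1 := by
      by_contra! h
      nlinarith [Real.pi_pos]
    have h6 : 0 < b - a := by exact_mod_cast h4
    have h7 : b - a < 1 := by exact_mod_cast h5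
    omega
  have hcper := fun i => cos_angle_add_int (hΘ1 i) θ
  -- `S t s` says on which side of the page point `s` the parameter `t` lies. On one side the angle
  -- is strictly monotone, so it reaches only one of the two levels `±δ`, and at most once. The two
  -- sides together account for the factor `2`.
  have hside : ∀ S : ℝ → ℝ → Prop, (∀ t s (k : ℤ), S t s → S (t + k) (s + k)) →
      (∀ t t' s, t < t' → S t s → S t' s → (s < t ∨ t' < s)) →
      {q : ι × ℝ | q.2 ∈ Set.Ico (0 : ℝ) 1 ∧ (Real.cos (Θ q.1 q.2 - θ) = Real.cos δ ∧
        ∃ s, Real.cos (Θ q.1 s - θ) = 1 ∧ |q.2 - s| < ρ ∧ S q.2 s)}.encard ≤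
      {q : ι × ℝ | q.2 ∈ Set.Ico (0 : ℝ) 1 ∧ Real.cos (Θ q.1 q.2 - θ) = 1}.encard := by
    intro S hS hS'
    refine encard_Ico_le_of_rel (P := fun i t => Real.cos (Θ i t - θ) = Real.cos δ ∧
        ∃ s, Real.cos (Θ i s - θ) = 1 ∧ |t - s| < ρ ∧ S t s)
      (Q := fun i t => Real.cos (Θ i t - θ) = 1) (fun _ t s => |t - s| < ρ ∧ S t s) ?_ ?_ ?_ ?_ ?_
    · rintro i t k ⟨h1, s, h2, h3, h4⟩
      exact ⟨by rwa [hcper], s + k, by rwa [hcper], by simpa using h3, hS _ _ _ h4⟩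
    · intro i t k h
      rwa [hcper]
    · rintro i t s k ⟨h1, h2⟩
      exact ⟨by simpa using h1, hS _ _ _ h2⟩
    · rintro i t ⟨-, s, h⟩
      exact ⟨s, h⟩
    · rintro i t t' s ⟨h1, -⟩ ⟨h2, -⟩ h3 ⟨h4, h5⟩ ⟨h6, h7⟩
      have hval : ∀ t, Real.cos (Θ i t - θ) = Real.cos δ → |t - s| < ρ →
          Θ i t - Θ i s = δ ∨ Θ i t - Θ i s = -δ := by
        intro t ht hts
        have hr := (hrad i s h3 t hts).1
        obtain ⟨n, hn⟩ := (Real.cos_eq_one_iff _).1 h3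
        have hc : Real.cos |Θ i t - Θ i s| = Real.cos δ := by
          rw [Real.cos_abs, ← ht, ← Real.cos_add_int_mul_two_pi (Θ i t - Θ i s) n]
          congr 1
          linarith
        have := Real.injOn_cos ⟨abs_nonneg _, by linarith [Real.pi_pos]⟩
          ⟨hδ0.le, by linarith [Real.pi_pos]⟩ hc
        exact (abs_eq hδ0.le).1 this
      have hne : ∀ y, y ≠ s → |y - s| < ρ → deriv (Θ i) y ≠ 0 :=
        fun y hy1 hy2 => (hrad i s h3 y hy2).2 hy1
      rcases lt_trichotomy t t' with h | h | h
      · exact (not_mem_same_side_of_level (hd i) hne h4 h6 h (hS' _ _ _ h h5 h7)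
          (hval t h1 h4) (hval t' h2 h6) hδ0).elim
      · exact h
      · exact (not_mem_same_side_of_level (hd i) hne h6 h4 h (hS' _ _ _ h h7 h5)
          (hval t' h2 h6) (hval t h1 h4) hδ0).elim
  have hr := hside (fun t s => s < t) (fun t s k h => by linarith) (fun t t' s _ h _ => Or.inl h)
  have hl := hside (fun t s => t < s) (fun t s k h => by linarith) (fun t t' s _ _ h => Or.inr h)
  rw [two_mul]
  refine le_trans ?_ (add_le_add hr hl)
  refine le_trans (Set.encard_le_encard ?_) (Set.encard_union_le _ _)
  intro q hq
  have hq1 : q.2 ∈ Set.Ico (0 : ℝ) 1 := by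
    rcases hq with h | h <;> exact h.1
  have hq2 : Real.cos (Θ q.1 q.2 - θ) = Real.cos δ := by
    rcases hq with ⟨-, h⟩ | ⟨-, h⟩
    · obtain ⟨n, hn⟩ := (Real.cos_eq_one_iff _).1 h
      rw [← Real.cos_add_int_mul_two_pi δ n]
      congr 1
      linarith
    · obtain ⟨n, hn⟩ := (Real.cos_eq_one_iff _).1 h
      rw [← Real.cos_neg δ, ← Real.cos_add_int_mul_two_pi (-δ) n]
      congr 1
      linarith
  obtain ⟨s, hs1, hs2⟩ := hgap q.1 q.2 (by rwa [hq2])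
  rcases lt_trichotomy s q.2 with h | h | h
  · exact Or.inl ⟨hq1, hq2, s, hs1, hs2, h⟩
  · rw [← h] at hq2
    exact absurd (hq2.symm.trans hs1) hδ2
  · exact Or.inr ⟨hq1, hq2, s, hs1, hs2, h⟩

lemma eventually_cos_sub_ne_one (c : ℝ) : ∀ᶠ δ in 𝓝[>] (0 : ℝ), Real.cos (c - δ) ≠ 1 := by
  by_cases hc : Real.cos c = 1
  · filter_upwards [Ioo_mem_nhdsGT Real.pi_pos] with δ hδ h
    obtain ⟨n, hn⟩ := (Real.cos_eq_one_iff _).1 hc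
    rw [← hn, sub_eq_add_neg, add_comm, Real.cos_add_int_mul_two_pi, Real.cos_neg] at h
    have := Real.cos_lt_cos_of_nonneg_of_le_pi le_rfl hδ.2.le hδ.1
    rw [Real.cos_zero] at this
    exact this.ne h
  · have : ContinuousAt (fun δ => Real.cos (c - δ)) 0 := by fun_prop
    exact (this.eventually_ne (by simpa using hc)).filter_mono nhdsWithin_le_nhds

/-- Every page can be replaced by a regular page with at most as many intersection points. -/
lemma exists_regular_page [Finite ι] (hΘ : ∀ i, ContDiff ℝ ∞ (Θ i))
    (hΘ1 : ∀ i t, Θ i (t + 1) = Θ i t + 2 * Real.pi * p i)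
    (hs : ∀ i t, deriv (Θ i) t = 0 → deriv (deriv (Θ i)) t ≠ 0) (θ : ℝ)
    (hfin : {q : ι × ℝ | q.2 ∈ Set.Ico (0 : ℝ) 1 ∧ Real.cos (Θ q.1 q.2 - θ) = 1}.Finite)
    (hcrit : {q : ι × ℝ | q.2 ∈ Set.Ico (0 : ℝ) 1 ∧ deriv (Θ q.1) q.2 = 0}.Finite) :
    ∃ θ', (∀ q ∈ {q : ι × ℝ | q.2 ∈ Set.Ico (0 : ℝ) 1 ∧ deriv (Θ q.1) q.2 = 0},
        Real.cos (Θ q.1 q.2 - θ') ≠ 1) ∧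
      {q : ι × ℝ | q.2 ∈ Set.Ico (0 : ℝ) 1 ∧ Real.cos (Θ q.1 q.2 - θ') = 1}.encard ≤
      {q : ι × ℝ | q.2 ∈ Set.Ico (0 : ℝ) 1 ∧ Real.cos (Θ q.1 q.2 - θ) = 1}.encard := by
  have h1 : ∀ᶠ δ in 𝓝[>] (0 : ℝ),
      ∀ q ∈ {q : ι × ℝ | q.2 ∈ Set.Ico (0 : ℝ) 1 ∧ deriv (Θ q.1) q.2 = 0},
        Real.cos (Θ q.1 q.2 - (θ + δ)) ≠ 1 ∧ Real.cos (Θ q.1 q.2 - (θ - δ)) ≠ 1 := by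
    refine (eventually_all_finite hcrit).2 fun q _ => ?_
    filter_upwards [eventually_cos_sub_ne_one (Θ q.1 q.2 - θ),
      eventually_cos_sub_ne_one (-(Θ q.1 q.2 - θ))] with δ ha hb
    refine ⟨by rwa [← sub_sub], ?_⟩
    rw [← Real.cos_neg]
    rwa [show -(Θ q.1 q.2 - (θ - δ)) = -(Θ q.1 q.2 - θ) - δ by ring]
  obtain ⟨δ, h1, h2⟩ := (h1.and (eventually_encard_pages_add_le hΘ hΘ1 hs θ hfin)).exists
  -- If both neighbouring pages had more points than the given one, the sum would exceed twice its
  -- count; strictness of the addition uses that this count is finite.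
  by_contra! hcon
  have h3 := hcon (θ + δ) fun q hq => (h1 q hq).1
  have h4 := hcon (θ - δ) fun q hq => (h1 q hq).2
  rw [two_mul] at h2
  have hN : {q : ι × ℝ | q.2 ∈ Set.Ico (0 : ℝ) 1 ∧ Real.cos (Θ q.1 q.2 - θ) = 1}.encard ≠ ⊤ :=
    hfin.encard_lt_top.ne
  generalize {q : ι × ℝ | q.2 ∈ Set.Ico (0 : ℝ) 1 ∧ Real.cos (Θ q.1 q.2 - θ) = 1}.encard = N at *
  generalize Set.encard _ = A at *
  generalize Set.encard _ = B at *
  exact absurd h2 (not_le.2 (WithTop.add_lt_add h3 h4))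

/-- A rotation after which a regular page lies at the angle with cosine `-a` and positive sine,
while the critical values have cosine greater than `-a`. -/
lemma exists_shift (θ : ℝ)
    (hcrit : {q : ι × ℝ | q.2 ∈ Set.Ico (0 : ℝ) 1 ∧ deriv (Θ q.1) q.2 = 0}.Finite)
    (hreg : ∀ q ∈ {q : ι × ℝ | q.2 ∈ Set.Ico (0 : ℝ) 1 ∧ deriv (Θ q.1) q.2 = 0},
        Real.cos (Θ q.1 q.2 - θ) ≠ 1) :
    ∃ β a : ℝ, 0 < a ∧ a < 1 ∧
      (∀ q ∈ {q : ι × ℝ | q.2 ∈ Set.Ico (0 : ℝ) 1 ∧ deriv (Θ q.1) q.2 = 0},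
        -a < Real.cos (Θ q.1 q.2 - β)) ∧
      ∀ x, Real.cos (x - β) = -a → 0 < Real.sin (x - β) → Real.cos (x - θ) = 1 := by
  -- For small `ε` the arc from `θ` to `θ + 2ε` contains no critical value.
  have h1 : ∀ᶠ ε in 𝓝[>] (0 : ℝ),
      ∀ q ∈ {q : ι × ℝ | q.2 ∈ Set.Ico (0 : ℝ) 1 ∧ deriv (Θ q.1) q.2 = 0},
        ∀ x, 0 ≤ x → x ≤ 2 * ε → Real.cos (Θ q.1 q.2 - θ - x) ≠ 1 := by
    refine (eventually_all_finite hcrit).2 fun q hq => ?_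
    have : ContinuousAt (fun x => Real.cos (Θ q.1 q.2 - θ - x)) 0 := by fun_prop
    obtain ⟨r, hr, h⟩ := Metric.eventually_nhds_iff.1
      (this.eventually_ne (by simpa using hreg q hq))
    filter_upwards [Ioo_mem_nhdsGT (half_pos hr)] with ε hε x hx0 hx1
    apply h
    rw [Real.dist_eq, sub_zero, abs_of_nonneg hx0]
    linarith [hε.2]
  obtain ⟨ε, h1, hε0, hε1⟩ := (h1.and (Ioo_mem_nhdsGT (half_pos Real.pi_pos))).exists
  have hsin : 0 < Real.sin ε := Real.sin_pos_of_pos_of_lt_pi hε0 (by linarith [Real.pi_pos])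
  have hcos : 0 < Real.cos ε := Real.cos_pos_of_mem_Ioo ⟨by linarith, by linarith⟩
  have hsc := Real.sin_sq_add_cos_sq ε
  -- The rotation sends `θ` to `π - ε`. The angles with cosine at most `-cos ε` form the arc from `π
  -- - ε` to `π + ε`, the image of the arc just found.
  refine ⟨θ - (Real.pi - ε), Real.cos ε, hcos, by nlinarith, fun q hq => ?_, fun x hx hx' => ?_⟩
  · by_contra! hle
    set c := Θ q.1 q.2 - θ with hc
    have hle' : Real.cos ε ≤ Real.cos (c - ε) := by
      rw [show Θ q.1 q.2 - (θ - (Real.pi - ε)) = c - ε + Real.pi by rw [hc]; ring,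
        Real.cos_add_pi] at hle
      linarith
    -- The representative of `c - ε` in `(-π, π]`, on which the cosine determines the absolute
    -- value.
    obtain ⟨k, hk⟩ : ∃ k : ℤ, c - ε - k * (2 * Real.pi) ∈ Set.Ioc (-Real.pi) Real.pi := by
      refine ⟨toIocDiv Real.two_pi_pos (-Real.pi) (c - ε), ?_⟩
      have := toIocMod_mem_Ioc Real.two_pi_pos (-Real.pi) (c - ε)
      rw [toIocMod, zsmul_eq_mul] at this
      exact ⟨this.1, by linarith [this.2]⟩
    set y := c - ε - k * (2 * Real.pi) with hy
    have hyc : Real.cos ε ≤ Real.cos |y| := by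
      rw [Real.cos_abs, hy, Real.cos_sub_int_mul_two_pi]
      exact hle'
    have hyε : |y| ≤ ε := by
      by_contra! hlt
      have := Real.cos_lt_cos_of_nonneg_of_le_pi hε0.le (abs_le.2 ⟨hk.1.le, hk.2⟩) hlt
      linarith
    rw [abs_le] at hyε
    refine h1 q hq (y + ε) (by linarith [hyε.1]) (by linarith [hyε.2]) ?_
    rw [Real.cos_eq_one_iff]
    exact ⟨k, by rw [hy]; ring⟩
  · have h2 := Real.sin_sq_add_cos_sq (x - (θ - (Real.pi - ε)))
    have h3 : Real.sin (x - (θ - (Real.pi - ε))) = Real.sin ε := by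
      rw [hx] at h2
      have : (Real.sin (x - (θ - (Real.pi - ε))) - Real.sin ε) *
        (Real.sin (x - (θ - (Real.pi - ε))) + Real.sin ε) = 0 := by linarith
      rcases mul_eq_zero.1 this with h | h <;> linarith
    rw [show x - θ = x - (θ - (Real.pi - ε)) - (Real.pi - ε) by ring, Real.cos_sub, hx, h3,
      Real.cos_pi_sub, Real.sin_pi_sub]
    linarith

end Levels

/-! ### The bridge index bounds the bridge-braid spectrum from below -/

lemma SmoothLink.contDiff_height {m : ℕ} (K : SmoothLink m) (i : Fin m) :
    ContDiff ℝ ∞ (K.height i) :=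
  Complex.imCLM.contDiff.comp (contDiff_fst.comp (K.smooth i))

namespace IsPolar

open Filter Topology

variable {m : ℕ} {Θ : Fin m → ℝ → ℝ} {u : Fin m → ℝ → ℂ} {p : Fin m → ℤ}

/-- The numerator of the derivative of the height of the link contracted to the core circle and
recentred by `a`. -/
noncomputable def heightNumerator (θ : ℝ → ℝ) (a : ℝ) (t : ℝ) : ℝ :=
  deriv θ t * ((Real.cos (θ t) + a) * (1 + a * Real.cos (θ t)))

/-- The coefficient of `ε²` in the numerator of the derivative of the height of the link contracted
by `ε`. -/
noncomputable def heightCorrection (θ : ℝ → ℝ) (w : ℝ → ℂ) (t : ℝ) : ℝ :=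
  Real.cos (θ t) * deriv θ t * ‖w t‖ ^ 2 - Real.sin (θ t) * inner ℝ (w t) (deriv w t)

lemma contDiff_heightNumerator {θ : ℝ → ℝ} (h : ContDiff ℝ ∞ θ) (a : ℝ) :
    ContDiff ℝ ∞ (heightNumerator θ a) := by
  have h' := (contDiff_infty_iff_deriv.1 h).2
  have hc := Real.contDiff_cos.comp h
  exact h'.mul ((hc.add contDiff_const).mul (contDiff_const.add (contDiff_const.mul hc)))

lemma contDiff_heightCorrection {θ : ℝ → ℝ} {w : ℝ → ℂ} (h : ContDiff ℝ ∞ θ)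
    (hw : ContDiff ℝ ∞ w) : ContDiff ℝ ∞ (heightCorrection θ w) := by
  have h' := (contDiff_infty_iff_deriv.1 h).2
  have hw' := (contDiff_infty_iff_deriv.1 hw).2
  exact (((Real.contDiff_cos.comp h).mul h').mul (hw.norm_sq ℝ)).sub
    ((Real.contDiff_sin.comp h).mul (hw.inner ℝ hw'))

lemma deriv_heightNumerator {θ : ℝ → ℝ} (h : ContDiff ℝ ∞ θ) (a t : ℝ) :
    deriv (heightNumerator θ a) t =
      deriv (deriv θ) t * ((Real.cos (θ t) + a) * (1 + a * Real.cos (θ t))) +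
      deriv θ t * (-Real.sin (θ t) * deriv θ t * (1 + a * Real.cos (θ t)) +
        (Real.cos (θ t) + a) * (a * (-Real.sin (θ t) * deriv θ t))) := by
  have h1 := (h.differentiable (by simp) t).hasDerivAt
  have h2 := ((contDiff_infty_iff_deriv.1 h).2.differentiable (by simp) t).hasDerivAt
  exact (h2.mul ((h1.cos.add_const a).mul ((h1.cos.const_mul a).const_add 1))).deriv

lemma euclideanNorm_polarCurve_sq (a c : ℝ) (i : Fin m) (t : ℝ) :
    euclideanNorm (polarCurve Θ u a c i t) ^ 2 =
      1 + 2 * a * Real.cos (Θ i t) + a ^ 2 + c ^ 2 * ‖u i t‖ ^ 2 := by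
  rw [euclideanNorm_sq, polarCurve, norm_smul, mul_pow, Real.norm_eq_abs, sq_abs,
    Complex.sq_norm, Complex.normSq_apply]
  simp only [Complex.add_re, Complex.add_im, Complex.exp_ofReal_mul_I_re,
    Complex.exp_ofReal_mul_I_im, Complex.ofReal_re, Complex.ofReal_im]
  have := Real.sin_sq_add_cos_sq (Θ i t)
  linear_combination this

lemma height_eq (h : IsPolar Θ u p) {a c : ℝ} (ha0 : 0 ≤ a) (ha1 : a < 1) (hc : 0 < c)
    (i : Fin m) (t : ℝ) : (h.isConeLink ha0 ha1 hc).toLink.height i t =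
      (euclideanNorm (polarCurve Θ u a c i t))⁻¹ * Real.sin (Θ i t) := by
  rw [SmoothLink.height, IsConeLink.toLink_curve, toSphere, Prod.smul_fst, Complex.smul_im,
    smul_eq_mul]
  simp [polarCurve, Complex.exp_ofReal_mul_I_im]

/-- The height is `sin Θ / N`, and `N²` is explicit, so `N N'` is found by differentiating `N²`.
Separating the term in `c²` shows that for `c → 0` the critical points are those with `Θ' = 0` or
`cos Θ = -a`. -/
lemma deriv_height (h : IsPolar Θ u p) {a c : ℝ} (ha0 : 0 ≤ a) (ha1 : a < 1) (hc : 0 < c)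
    (i : Fin m) (t : ℝ) : deriv ((h.isConeLink ha0 ha1 hc).toLink.height i) t =
      ((euclideanNorm (polarCurve Θ u a c i t))⁻¹) ^ 3 *
        (heightNumerator (Θ i) a t + c ^ 2 * heightCorrection (Θ i) (u i) t) := by
  have hcl := h.isConeLink ha0 ha1 hc
  have hN := euclideanNorm_pos (hcl.ne_zero i t)
  have hNd := ((hcl.contDiff_norm i).differentiable (by simp) t).hasDerivAt
  have hΘ := ((h.smooth_angle i).differentiable (by simp) t).hasDerivAt
  have hu := ((h.smooth_fibre i).differentiable (by simp) t).hasDerivAt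
  rw [show (h.isConeLink ha0 ha1 hc).toLink.height i = fun t =>
    (euclideanNorm (polarCurve Θ u a c i t))⁻¹ * Real.sin (Θ i t) from
    funext (h.height_eq ha0 ha1 hc i)]
  have h1 := hNd.pow 2
  have h2 : HasDerivAt (fun t => euclideanNorm (polarCurve Θ u a c i t) ^ 2)
      (2 * a * (-Real.sin (Θ i t) * deriv (Θ i) t) +
        c ^ 2 * (2 * inner ℝ (u i t) (deriv (u i) t))) t := by
    rw [funext (euclideanNorm_polarCurve_sq (Θ := Θ) (u := u) a c i)]
    exact (((hΘ.cos.const_mul (2 * a)).const_add 1).add_const (a ^ 2)).add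
      (hu.norm_sq.const_mul (c ^ 2))
  have h3 := h1.unique h2
  have h4 := euclideanNorm_polarCurve_sq (Θ := Θ) (u := u) a c i t
  have h5 := ((hNd.fun_inv hN.ne').mul hΘ.sin).deriv
  have h6 := Real.sin_sq_add_cos_sq (Θ i t)
  refine Eq.trans h5 ?_
  rw [heightNumerator, heightCorrection]
  generalize deriv (fun t => euclideanNorm (polarCurve Θ u a c i t)) t = N' at *
  generalize euclideanNorm (polarCurve Θ u a c i t) = N at *
  generalize inner ℝ (u i t) (deriv (u i) t) = v' at *
  generalize ‖u i t‖ ^ 2 = v at *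
  generalize deriv (Θ i) t = Θ' at *
  generalize Real.sin (Θ i t) = S at *
  generalize Real.cos (Θ i t) = C at *
  simp only [Nat.cast_ofNat, Nat.add_one_sub_one, pow_one] at h3
  field_simp
  linear_combination (-S / 2) * h3 + C * Θ' * h4 + a * Θ' * h6

/-- Zeros of the derivative of the height of the contracted link, for a link without critical
values of the angle on the side of the cosines at most `-a`. -/
lemma heightNumerator_zero {θ : ℝ → ℝ} (h : ContDiff ℝ ∞ θ) {a : ℝ} (ha0 : 0 < a) (ha1 : a < 1)
    (hs : ∀ t, deriv θ t = 0 → deriv (deriv θ) t ≠ 0)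
    (hcrit : ∀ t, deriv θ t = 0 → -a < Real.cos (θ t)) {t : ℝ} (h0 : heightNumerator θ a t = 0) :
    deriv (heightNumerator θ a) t ≠ 0 ∧ (deriv (heightNumerator θ a) t < 0 →
      (Real.cos (θ t) = -a ∧ 0 < Real.sin (θ t)) ∨
        (deriv θ t = 0 ∧ deriv (deriv θ) t < 0)) := by
  have hpos : 0 < 1 + a * Real.cos (θ t) := by nlinarith [Real.neg_one_le_cos (θ t)]
  rw [deriv_heightNumerator h]
  by_cases hd : deriv θ t = 0
  -- At a critical point of the angle, `cos Θ + a > 0`: the limiting height increases with the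
  -- angle, so maxima correspond to maxima.
  · have hc := hcrit t hd
    have hP : 0 < (Real.cos (θ t) + a) * (1 + a * Real.cos (θ t)) :=
      mul_pos (by linarith) hpos
    rw [hd, zero_mul, add_zero]
    refine ⟨mul_ne_zero (hs t hd) hP.ne', fun hlt => Or.inr ⟨rfl, ?_⟩⟩
    by_contra! hle
    exact absurd hlt (not_lt.2 (mul_nonneg hle hP.le))
  · have hc : Real.cos (θ t) = -a := by
      rcases mul_eq_zero.1 h0 with h1 | h1
      · exact absurd h1 hd
      · rcases mul_eq_zero.1 h1 with h2 | h2
        · linarith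
        · linarith
    have hsc := Real.sin_sq_add_cos_sq (θ t)
    have hsin : Real.sin (θ t) ≠ 0 := by
      intro h1
      rw [h1, hc] at hsc
      nlinarith
    rw [hc] at hpos ⊢
    -- The derivative is `-sin θ · θ'² · (1 - a²)`; its sign depends on the sine alone, not on the
    -- direction of traversal.
    have hd2 : 0 < deriv θ t ^ 2 := by positivity
    have e : deriv (deriv θ) t * ((-a + a) * (1 + a * -a)) +
      deriv θ t * (-Real.sin (θ t) * deriv θ t * (1 + a * -a) +
        (-a + a) * (a * (-Real.sin (θ t) * deriv θ t))) =
      -Real.sin (θ t) * (deriv θ t ^ 2 * (1 + a * -a)) := by ring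
    rw [e]
    have hP : 0 < deriv θ t ^ 2 * (1 + a * -a) := mul_pos hd2 hpos
    refine ⟨mul_ne_zero (neg_ne_zero.2 hsin) hP.ne', fun hlt => Or.inl ⟨rfl, ?_⟩⟩
    by_contra! hle
    exact absurd hlt (not_lt.2 (mul_nonneg (by linarith) hP.le))

/-- The maxima of the height of the contracted link are at most the points with angle
`arccos (-a)` and the maxima of the angle. -/
lemma exists_numMaxima_le (h : IsPolar Θ u p) {a : ℝ} (ha0 : 0 < a) (ha1 : a < 1)
    (hs : ∀ i t, deriv (Θ i) t = 0 → deriv (deriv (Θ i)) t ≠ 0)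
    (hcrit : ∀ i t, deriv (Θ i) t = 0 → -a < Real.cos (Θ i t)) :
    ∃ (c : ℝ) (hc : 0 < c), (h.isConeLink ha0.le ha1 hc).toLink.IsHeightMorse ∧
      (h.isConeLink ha0.le ha1 hc).toLink.numMaxima ≤
      {q : Fin m × ℝ | q.2 ∈ Set.Ico (0 : ℝ) 1 ∧
        (Real.cos (Θ q.1 q.2) = -a ∧ 0 < Real.sin (Θ q.1 q.2))}.encard +
      {q : Fin m × ℝ | q.2 ∈ Set.Ico (0 : ℝ) 1 ∧
        (deriv (Θ q.1) q.2 = 0 ∧ deriv (deriv (Θ q.1)) q.2 < 0)}.encard := by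
  have hgs := fun i => contDiff_heightNumerator (h.smooth_angle i) a
  have hks := fun i => contDiff_heightCorrection (h.smooth_angle i) (h.smooth_fibre i)
  have hcosp : ∀ i t, Real.cos (Θ i (t + 1)) = Real.cos (Θ i t) := fun i t => by
    simpa using cos_angle_add_one (h.angle_add_one i) 0 t
  have hsinp : ∀ i t, Real.sin (Θ i (t + 1)) = Real.sin (Θ i t) := fun i t => by
    rw [h.angle_add_one, ← Real.sin_add_int_mul_two_pi (Θ i t) (p i)]
    congr 1
    ring
  have hdp : ∀ i t, deriv (Θ i) (t + 1) = deriv (Θ i) t := fun i =>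
    periodic_deriv (h.angle_add_one i)
  have hup : ∀ i t, deriv (u i) (t + 1) = deriv (u i) t := fun i t => by
    rw [← deriv_comp_add_const, funext (h.fibre_periodic i)]
  have hgp : ∀ i t, heightNumerator (Θ i) a (t + 1) = heightNumerator (Θ i) a t := fun i t => by
    simp only [heightNumerator, hcosp, hdp]
  have hkp : ∀ i t, heightCorrection (Θ i) (u i) (t + 1) = heightCorrection (Θ i) (u i) t :=
    fun i t => by simp only [heightCorrection, hcosp, hsinp, hdp, h.fibre_periodic, hup]
  have hz := fun i t => heightNumerator_zero (h.smooth_angle i) ha0 ha1 (hs i) (hcrit i) (t := t)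
  choose ρ hρ η₀ hη₀ hpert using fun i => perturb_zeros (hgs i) (hks i) (hgp i) (hkp i)
    fun t ht => (hz i t ht).1
  have hη : ∀ᶠ η in 𝓝[>] (0 : ℝ), ∀ i, η < η₀ i :=
    eventually_all.2 fun i => by
      filter_upwards [Ioo_mem_nhdsGT (hη₀ i)] with η hη using hη.2
  obtain ⟨η, hη, hη0⟩ := (hη.and self_mem_nhdsWithin).exists
  have hη0 : 0 < η := hη0
  -- The size of the perturbation is `c²`.
  set c := √η with hcdef
  have hc : 0 < c := Real.sqrt_pos.2 hη0
  have hc2 : c ^ 2 = η := Real.sq_sqrt hη0.le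
  have hcl := h.isConeLink ha0.le ha1 hc
  have hdh := fun i t => h.deriv_height ha0.le ha1 hc i t
  rw [hc2] at hdh
  set G : Fin m → ℝ → ℝ := fun i t =>
    heightNumerator (Θ i) a t + η * heightCorrection (Θ i) (u i) t with hG
  have hN : ∀ i t, 0 < ((euclideanNorm (polarCurve Θ u a c i t))⁻¹) ^ 3 := fun i t =>
    pow_pos (inv_pos.2 (euclideanNorm_pos (hcl.ne_zero i t))) 3
  have hzero : ∀ i t, deriv (hcl.toLink.height i) t = 0 → G i t = 0 := fun i t h0 => by
    rw [hdh] at h0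
    exact (mul_eq_zero.1 h0).resolve_left (hN i t).ne'
  have hGd : ∀ i, Differentiable ℝ (G i) := fun i =>
    ((hgs i).differentiable (by simp)).add (((hks i).differentiable (by simp)).const_mul η)
  have hsecond : ∀ i t, G i t = 0 → deriv (deriv (hcl.toLink.height i)) t =
      ((euclideanNorm (polarCurve Θ u a c i t))⁻¹) ^ 3 * deriv (G i) t := by
    intro i t h0
    rw [show deriv (hcl.toLink.height i) = _ from funext (hdh i)]
    have h1 : DifferentiableAt ℝ (fun t => ((euclideanNorm (polarCurve Θ u a c i t))⁻¹) ^ 3) t :=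
      (((hcl.contDiff_norm i).differentiable (by simp) t).fun_inv
        (euclideanNorm_pos (hcl.ne_zero i t)).ne').pow 3
    have h2 := (h1.hasDerivAt.mul (hGd i t).hasDerivAt).deriv
    rw [h0, mul_zero, zero_add] at h2
    exact h2
  have hGne : ∀ i t, G i t = 0 → deriv (G i) t ≠ 0 := fun i t =>
    (hpert i η hη0 (hη i)).1 t
  refine ⟨c, hc, ?_, ?_⟩
  · intro i t h0
    have h1 := hzero i t h0
    rw [hsecond i t h1]
    exact mul_ne_zero (hN i t).ne' (hGne i t h1)
  · have hGp : ∀ i t (k : ℤ), G i (t + k) = G i t := fun i =>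
      periodic_add_int fun t => by simp only [hG, hgp, hkp]
    have hG'p : ∀ i t (k : ℤ), deriv (G i) (t + k) = deriv (G i) t := fun i =>
      periodic_add_int (periodic_deriv (c := 0) fun t => by simp only [hG, hgp, hkp, add_zero])
    have hgp' := fun i => periodic_add_int (hgp i)
    have hg'p' := fun i => periodic_add_int (periodic_deriv (c := 0) (by simpa using hgp i))
    calc hcl.toLink.numMaxima ≤
        {q : Fin m × ℝ | q.2 ∈ Set.Ico (0 : ℝ) 1 ∧
          (G q.1 q.2 = 0 ∧ deriv (G q.1) q.2 < 0)}.encard := by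
          refine Set.encard_le_encard ?_
          rintro ⟨i, t⟩ ⟨ht, hmax⟩
          have h0 := hmax.deriv_eq_zero
          have h1 := hzero i t h0
          refine ⟨ht, h1, lt_of_le_of_ne ?_ (hGne i t h1)⟩
          -- A local maximum with positive second derivative would also be a local minimum; the
          -- height would be locally constant and its second derivative zero.
          by_contra! hpos
          have h2 : 0 < deriv (deriv (hcl.toLink.height i)) t := by
            rw [hsecond i t h1]
            exact mul_pos (hN i t) hpos
          have h3 := isLocalMin_of_deriv_deriv_pos h2 h0
            (hcl.toLink.contDiff_height i).continuous.continuousAt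
          have h4 : hcl.toLink.height i =ᶠ[𝓝 t] fun _ => hcl.toLink.height i t := by
            filter_upwards [h3, hmax] with x hx hx'
            exact le_antisymm hx' hx
          have h5 := h4.deriv.deriv_eq
          rw [h5] at h2
          simp at h2
      _ ≤ {q : Fin m × ℝ | q.2 ∈ Set.Ico (0 : ℝ) 1 ∧ (heightNumerator (Θ q.1) a q.2 = 0 ∧
            deriv (heightNumerator (Θ q.1) a) q.2 < 0)}.encard := by
          refine encard_Ico_le_of_rel (P := fun i t => G i t = 0 ∧ deriv (G i) t < 0)
            (Q := fun i t => heightNumerator (Θ i) a t = 0 ∧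
              deriv (heightNumerator (Θ i) a) t < 0) (fun i t s => |t - s| < ρ i) ?_ ?_ ?_ ?_ ?_
          · intro i t k ht; rwa [hGp, hG'p]
          · intro i t k ht; rwa [hgp', hg'p']
          · intro i t s k ht; simpa using ht
          · rintro i t ⟨h1, h2⟩
            exact (hpert i η hη0 (hη i)).2.1 t h1 h2
          · rintro i t t' s ⟨h1, -⟩ ⟨h2, -⟩ ⟨h3, h4⟩ h5 h6
            exact (hpert i η hη0 (hη i)).2.2 t t' s h1 h2 h3 h4 h5 h6
      _ ≤ _ := by
          refine le_trans (Set.encard_le_encard ?_) (Set.encard_union_le _ _)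
          rintro ⟨i, t⟩ ⟨ht, h1, h2⟩
          rcases (hz i t h1).2 h2 with h3 | h3
          · exact Or.inl ⟨ht, h3⟩
          · exact Or.inr ⟨ht, h3⟩

/-- Rotation, recentring and contraction to the core circle is an isotopy. -/
lemma isotopic_contract (h : IsPolar Θ u p) {K : SmoothLink m}
    (hK : ∀ i t, K.curve i t = toSphere (polarCurve Θ u 0 1 i t)) {a c : ℝ} (ha0 : 0 ≤ a)
    (ha1 : a < 1) (hc : 0 < c) (β : ℝ) :
    K.Isotopic ((h.sub_const β).isConeLink ha0 ha1 hc).toLink := by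
  refine SmoothLink.isotopic_of_isConeLink
    (fun s => polarCurve (fun i t => Θ i t - s * β) u (s * a) (1 - s + s * c)) ?_ ?_ ?_ ?_
  · rintro s ⟨hs0, hs1⟩
    refine (h.sub_const (s * β)).isConeLink (by positivity) (by nlinarith) ?_
    rcases eq_or_lt_of_le hs0 with rfl | hs
    · norm_num
    · have := mul_pos hs hc
      linarith
  · intro i
    have h1 : ContDiff ℝ ∞ (fun q : ℝ × ℝ => Θ i q.2 - q.1 * β) :=
      ((h.smooth_angle i).comp contDiff_snd).sub (contDiff_fst.mul contDiff_const)
    have h2 : ContDiff ℝ ∞ (fun q : ℝ × ℝ => ((q.1 * a : ℝ) : ℂ)) :=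
      Complex.ofRealCLM.contDiff.comp (contDiff_fst.mul contDiff_const)
    have h3 : ContDiff ℝ ∞ (fun q : ℝ × ℝ => (1 - q.1 + q.1 * c) • u i q.2) :=
      ((contDiff_const.sub contDiff_fst).add (contDiff_fst.mul contDiff_const)).smul
        ((h.smooth_fibre i).comp contDiff_snd)
    exact ((contDiff_exp_angle h1).add h2).prodMk h3
  · intro i t
    rw [hK]
    simp [polarCurve]
  · intro i t
    rw [IsConeLink.toLink_curve]
    simp [polarCurve]

end IsPolar

namespace SmoothLink

variable {m : ℕ}

/-- The contracted link is a Morse representative whose maxima come from at most `n` points on a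
page and at most `d` maxima of the angle. -/
theorem bridgeIndex_le_of_isRepresentative {L K : SmoothLink m} (hLK : L.Isotopic K) {d : ℕ}
    {n : ℕ∞} (hK : K.IsRepresentative d n) : L.bridgeIndex ≤ n + d := by
  obtain ⟨⟨havoid, hmorse⟩, hcrit, hmin⟩ := hK
  rcases eq_or_ne n ⊤ with rfl | hn
  · simp
  obtain ⟨Θ, u, p, hpol, hcurve, hangle⟩ := K.exists_polar havoid
  have hangle' : ∀ i, K.angleDeriv i = deriv (Θ i) := fun i => funext (hangle i)
  have hs : ∀ i t, deriv (Θ i) t = 0 → deriv (deriv (Θ i)) t ≠ 0 := by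
    intro i t h0
    rw [← hangle'] at h0 ⊢
    exact hmorse i t h0
  rw [numCritical] at hcrit
  simp only [hangle'] at hcrit
  have hcritfin : {q : Fin m × ℝ | q.2 ∈ Set.Ico (0 : ℝ) 1 ∧ deriv (Θ q.1) q.2 = 0}.Finite :=
    Set.finite_of_encard_eq_coe (k := 2 * d) (by rw [hcrit]; push_cast; rfl)
  have hpage := fun θ => pageCount_eq_of_polar hpol hcurve θ
  -- The minimum over the pages is attained, since `ℕ∞` is well-ordered.
  obtain ⟨θ₀, hθ₀⟩ := ciInf_mem fun θ => K.pageCount θ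
  rw [hmin] at hθ₀
  simp only at hθ₀
  rw [hpage] at hθ₀
  obtain ⟨θ, hreg, hle⟩ := exists_regular_page hpol.smooth_angle hpol.angle_add_one hs θ₀
    (Set.encard_ne_top_iff.1 (by rw [hθ₀]; exact hn)) hcritfin
  rw [hθ₀] at hle
  obtain ⟨β, a, ha0, ha1, hcos, hlevel⟩ := exists_shift θ hcritfin hreg
  have hder : ∀ i, deriv (fun t => Θ i t - β) = deriv (Θ i) := fun i => by
    funext t; rw [deriv_sub_const]
  obtain ⟨c, hc, hM, hmax⟩ := (hpol.sub_const β).exists_numMaxima_le ha0 ha1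
    (fun i t => by rw [hder]; exact hs i t) (fun i t h0 => by
      rw [hder] at h0
      have h1 := hcos (i, Int.fract t) ⟨⟨Int.fract_nonneg _, Int.fract_lt_one _⟩, by
        have := periodic_add_int (periodic_deriv (hpol.angle_add_one i)) t (-⌊t⌋)
        rw [h0] at this
        simpa [Int.fract, sub_eq_add_neg] using this⟩
      have h2 := cos_angle_add_int (hpol.angle_add_one i) β t (-⌊t⌋)
      push_cast at h2
      rw [← sub_eq_add_neg] at h2
      rw [← h2]
      exact h1)
  have hneg : {q : Fin m × ℝ | q.2 ∈ Set.Ico (0 : ℝ) 1 ∧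
      (deriv (Θ q.1) q.2 = 0 ∧ deriv (deriv (Θ q.1)) q.2 < 0)}.encard ≤ d := by
    -- Along closed curves the maxima of the angle do not outnumber its minima, and together they
    -- are at most `2d`.
    have h1 := encard_neg_zeros_le (g := fun i => deriv (Θ i))
      (fun i => (contDiff_infty_iff_deriv.1 (hpol.smooth_angle i)).2.differentiable (by simp))
      (fun i => periodic_deriv (hpol.angle_add_one i)) hs
    have h2 : {q : Fin m × ℝ | q.2 ∈ Set.Ico (0 : ℝ) 1 ∧
        (deriv (Θ q.1) q.2 = 0 ∧ deriv (deriv (Θ q.1)) q.2 < 0)}.encard +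
        {q : Fin m × ℝ | q.2 ∈ Set.Ico (0 : ℝ) 1 ∧
        (deriv (Θ q.1) q.2 = 0 ∧ 0 < deriv (deriv (Θ q.1)) q.2)}.encard ≤ 2 * d := by
      rw [← hcrit, ← Set.encard_union_eq]
      · refine Set.encard_le_encard ?_
        rintro q (⟨h1, h2, -⟩ | ⟨h1, h2, -⟩) <;> exact ⟨h1, h2⟩
      · rw [Set.disjoint_left]
        rintro q ⟨-, -, h1⟩ ⟨-, -, h2⟩
        linarith
    have h3 := (add_le_add le_rfl h1).trans h2
    rw [← two_mul] at h3
    generalize Set.encard _ = x at h3 ⊢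
    induction x using ENat.recTopCoe with
    | top =>
      rw [ENat.mul_top (by norm_num), top_le_iff] at h3
      exact absurd h3 (by exact_mod_cast ENat.natCast_ne_top (2 * d))
    | coe x =>
      have : 2 * x ≤ 2 * d := by exact_mod_cast h3
      exact_mod_cast (by omega : x ≤ d)
  have hlev : {q : Fin m × ℝ | q.2 ∈ Set.Ico (0 : ℝ) 1 ∧
      (Real.cos (Θ q.1 q.2 - β) = -a ∧ 0 < Real.sin (Θ q.1 q.2 - β))}.encard ≤ n := by
    refine le_trans (Set.encard_le_encard ?_) hle
    rintro q ⟨h1, h2, h3⟩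
    exact ⟨h1, hlevel _ h2 h3⟩
  simp only [hder] at hmax
  refine le_trans (sInf_le ?_) (hmax.trans (add_le_add hlev hneg))
  exact ⟨_, hLK.trans (hpol.isotopic_contract hcurve ha0.le ha1 hc β), hM, rfl⟩

end SmoothLink

/-! ### Finger profiles -/

/-- The bump function `exp (1 - 1 / (1 - v²))`. -/
noncomputable def stdBump (v : ℝ) : ℝ := Real.exp 1 * expNegInvGlue (1 - v ^ 2)

lemma contDiff_stdBump : ContDiff ℝ ∞ stdBump :=
  contDiff_const.mul (expNegInvGlue.contDiff.comp (contDiff_const.sub (contDiff_id.pow 2)))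

lemma contDiff_deriv_stdBump : ContDiff ℝ ∞ (deriv stdBump) :=
  (contDiff_infty_iff_deriv.1 contDiff_stdBump).2

lemma stdBump_nonneg (v : ℝ) : 0 ≤ stdBump v :=
  mul_nonneg (Real.exp_pos 1).le (expNegInvGlue.nonneg _)

lemma stdBump_eq {v : ℝ} (hv : 0 < 1 - v ^ 2) :
    stdBump v = Real.exp (1 - (1 - v ^ 2)⁻¹) := by
  rw [stdBump, expNegInvGlue, if_neg (not_le.2 hv), ← Real.exp_add, ← sub_eq_add_neg]

lemma stdBump_eq_zero {v : ℝ} (hv : 1 ≤ |v|) : stdBump v = 0 := by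
  have : 1 ≤ v ^ 2 := by rw [← sq_abs]; nlinarith
  rw [stdBump, expNegInvGlue.zero_of_nonpos (by linarith), mul_zero]

lemma stdBump_zero : stdBump 0 = 1 := by
  rw [stdBump_eq (by norm_num)]; norm_num

lemma stdBump_neg (v : ℝ) : stdBump (-v) = stdBump v := by
  rw [stdBump, stdBump, neg_sq]

lemma sq_lt_one_of_abs {v : ℝ} (hv : |v| < 1) : 0 < 1 - v ^ 2 := by
  rw [← sq_abs]; nlinarith [abs_nonneg v]

lemma stdBump_le_one (v : ℝ) : stdBump v ≤ 1 := by
  rcases lt_or_ge |v| 1 with h | h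
  · have h1 := sq_lt_one_of_abs h
    rw [stdBump_eq h1, Real.exp_le_one_iff, sub_nonpos, one_le_inv₀ h1]
    nlinarith [sq_nonneg v]
  · rw [stdBump_eq_zero h]; norm_num

lemma hasDerivAt_stdBump {v : ℝ} (hv : |v| < 1) :
    HasDerivAt stdBump (-(2 * v) / (1 - v ^ 2) ^ 2 * stdBump v) v := by
  have h1 := sq_lt_one_of_abs hv
  have hd : HasDerivAt (fun v : ℝ => 1 - v ^ 2) (-(2 * v)) v := by
    simpa using (hasDerivAt_pow 2 v).const_sub 1
  have h2 := ((hd.fun_inv h1.ne').const_sub 1).exp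
  rw [← stdBump_eq h1] at h2
  have h3 : stdBump =ᶠ[nhds v] fun v => Real.exp (1 - (1 - v ^ 2)⁻¹) := by
    filter_upwards [(isOpen_Iio.preimage continuous_abs).mem_nhds
      (show v ∈ abs ⁻¹' Set.Iio (1 : ℝ) from hv)] with x hx
    exact stdBump_eq (sq_lt_one_of_abs hx)
  refine (h2.congr_of_eventuallyEq h3).congr_deriv ?_
  field_simp

lemma deriv_stdBump {v : ℝ} (hv : |v| < 1) :
    deriv stdBump v = -(2 * v) / (1 - v ^ 2) ^ 2 * stdBump v := (hasDerivAt_stdBump hv).deriv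

lemma deriv_eq_zero_of_nonneg {f : ℝ → ℝ} (hf : ∀ x, 0 ≤ f x) {x : ℝ} (hx : f x = 0) :
    deriv f x = 0 := by
  have : IsLocalMin f x := Filter.Eventually.of_forall fun y => by rw [hx]; exact hf y
  exact this.deriv_eq_zero

lemma deriv_stdBump_eq_zero {v : ℝ} (hv : 1 ≤ |v|) : deriv stdBump v = 0 :=
  deriv_eq_zero_of_nonneg stdBump_nonneg (stdBump_eq_zero hv)

lemma deriv_stdBump_neg (v : ℝ) : deriv stdBump (-v) = -deriv stdBump v := by
  have := deriv_comp_neg stdBump v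
  rw [show (fun x => stdBump (-x)) = stdBump from funext stdBump_neg] at this
  linarith

lemma deriv_deriv_stdBump {v : ℝ} (hv : |v| < 1) :
    deriv (deriv stdBump) v = 2 * (3 * v ^ 4 - 1) / (1 - v ^ 2) ^ 4 * stdBump v := by
  have h1 := sq_lt_one_of_abs hv
  have hd : HasDerivAt (fun v : ℝ => 1 - v ^ 2) (-(2 * v)) v := by
    simpa using (hasDerivAt_pow 2 v).const_sub 1
  have h3 : deriv stdBump =ᶠ[nhds v] fun v => -(2 * v) / (1 - v ^ 2) ^ 2 * stdBump v := by
    filter_upwards [(isOpen_Iio.preimage continuous_abs).mem_nhds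
      (show v ∈ abs ⁻¹' Set.Iio (1 : ℝ) from hv)] with x hx
    exact deriv_stdBump hx
  have h4 : HasDerivAt (fun v : ℝ => -(2 * v)) (-2) v := by
    simpa using ((hasDerivAt_id v).const_mul 2).fun_neg
  have h2 := (h4.fun_div (hd.fun_pow 2) (by positivity)).fun_mul (hasDerivAt_stdBump hv)
  rw [h3.deriv_eq, h2.deriv]
  field_simp
  ring

/-! ### Critical angles of a single finger -/

/-- The function `1 + A ((κ + v) b'(v) - b(v))`, whose zeros are the critical angles of a finger
with profile `A b`. -/
noncomputable def fingerSlope (A κ v : ℝ) : ℝ :=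
  1 + A * ((κ + v) * deriv stdBump v - stdBump v)

lemma hasDerivAt_fingerSlope (A κ v : ℝ) :
    HasDerivAt (fingerSlope A κ) (A * ((κ + v) * deriv (deriv stdBump) v)) v := by
  have h1 := (contDiff_stdBump.differentiable (by simp) v).hasDerivAt
  have h2 := (contDiff_deriv_stdBump.differentiable (by simp) v).hasDerivAt
  have h3 := ((((hasDerivAt_id v).const_add κ).mul h2).sub h1).const_mul A |>.const_add 1
  refine h3.congr_deriv ?_
  simp only [id]
  ring

lemma fingerSlope_of_one_le {A κ v : ℝ} (hv : 1 ≤ |v|) : fingerSlope A κ v = 1 := by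
  rw [fingerSlope, deriv_stdBump_eq_zero hv, stdBump_eq_zero hv]; ring

/-- On `(0, 1)` the second derivative of the bump has the sign of `3 v⁴ - 1`. The bound `1/2 < v₀`
places the test point `1/2` of the lateral finger on the decreasing branch. -/
lemma exists_inflection : ∃ v₀ : ℝ, 1 / 2 < v₀ ∧ v₀ < 1 ∧
    (∀ v, 0 < v → v < v₀ → deriv (deriv stdBump) v < 0) ∧
    (∀ v, v₀ < v → v < 1 → 0 < deriv (deriv stdBump) v) := by
  obtain ⟨v₀, ⟨h1, h2⟩, h3⟩ := intermediate_value_Ioo (by norm_num : (1 / 2 : ℝ) ≤ 1)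
    (f := fun v : ℝ => 3 * v ^ 4) (by fun_prop)
    (show (1 : ℝ) ∈ _ by norm_num)
  simp only at h3
  have hb : ∀ v : ℝ, |v| < 1 → 0 < stdBump v / (1 - v ^ 2) ^ 4 := fun v hv => by
    have := sq_lt_one_of_abs hv
    rw [stdBump_eq this]; positivity
  refine ⟨v₀, h1, h2, fun v hv hv' => ?_, fun v hv hv' => ?_⟩
  · have hav : |v| < 1 := by rw [abs_of_pos hv]; linarith
    have : v ^ 4 < v₀ ^ 4 := pow_lt_pow_left₀ hv' hv.le (by norm_num)
    rw [deriv_deriv_stdBump hav, div_mul_eq_mul_div, mul_div_assoc]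
    exact mul_neg_of_neg_of_pos (by linarith) (hb v hav)
  · have hv0 : 0 < v := by linarith
    have hav : |v| < 1 := by rw [abs_of_pos hv0]; linarith
    have : v₀ ^ 4 < v ^ 4 := pow_lt_pow_left₀ hv (by linarith) (by norm_num)
    rw [deriv_deriv_stdBump hav, div_mul_eq_mul_div, mul_div_assoc]
    exact mul_pos (by linarith) (hb v hav)

/-- The terms in `b'` cancel in the derivative, which is `A (κ + v) b''`; so the slope function
turns only once on `[0, 1]`, at the inflection point. -/
lemma fingerSlope_mono {A κ v₀ : ℝ} (hA : 0 < A) (hκ : 0 ≤ κ) (h0 : 0 < v₀)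
    (hneg : ∀ v, 0 < v → v < v₀ → deriv (deriv stdBump) v < 0)
    (hpos : ∀ v, v₀ < v → v < 1 → 0 < deriv (deriv stdBump) v) :
    StrictAntiOn (fingerSlope A κ) (Set.Icc 0 v₀) ∧
      StrictMonoOn (fingerSlope A κ) (Set.Icc v₀ 1) := by
  have hc : Continuous (fingerSlope A κ) := continuous_iff_continuousAt.2 fun v =>
    (hasDerivAt_fingerSlope A κ v).continuousAt
  constructor
  · refine strictAntiOn_of_deriv_neg (convex_Icc _ _) hc.continuousOn fun v hv => ?_
    rw [interior_Icc] at hv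
    rw [(hasDerivAt_fingerSlope A κ v).deriv]
    exact mul_neg_of_pos_of_neg hA (mul_neg_of_pos_of_neg (by linarith [hv.1])
      (hneg v hv.1 hv.2))
  · refine strictMonoOn_of_deriv_pos (convex_Icc _ _) hc.continuousOn fun v hv => ?_
    rw [interior_Icc] at hv
    rw [(hasDerivAt_fingerSlope A κ v).deriv]
    exact mul_pos hA (mul_pos (by linarith [hv.1]) (hpos v hv.1 hv.2))

lemma continuous_fingerSlope (A κ : ℝ) : Continuous (fingerSlope A κ) :=
  continuous_iff_continuousAt.2 fun v => (hasDerivAt_fingerSlope A κ v).continuousAt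

/-- A finger across the axis has two critical angles. -/
lemma fingerSlope_zeros_central {A : ℝ} (hA : 1 < A) :
    {v | fingerSlope A 0 v = 0}.encard = 2 ∧ ∀ v, fingerSlope A 0 v = 0 →
      |v| < 1 ∧ v ≠ 0 ∧ deriv (deriv stdBump) v ≠ 0 := by
  obtain ⟨v₀, hv₀, hv₁, hneg, hpos⟩ := exists_inflection
  obtain ⟨hanti, hmono⟩ := fingerSlope_mono (A := A) (κ := 0) (by linarith) le_rfl (by linarith)
    hneg hpos
  -- The value at `0` is `1 - A < 0`, the function decreases up to `v₀` and then increases to `1` at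
  -- `v = 1`: one positive zero. By evenness there is one negative zero.
  have h0 : fingerSlope A 0 0 < 0 := by
    rw [fingerSlope, stdBump_zero]; linarith
  have hle : ∀ v, 0 ≤ v → v ≤ v₀ → fingerSlope A 0 v < 0 := fun v hv hv' =>
    (hanti.antitoneOn ⟨le_rfl, by linarith⟩ ⟨hv, hv'⟩ hv).trans_lt h0
  have h1 : fingerSlope A 0 1 = 1 := fingerSlope_of_one_le (by simp)
  obtain ⟨w, ⟨hw1, hw2⟩, hw⟩ := intermediate_value_Ioo hv₁.le
    (continuous_fingerSlope A 0).continuousOn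
    (show (0 : ℝ) ∈ _ from ⟨hle v₀ (by linarith) le_rfl, by rw [h1]; norm_num⟩)
  have heven : ∀ v, fingerSlope A 0 (-v) = fingerSlope A 0 v := fun v => by
    rw [fingerSlope, fingerSlope, stdBump_neg, deriv_stdBump_neg]; ring
  have huniq : ∀ v, 0 ≤ v → fingerSlope A 0 v = 0 → v = w := by
    intro v hv h
    rcases le_or_gt v v₀ with h2 | h2
    · exact absurd h (hle v hv h2).ne
    rcases le_or_gt 1 v with h3 | h3
    · rw [fingerSlope_of_one_le (h3.trans (le_abs_self v))] at h
      norm_num at h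
    · exact hmono.injOn ⟨h2.le, h3.le⟩ ⟨hw1.le, hw2.le⟩ (h.trans hw.symm)
  have hset : {v | fingerSlope A 0 v = 0} = {w, -w} := by
    ext v
    simp only [Set.mem_ofPred_eq, Set.mem_insert_iff, Set.mem_singleton_iff]
    constructor
    · intro h
      rcases le_total 0 v with hv | hv
      · exact Or.inl (huniq v hv h)
      · right
        rw [← heven] at h
        linarith [huniq (-v) (by linarith) h]
    · rintro (rfl | rfl)
      · exact hw
      · rw [heven, hw]
  have hdd : deriv (deriv stdBump) w ≠ 0 := (hpos w hw1 hw2).ne'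
  refine ⟨by rw [hset]; exact Set.encard_pair (by linarith), fun v hv => ?_⟩
  have hv : v ∈ ({w, -w} : Set ℝ) := hset ▸ hv
  have haw : |w| < 1 := by rw [abs_of_pos (by linarith)]; exact hw2
  rcases hv with rfl | hv
  · exact ⟨haw, by linarith, hdd⟩
  · rw [hv]
    refine ⟨by rwa [abs_neg], by linarith, ?_⟩
    rw [deriv_deriv_stdBump haw] at hdd
    rwa [deriv_deriv_stdBump (by rwa [abs_neg]), stdBump_neg, neg_sq,
      show (-w) ^ 4 = w ^ 4 by ring]

/-- A finger beside the axis has two critical angles. -/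
lemma fingerSlope_zeros_lateral :
    {v | fingerSlope (1 / 2) 6 v = 0}.encard = 2 ∧ ∀ v, fingerSlope (1 / 2) 6 v = 0 →
      |v| < 1 ∧ deriv (deriv stdBump) v ≠ 0 := by
  obtain ⟨v₀, hv₀, hv₁, hneg, hpos⟩ := exists_inflection
  obtain ⟨hanti, hmono⟩ := fingerSlope_mono (A := 1 / 2) (κ := 6) (by norm_num) (by norm_num)
    (by linarith) hneg hpos
  have hc := continuous_fingerSlope (1 / 2) 6
  -- The values are positive at `0`, negative at `1/2` and `1` at `v = 1`, which gives one zero on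
  -- each side of `v₀`. For `v ≤ 0` both `b' ≥ 0` and `A b ≤ 1/2` keep the function positive.
  have h0 : 0 < fingerSlope (1 / 2) 6 0 := by
    have : deriv stdBump 0 = 0 := by rw [deriv_stdBump (by simp)]; simp
    rw [fingerSlope, stdBump_zero, this]; norm_num
  have h1 : fingerSlope (1 / 2) 6 1 = 1 := fingerSlope_of_one_le (by simp)
  have hhalf : fingerSlope (1 / 2) 6 (1 / 2) < 0 := by
    have h : |(1 / 2 : ℝ)| < 1 := by rw [abs_of_pos] <;> norm_num
    -- The value is `exp (-1/3)`, and `exp x ≥ 1 + x`.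
    have hb : 2 / 3 ≤ stdBump (1 / 2) := by
      rw [stdBump_eq (by norm_num)]
      refine le_trans ?_ (Real.add_one_le_exp _)
      norm_num
    rw [fingerSlope, deriv_stdBump h]
    norm_num
    linarith
  have hv0 : fingerSlope (1 / 2) 6 v₀ < 0 :=
    (hanti ⟨by norm_num, hv₀.le⟩ ⟨by linarith, le_rfl⟩ hv₀).trans hhalf
  have hnonpos : ∀ v, v ≤ 0 → fingerSlope (1 / 2) 6 v ≠ 0 := by
    intro v hv h
    rcases le_or_gt 1 |v| with h2 | h2
    · rw [fingerSlope_of_one_le h2] at h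
      norm_num at h
    · have hd : 0 ≤ deriv stdBump v := by
        rw [deriv_stdBump h2]
        exact mul_nonneg (div_nonneg (by linarith) (sq_nonneg _)) (stdBump_nonneg v)
      have h3 : 0 ≤ (6 + v) * deriv stdBump v :=
        mul_nonneg (by linarith [(abs_lt.1 h2).1]) hd
      have h4 := stdBump_le_one v
      rw [fingerSlope] at h
      linarith
  obtain ⟨a, ⟨ha1, ha2⟩, ha⟩ := intermediate_value_Ioo' (by linarith : (0 : ℝ) ≤ v₀)
    hc.continuousOn (show (0 : ℝ) ∈ _ from ⟨hv0, h0⟩)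
  obtain ⟨w, ⟨hw1, hw2⟩, hw⟩ := intermediate_value_Ioo hv₁.le hc.continuousOn
    (show (0 : ℝ) ∈ _ from ⟨hv0, by rw [h1]; norm_num⟩)
  have hset : {v | fingerSlope (1 / 2) 6 v = 0} = {a, w} := by
    ext v
    simp only [Set.mem_ofPred_eq, Set.mem_insert_iff, Set.mem_singleton_iff]
    constructor
    · intro h
      rcases le_or_gt v 0 with h2 | h2
      · exact absurd h (hnonpos v h2)
      rcases le_or_gt v v₀ with h3 | h3
      · exact Or.inl (hanti.injOn ⟨h2.le, h3⟩ ⟨ha1.le, ha2.le⟩ (h.trans ha.symm))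
      rcases le_or_gt 1 v with h4 | h4
      · rw [fingerSlope_of_one_le (h4.trans (le_abs_self v))] at h
        norm_num at h
      · exact Or.inr (hmono.injOn ⟨h3.le, h4.le⟩ ⟨hw1.le, hw2.le⟩ (h.trans hw.symm))
    · rintro (rfl | rfl)
      · exact ha
      · exact hw
  refine ⟨by rw [hset]; exact Set.encard_pair (by linarith), fun v hv => ?_⟩
  have hv : v ∈ ({a, w} : Set ℝ) := hset ▸ hv
  rcases hv with rfl | hv
  · exact ⟨abs_lt.2 ⟨by linarith, by linarith⟩, (hneg v ha1 ha2).ne⟩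
  · rw [hv]
    exact ⟨abs_lt.2 ⟨by linarith, by linarith⟩, (hpos w hw1 hw2).ne'⟩

/-! ### Finger profiles with a prescribed number of critical pairs -/

/-- A bump function with amplitude `A`, centre `c` and radius `w`. -/
noncomputable def scaledBump (A c w y : ℝ) : ℝ := A * stdBump ((y - c) / w)

lemma contDiff_scaledBump (A c w : ℝ) : ContDiff ℝ ∞ (scaledBump A c w) :=
  contDiff_const.mul (contDiff_stdBump.comp ((contDiff_id.sub contDiff_const).div_const w))

lemma deriv_scaledBump (A c w y : ℝ) :
    deriv (scaledBump A c w) y = A * (deriv stdBump ((y - c) / w) / w) := by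
  have h1 := (contDiff_stdBump.differentiable (by simp) ((y - c) / w)).hasDerivAt
  have h2 : HasDerivAt (fun y : ℝ => (y - c) / w) (1 / w) y :=
    ((hasDerivAt_id y).sub_const c).div_const w
  refine ((h1.comp y h2).const_mul A).deriv.trans ?_
  ring

lemma deriv_deriv_scaledBump (A c w y : ℝ) :
    deriv (deriv (scaledBump A c w)) y = A * (deriv (deriv stdBump) ((y - c) / w) / w ^ 2) := by
  rw [funext (deriv_scaledBump A c w)]
  have h1 := (contDiff_deriv_stdBump.differentiable (by simp) ((y - c) / w)).hasDerivAt
  have h2 : HasDerivAt (fun y : ℝ => (y - c) / w) (1 / w) y :=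
    ((hasDerivAt_id y).sub_const c).div_const w
  refine (((h1.comp y h2).div_const w).const_mul A).deriv.trans ?_
  ring

/-- Substituting `y = c + w v` leaves only the ratio `c / w`, so a finger can be made arbitrarily
thin without changing its number of critical angles. -/
lemma scaledBump_slope {A c w : ℝ} (hw : 0 < w) (y : ℝ) :
    y * deriv (scaledBump A c w) y - scaledBump A c w y + 1 =
      fingerSlope A (c / w) ((y - c) / w) := by
  rw [deriv_scaledBump, scaledBump, fingerSlope]
  field_simp
  ring

lemma scaledBump_eq_zero {A c w : ℝ} (hw : 0 < w) {y : ℝ} (hy : w ≤ |y - c|) :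
    scaledBump A c w y = 0 := by
  rw [scaledBump, stdBump_eq_zero, mul_zero]
  rwa [abs_div, abs_of_pos hw, one_le_div hw]

lemma encard_scaledBump_zeros {A c w : ℝ} (hw : 0 < w) :
    {y | y * deriv (scaledBump A c w) y - scaledBump A c w y + 1 = 0}.encard =
      {v | fingerSlope A (c / w) v = 0}.encard := by
  have hinj : Function.Injective (fun v : ℝ => c + w * v) := fun a b h => by
    simpa [hw.ne'] using h
  rw [← hinj.encard_image {v | fingerSlope A (c / w) v = 0}]
  congr 1
  ext y
  simp only [Set.mem_ofPred_eq, Set.mem_image, scaledBump_slope hw]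
  constructor
  · intro h
    exact ⟨_, h, by field_simp; ring⟩
  · rintro ⟨v, hv, rfl⟩
    rw [show (c + w * v - c) / w = v by field_simp; ring]
    exact hv

/-- A profile `Y` of width `η` such that the curve `y ↦ (-1 + Y y) + i y` has `k` pairs of
critical angles and, unless `k = 0`, passes the origin on the right. -/
structure IsProfile (k : ℕ) (η : ℝ) (Y : ℝ → ℝ) : Prop where
  smooth : ContDiff ℝ ∞ Y
  eq_zero : ∀ y, η ≤ |y| → Y y = 0
  nonneg : ∀ y, 0 ≤ Y y
  le : ∀ y, Y y ≤ 1 + η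
  center_ne : Y 0 ≠ 1
  center : 0 < k → 1 < Y 0
  encard_zeros : {y | y * deriv Y y - Y y + 1 = 0}.encard = 2 * k
  nondegenerate : ∀ y, y * deriv Y y - Y y + 1 = 0 → y * deriv (deriv Y) y ≠ 0

lemma isProfile_zero {η : ℝ} (hη : 0 < η) : IsProfile 0 η (fun _ => 0) where
  smooth := contDiff_const
  eq_zero _ _ := rfl
  nonneg _ := le_rfl
  le _ := by linarith
  center_ne := by norm_num
  center h := absurd h (lt_irrefl 0)
  encard_zeros := by simp
  nondegenerate y h := by simp at h

lemma isProfile_one {η : ℝ} (hη : 0 < η) : IsProfile 1 η (scaledBump (1 + η) 0 η) := by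
  obtain ⟨h1, h2⟩ := fingerSlope_zeros_central (A := 1 + η) (by linarith)
  have h0 : scaledBump (1 + η) 0 η 0 = 1 + η := by
    rw [scaledBump, sub_self, zero_div, stdBump_zero, mul_one]
  refine ⟨contDiff_scaledBump _ _ _, fun y hy => scaledBump_eq_zero hη (by simpa using hy),
    fun y => mul_nonneg (by linarith) (stdBump_nonneg _), fun y => ?_, ?_, fun _ => ?_, ?_, ?_⟩
  · rw [scaledBump]
    have := stdBump_le_one ((y - 0) / η)
    nlinarith
  · rw [h0]; linarith
  · rw [h0]; linarith
  · rw [encard_scaledBump_zeros hη, zero_div, h1]; norm_num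
  · intro y hy
    rw [scaledBump_slope hη, zero_div] at hy
    obtain ⟨-, h3, h4⟩ := h2 _ hy
    rw [deriv_deriv_scaledBump]
    refine mul_ne_zero (fun h => h3 (by rw [h]; simp)) (mul_ne_zero (by linarith)
      (div_ne_zero h4 (by positivity)))

/-- A lateral bump is added over `[5η/8, 7η/8]`, disjoint from the support of `Y` in `|y| ≤ η/2`, so
the critical angles of the two pieces simply add up. Centre and radius have the ratio `6` required
by `fingerSlope_zeros_lateral`. -/
lemma IsProfile.succ {k : ℕ} {η : ℝ} (hη : 0 < η) (hk : 0 < k) {Y : ℝ → ℝ}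
    (h : IsProfile k (η / 2) Y) :
    IsProfile (k + 1) η (fun y => Y y + scaledBump (1 / 2) (3 * η / 4) (η / 8) y) := by
  have hw : 0 < η / 8 := by positivity
  have hκ : 3 * η / 4 / (η / 8) = 6 := by field_simp; norm_num
  obtain ⟨hz1, hz2⟩ := fingerSlope_zeros_lateral
  set B := scaledBump (1 / 2) (3 * η / 4) (η / 8) with hB
  have hBs : ContDiff ℝ ∞ B := contDiff_scaledBump _ _ _
  have hB0 : ∀ y, y ≤ 5 * η / 8 → B y = 0 := fun y hy =>
    scaledBump_eq_zero hw (by rw [abs_of_nonpos (by linarith)]; linarith)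
  have hBη : ∀ y, η ≤ |y| → B y = 0 := fun y hy => by
    rcases le_abs.1 hy with h' | h'
    · exact scaledBump_eq_zero hw (by rw [abs_of_nonneg (by linarith)]; linarith)
    · exact hB0 y (by linarith)
  have hBnn : ∀ y, 0 ≤ B y := fun y => mul_nonneg (by norm_num) (stdBump_nonneg _)
  have hBle : ∀ y, B y ≤ 1 / 2 := fun y => by
    have := stdBump_le_one ((y - 3 * η / 4) / (η / 8))
    rw [hB, scaledBump]; linarith
  have hd : ∀ y, deriv (fun y => Y y + B y) y = deriv Y y + deriv B y := fun y =>
    deriv_fun_add (h.smooth.differentiable (by simp) y) (hBs.differentiable (by simp) y)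
  have hdd : ∀ y, deriv (deriv (fun y => Y y + B y)) y =
      deriv (deriv Y) y + deriv (deriv B) y := fun y => by
    rw [funext hd]
    exact deriv_fun_add ((contDiff_infty_iff_deriv.1 h.smooth).2.differentiable (by simp) y)
      ((contDiff_infty_iff_deriv.1 hBs).2.differentiable (by simp) y)
  have hYfar : ∀ y, η / 2 ≤ |y| → y * deriv Y y - Y y = 0 := fun y hy => by
    rw [h.eq_zero y hy, deriv_eq_zero_of_nonneg h.nonneg (h.eq_zero y hy)]; simp
  have hBfar : ∀ y, y ≤ 5 * η / 8 → y * deriv B y - B y = 0 := fun y hy => by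
    rw [hB0 y hy, deriv_eq_zero_of_nonneg hBnn (hB0 y hy)]; simp
  have hYz : ∀ y, y * deriv Y y - Y y + 1 = 0 → |y| < η / 2 := fun y hy => by
    by_contra! hcon
    rw [hYfar y hcon] at hy
    norm_num at hy
  have hBz : ∀ y, y * deriv B y - B y + 1 = 0 → 5 * η / 8 < y := fun y hy => by
    by_contra! hcon
    rw [hBfar y hcon] at hy
    norm_num at hy
  -- At each `y` at least one of the two summands vanishes together with its derivative.
  have hsplit : ∀ y, y * deriv (fun y => Y y + B y) y - (Y y + B y) + 1 = 0 ↔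
      y * deriv Y y - Y y + 1 = 0 ∨ y * deriv B y - B y + 1 = 0 := by
    intro y
    rw [hd]
    constructor
    · intro h0
      rcases le_or_gt y (5 * η / 8) with h1 | h1
      · left; linarith [hBfar y h1]
      · right; linarith [hYfar y (le_trans (by linarith) (le_abs_self y))]
    · rintro (h0 | h0)
      · linarith [hBfar y (by linarith [(abs_lt.1 (hYz y h0)).2])]
      · have := hBz y h0
        linarith [hYfar y (le_trans (by linarith) (le_abs_self y))]
  refine ⟨h.smooth.add hBs, fun y hy => ?_, fun y => add_nonneg (h.nonneg y) (hBnn y),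
    fun y => ?_, ?_, fun _ => ?_, ?_, fun y hy => ?_⟩
  · simp only [h.eq_zero y (by linarith), hBη y hy, add_zero]
  · rcases le_or_gt y (5 * η / 8) with h1 | h1
    · simp only [hB0 y h1]; linarith [h.le y]
    · simp only [h.eq_zero y (le_trans (by linarith) (le_abs_self y))]; linarith [hBle y]
  · simp only [hB0 0 (by positivity), add_zero]
    exact h.center_ne
  · simp only [hB0 0 (by positivity), add_zero]
    exact h.center hk
  · simp only [hsplit]
    rw [Set.ofPred_or, Set.encard_union_eq, h.encard_zeros, encard_scaledBump_zeros hw, hκ, hz1]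
    · push_cast; ring
    · rw [Set.disjoint_left]
      intro y h1 h2
      linarith [(abs_lt.1 (hYz y h1)).2, hBz y h2]
  · rw [hdd]
    rcases (hsplit y).1 hy with h0 | h0
    · have hy1 := (abs_lt.1 (hYz y h0)).2
      have : B =ᶠ[nhds y] fun _ => 0 := by
        filter_upwards [Iio_mem_nhds (show y < 5 * η / 8 by linarith)] with x hx
        exact hB0 x (le_of_lt hx)
      have h2 : deriv (deriv B) y = 0 := by rw [this.deriv.deriv_eq]; simp
      rw [h2, add_zero]
      exact h.nondegenerate y h0
    · have hy1 := hBz y h0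
      have : Y =ᶠ[nhds y] fun _ => 0 := by
        filter_upwards [Ioi_mem_nhds (show η / 2 < y by linarith)] with x hx
        exact h.eq_zero x (le_trans (le_of_lt hx) (le_abs_self x))
      have h2 : deriv (deriv Y) y = 0 := by rw [this.deriv.deriv_eq]; simp
      rw [h2, zero_add, hB, deriv_deriv_scaledBump]
      rw [scaledBump_slope hw, hκ] at h0
      exact mul_ne_zero (by linarith) (mul_ne_zero (by norm_num)
        (div_ne_zero (hz2 _ h0).2 (by positivity)))

lemma exists_isProfile (k : ℕ) {η : ℝ} (hη : 0 < η) : ∃ Y, IsProfile k η Y := by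
  rcases Nat.eq_zero_or_pos k with rfl | hk
  · exact ⟨_, isProfile_zero hη⟩
  · induction k, hk using Nat.le_induction generalizing η with
    | base => exact ⟨_, isProfile_one hη⟩
    | succ k hk ih =>
      obtain ⟨Y, hY⟩ := ih (half_pos hη)
      exact ⟨_, hY.succ hη hk⟩

/-! ### Straightening a closed braid -/

/-- The angles of a braid whose components have constant speed. -/
noncomputable def linearAngle {m : ℕ} (p : Fin m → ℤ) (i : Fin m) (t : ℝ) : ℝ :=
  2 * Real.pi * (p i * t)

/-- A monotone circle-valued function has a smooth inverse. -/
lemma exists_smooth_inverse {f : ℝ → ℝ} {n : ℤ} (hf : ContDiff ℝ ∞ f)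
    (h1 : ∀ t, f (t + 1) = f t + 2 * Real.pi * n) (hd : ∀ t, deriv f t ≠ 0) :
    n ≠ 0 ∧ ∃ g : ℝ → ℝ, ContDiff ℝ ∞ g ∧ (∀ t, g (t + 1) = g t + 1) ∧ (∀ t, 0 < deriv g t) ∧
      ∀ t, f (g t) = 2 * Real.pi * (n * t) := by
  have hdiff : Differentiable ℝ f := hf.differentiable (by simp)
  have hn : n ≠ 0 := by
    rintro rfl
    obtain ⟨x, -, hx⟩ := exists_deriv_eq_zero (zero_lt_one' ℝ) hdiff.continuous.continuousOn
      (show f 0 = f 1 by simpa using (h1 0).symm)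
    exact hd x hx
  refine ⟨hn, ?_⟩
  have hn' : (2 * Real.pi * n : ℝ) ≠ 0 :=
    mul_ne_zero Real.two_pi_pos.ne' (by exact_mod_cast hn)
  -- Dividing by `2π n` removes winding number and orientation: `ψ` is a lift of degree one.
  set ψ : ℝ → ℝ := fun t => f t / (2 * Real.pi * n) with hψ
  have hψs : ContDiff ℝ ∞ ψ := hf.div_const _
  have hψ1 : ∀ t, ψ (t + 1) = ψ t + 1 := fun t => by
    simp only [hψ, h1]; field_simp
  have hψd : ∀ t, HasDerivAt ψ (deriv f t / (2 * Real.pi * n)) t := fun t =>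
    (hdiff t).hasDerivAt.div_const _
  have hψne : ∀ t, deriv ψ t ≠ 0 := fun t => by
    rw [(hψd t).deriv]; exact div_ne_zero (hd t) hn'
  have hψc : Continuous (deriv ψ) := (contDiff_infty_iff_deriv.1 hψs).2.continuous
  -- The derivative is `1` somewhere by the mean value theorem and never zero, hence positive
  -- everywhere.
  have hψpos : ∀ t, 0 < deriv ψ t := by
    obtain ⟨x, -, hx⟩ := exists_deriv_eq_slope ψ (zero_lt_one' ℝ) hψs.continuous.continuousOn
      (hψs.differentiable (by simp)).differentiableOn
    have hx1 : deriv ψ x = 1 := by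
      rw [hx]; have := hψ1 0; rw [zero_add] at this; rw [this]; simp
    intro t
    by_contra! hle
    obtain ⟨y, hy⟩ := mem_range_of_exists_le_of_exists_ge hψc ⟨t, hle⟩
      ⟨x, by rw [hx1]; norm_num⟩
    exact hψne y hy
  have hmono : StrictMono ψ := strictMono_of_deriv_pos hψpos
  have hψk : ∀ (t : ℝ) (k : ℤ), ψ (t + k) = ψ t + k := fun t k => by
    have := periodic_add_int (g := fun t => ψ t - t) (fun t => by simp only [hψ1]; ring) t k
    linarith
  have hsurj : Function.Surjective ψ := fun y => by
    refine mem_range_of_exists_le_of_exists_ge hψs.continuous ⟨0 + (⌊y - ψ 0⌋ : ℤ), ?_⟩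
      ⟨0 + (⌈y - ψ 0⌉ : ℤ), ?_⟩
    · rw [hψk]; linarith [Int.floor_le (y - ψ 0)]
    · rw [hψk]; linarith [Int.le_ceil (y - ψ 0)]
  set e : ℝ ≃ₜ ℝ := (hmono.orderIsoOfSurjective ψ hsurj).toHomeomorph with he
  have hee : ∀ t, e t = ψ t := fun t => rfl
  have hes : ∀ t, ψ (e.symm t) = t := fun t => e.apply_symm_apply t
  have hsm : ContDiff ℝ ∞ e.symm := e.contDiff_symm_deriv (f' := deriv ψ) (fun x => hψne x)
    (fun x => (hψs.differentiable (by simp) x).hasDerivAt) hψs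
  refine ⟨e.symm, hsm, fun t => hmono.injective ?_, fun t => ?_, fun t => ?_⟩
  · rw [hes, hψ1, hes]
  · have h2 := (hψs.differentiable (by simp) (e.symm t)).hasDerivAt.comp t
      (hsm.differentiable (by simp) t).hasDerivAt
    have h3 : ψ ∘ e.symm = id := funext hes
    rw [h3] at h2
    have h4 := h2.unique (hasDerivAt_id t)
    have h5 := hψpos (e.symm t)
    by_contra! hle
    nlinarith
  · have := hes t
    simp only [hψ] at this
    rw [div_eq_iff hn'] at this
    rw [this]; ring

namespace IsPolar

variable {m : ℕ} {Θ : Fin m → ℝ → ℝ} {u : Fin m → ℝ → ℂ} {p : Fin m → ℤ}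

/-- Reparametrization of a link in polar form. -/
lemma comp (h : IsPolar Θ u p) {g : Fin m → ℝ → ℝ} (hg : ∀ i, ContDiff ℝ ∞ (g i))
    (hg1 : ∀ i t, g i (t + 1) = g i t + 1) (hgd : ∀ i t, 0 < deriv (g i) t) :
    IsPolar (fun i t => Θ i (g i t)) (fun i t => u i (g i t)) p where
  smooth_angle i := (h.smooth_angle i).comp (hg i)
  smooth_fibre i := (h.smooth_fibre i).comp (hg i)
  angle_add_one i t := by rw [hg1, h.angle_add_one]
  fibre_periodic i t := by rw [hg1, h.fibre_periodic]
  immersion i t h0 := by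
    have h1 := ((hg i).differentiable (by simp) t).hasDerivAt
    have h2 := ((h.smooth_angle i).differentiable (by simp) (g i t)).hasDerivAt.comp t h1
    have h3 := ((h.smooth_fibre i).differentiable (by simp) (g i t)).hasDerivAt.scomp t h1
    change deriv (Θ i ∘ g i) t = 0 at h0
    change deriv (u i ∘ g i) t ≠ 0
    rw [h2.deriv] at h0
    rw [h3.deriv]
    exact smul_ne_zero (hgd i t).ne'
      (h.immersion i _ ((mul_eq_zero.1 h0).resolve_right (hgd i t).ne'))
  injective i j s t k hk huu := by
    obtain ⟨rfl, l, hl⟩ := h.injective i j _ _ k hk huu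
    refine ⟨rfl, l, (strictMono_of_deriv_pos (hgd i)).injective ?_⟩
    have := periodic_add_int (g := fun t => g i t - t) (fun t => by simp only [hg1]; ring) s l
    rw [hl]
    linarith

/-- Links in polar form that are joined by a smooth family of such links are isotopic. -/
lemma isotopic_of_family {K : SmoothLink m} {Θ : ℝ → Fin m → ℝ → ℝ} {u : ℝ → Fin m → ℝ → ℂ}
    (h : ∀ s ∈ Set.Icc (0 : ℝ) 1, IsPolar (Θ s) (u s) p)
    (hΘ : ∀ i, ContDiff ℝ ∞ (fun q : ℝ × ℝ => Θ q.1 i q.2))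
    (hu : ∀ i, ContDiff ℝ ∞ (fun q : ℝ × ℝ => u q.1 i q.2))
    (hK : ∀ i t, K.curve i t = toSphere (polarCurve (Θ 0) (u 0) 0 1 i t))
    {Θ' : Fin m → ℝ → ℝ} {u' : Fin m → ℝ → ℂ} (h' : IsPolar Θ' u' p) (hΘ' : Θ 1 = Θ')
    (hu' : u 1 = u') :
    K.Isotopic (h'.isConeLink le_rfl zero_lt_one zero_lt_one).toLink := by
  refine SmoothLink.isotopic_of_isConeLink (fun s => polarCurve (Θ s) (u s) 0 1)
    (fun s hs => (h s hs).isConeLink le_rfl zero_lt_one zero_lt_one) (fun i => ?_) hK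
    (fun i t => by rw [hΘ', hu', IsConeLink.toLink_curve])
  exact ((contDiff_exp_angle (hΘ i)).add contDiff_const).prodMk ((hu i).const_smul (1 : ℝ))

end IsPolar

/-- Each component is reparametrized by the inverse of its angle function. Increasing lifts of
degree one form a convex set, so interpolation with the identity is an isotopy. -/
lemma SmoothLink.IsClosedBraid.exists_linear {m : ℕ} {K : SmoothLink m} {n : ℕ∞}
    (hK : K.IsClosedBraid n) :
    ∃ (p : Fin m → ℤ) (u : Fin m → ℝ → ℂ) (h : IsPolar (linearAngle p) u p), (∀ i, p i ≠ 0) ∧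
      K.Isotopic (h.isConeLink le_rfl zero_lt_one zero_lt_one).toLink ∧
      {q : Fin m × ℝ | q.2 ∈ Set.Ico (0 : ℝ) 1 ∧
        Real.cos (linearAngle p q.1 q.2 - Real.pi) = 1}.encard ≤ n := by
  obtain ⟨havoid, hne, hcount⟩ := hK
  obtain ⟨Θ, u, p, hpol, hcurve, hangle⟩ := K.exists_polar havoid
  have hinv := fun i => exists_smooth_inverse (hpol.smooth_angle i) (hpol.angle_add_one i)
    (fun t => by rw [← hangle]; exact hne i t)
  choose g hg hg1 hgd hgΘ using fun i => (hinv i).2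
  have hlin : (fun i t => Θ i (g i t)) = linearAngle p := by
    funext i t; exact hgΘ i t
  have hpol' := hpol.comp hg hg1 hgd
  rw [hlin] at hpol'
  refine ⟨p, _, hpol', fun i => (hinv i).1, ?_, ?_⟩
  · refine IsPolar.isotopic_of_family (Θ := fun s i t => Θ i ((1 - s) * t + s * g i t))
      (u := fun s i t => u i ((1 - s) * t + s * g i t)) ?_ ?_ ?_ ?_ hpol' ?_ ?_
    · rintro s ⟨hs0, hs1⟩
      refine hpol.comp (g := fun i t => (1 - s) * t + s * g i t)
        (fun i => (contDiff_const.mul contDiff_id).add (contDiff_const.mul (hg i)))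
        (fun i t => by simp only [hg1]; ring) fun i t => ?_
      have h1 := ((hasDerivAt_id t).const_mul (1 - s)).fun_add
        (((hg i).differentiable (by simp) t).hasDerivAt.const_mul s)
      simp only [id] at h1
      rw [h1.deriv]
      rcases eq_or_lt_of_le hs0 with rfl | hs
      · norm_num
      · have := mul_pos hs (hgd i t)
        linarith
    · intro i
      exact (hpol.smooth_angle i).comp (((contDiff_const.sub contDiff_fst).mul contDiff_snd).add
        (contDiff_fst.mul ((hg i).comp contDiff_snd)))
    · intro i
      exact (hpol.smooth_fibre i).comp (((contDiff_const.sub contDiff_fst).mul contDiff_snd).add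
        (contDiff_fst.mul ((hg i).comp contDiff_snd)))
    · intro i t
      simpa using hcurve i t
    · rw [← hlin]
      funext i t
      simp
    · funext i t
      simp
  · rw [← hcount Real.pi, pageCount_eq_of_polar hpol hcurve]
    refine encard_Ico_le_of_rel (P := fun i t => Real.cos (linearAngle p i t - Real.pi) = 1)
      (Q := fun i t => Real.cos (Θ i t - Real.pi) = 1) (fun i t s => s = g i t) ?_ ?_ ?_ ?_ ?_
    · intro i t k h
      rwa [cos_angle_add_int (hpol'.angle_add_one i)]
    · intro i t k h
      rwa [cos_angle_add_int (hpol.angle_add_one i)]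
    · rintro i t _ k rfl
      have := periodic_add_int (g := fun t => g i t - t) (fun t => by simp only [hg1]; ring) t k
      linarith
    · intro i t h
      refine ⟨g i t, ?_, rfl⟩
      rw [← hlin] at h
      exact h
    · rintro i t t' s - - - h1 h2
      exact (strictMono_of_deriv_pos (hgd i)).injective (h1.symm.trans h2)

/-! ### Making the braid constant and radially separated near a page -/

/-- A smooth staircase, constant near the integers. -/
noncomputable def staircase (x : ℝ) : ℝ :=
  ⌊x⌋ + Real.smoothTransition (2 * Int.fract x - 1 / 2)

lemma staircase_add_int (x : ℝ) (k : ℤ) : staircase (x + k) = staircase x + k := by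
  rw [staircase, staircase, Int.floor_add_intCast, Int.fract_add_intCast]
  push_cast; ring

lemma staircase_eq_of_near {x : ℝ} {n : ℤ} (h1 : n - 1 / 4 ≤ x) (h2 : x ≤ n + 1 / 4) :
    staircase x = n := by
  rcases lt_or_ge x n with h | h
  · have hf : ⌊x⌋ = n - 1 := by
      rw [Int.floor_eq_iff]; push_cast; constructor <;> linarith
    rw [staircase, Int.fract, hf, Real.smoothTransition.one_of_one_le (by push_cast; linarith)]
    push_cast; ring
  · have hf : ⌊x⌋ = n := by
      rw [Int.floor_eq_iff]; constructor <;> linarith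
    rw [staircase, Int.fract, hf, Real.smoothTransition.zero_of_nonpos (by linarith), add_zero]

lemma contDiff_staircase : ContDiff ℝ ∞ staircase := by
  rw [contDiff_iff_contDiffAt]
  intro x
  have hs : ContDiffAt ℝ ∞ (fun y : ℝ => ⌊x⌋ +
      Real.smoothTransition (2 * (y - ⌊x⌋) - 1 / 2)) x :=
    (contDiff_const.add (Real.smoothTransition.contDiff.comp
      ((contDiff_const.mul (contDiff_id.sub contDiff_const)).sub contDiff_const))).contDiffAt
  refine hs.congr_of_eventuallyEq ?_
  filter_upwards [Ioo_mem_nhds (show (⌊x⌋ : ℝ) - 1 / 4 < x by linarith [Int.floor_le x])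
    (show x < ⌊x⌋ + 1 + 1 / 4 by linarith [Int.lt_floor_add_one x])] with y hy
  obtain ⟨h1, h2⟩ := hy
  rcases lt_or_ge y ⌊x⌋ with h | h
  · rw [staircase_eq_of_near h1.le (by linarith),
      Real.smoothTransition.zero_of_nonpos (by linarith), add_zero]
  rcases lt_or_ge y (⌊x⌋ + 1) with h' | h'
  · have : ⌊y⌋ = ⌊x⌋ := by rw [Int.floor_eq_iff]; exact ⟨h, h'⟩
    rw [staircase, Int.fract, this]
  · rw [staircase_eq_of_near (n := ⌊x⌋ + 1) (by push_cast; linarith) (by push_cast; linarith),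
      Real.smoothTransition.one_of_one_le (by linarith)]
    push_cast; ring

/-- For `x = p t` the half-space `Re z < 0` is traversed once per unit interval, around its
midpoint; the integer part labels the traversal and is locally constant there. -/
lemma floor_of_cos_neg {x : ℝ} (h : Real.cos (2 * Real.pi * x) < 0) :
    ⌊x⌋ + 1 / 4 < x ∧ x < ⌊x⌋ + 3 / 4 := by
  have hpi := Real.pi_pos
  have h1 := Int.floor_le x
  have h2 := Int.lt_floor_add_one x
  constructor
  · by_contra! hle
    refine absurd h (not_lt.2 ?_)
    rw [← Real.cos_sub_int_mul_two_pi _ ⌊x⌋]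
    exact Real.cos_nonneg_of_neg_pi_div_two_le_of_le (by nlinarith) (by nlinarith)
  · by_contra! hle
    refine absurd h (not_lt.2 ?_)
    rw [← Real.cos_sub_int_mul_two_pi _ (⌊x⌋ + 1)]
    push_cast
    exact Real.cos_nonneg_of_neg_pi_div_two_le_of_le (by nlinarith) (by nlinarith)

/-- A translation that moves finitely many points of the plane to distinct rays. -/
lemma exists_separating_translation {W : Set ℂ} (hW : W.Finite) :
    ∃ c : ℂ, (∀ a ∈ W, a + c ≠ 0) ∧
      ∀ a ∈ W, ∀ b ∈ W, ∀ r : ℝ, a + c = r • (b + c) → a = b := by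
  -- The translation is sought on the parabola `x + i x²`; each pair of points excludes only
  -- finitely many `x`.
  have key : ∀ q ∈ W ×ˢ W, ∀ᶠ x : ℝ in Filter.cofinite,
      q.1 + (x + x ^ 2 * Complex.I) ≠ 0 ∧ ∀ r : ℝ,
        q.1 + (x + x ^ 2 * Complex.I) = r • (q.2 + (x + x ^ 2 * Complex.I)) → q.1 = q.2 := by
    rintro ⟨a, b⟩ -
    have h1 : ∀ᶠ x : ℝ in Filter.cofinite, x ≠ -a.re :=
      (Set.finite_singleton (-a.re)).compl_mem_cofinite
    -- Proportionality makes the determinant of the two translated points vanish. Its cubic terms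
    -- cancel, and the coefficients of `x²` and `x` are both zero only for `a = b`.
    have h2 : ∀ᶠ x : ℝ in Filter.cofinite, a ≠ b →
        (b.re - a.re) * x ^ 2 + (a.im - b.im) * x + (a.im * b.re - a.re * b.im) ≠ 0 := by
      by_cases hab : a = b
      · exact Filter.Eventually.of_forall fun x h => absurd hab h
      set P : Polynomial ℝ := Polynomial.C (b.re - a.re) * Polynomial.X ^ 2 +
        Polynomial.C (a.im - b.im) * Polynomial.X + Polynomial.C (a.im * b.re - a.re * b.im) with hP
      have hP0 : P ≠ 0 := by
        intro h0
        have c2 : P.coeff 2 = b.re - a.re := by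
          simp [hP, -map_sub]
        have c1 : P.coeff 1 = a.im - b.im := by
          simp [hP, Polynomial.coeff_C, Polynomial.coeff_X_pow, -map_sub]
        rw [h0, Polynomial.coeff_zero] at c1 c2
        exact hab (Complex.ext (by linarith) (by linarith))
      have hfin : {x | P.IsRoot x}.Finite := Polynomial.finite_setOfPred_isRoot hP0
      filter_upwards [hfin.compl_mem_cofinite] with x hx _ h0
      apply hx
      simp only [Set.mem_ofPred_eq, Polynomial.IsRoot, hP]
      simpa using h0
    filter_upwards [h1, h2] with x hx1 hx2
    have hre : ∀ z : ℂ, (z + (x + x ^ 2 * Complex.I)).re = z.re + x := fun z => by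
      simp [← Complex.ofReal_pow]
    have him : ∀ z : ℂ, (z + (x + x ^ 2 * Complex.I)).im = z.im + x ^ 2 := fun z => by
      simp [← Complex.ofReal_pow]
    refine ⟨fun h0 => hx1 ?_, fun r hr => ?_⟩
    · have := congrArg Complex.re h0
      rw [hre, Complex.zero_re] at this
      linarith
    · by_contra hab
      apply hx2 hab
      have e1 := congrArg Complex.re hr
      have e2 := congrArg Complex.im hr
      rw [Complex.smul_re, hre, hre, smul_eq_mul] at e1
      rw [Complex.smul_im, him, him, smul_eq_mul] at e2
      linear_combination (b.re + x) * e2 - (b.im + x ^ 2) * e1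
  have hev := (Filter.eventually_all_finite (hW.prod hW)).2 key
  obtain ⟨x, hx⟩ := hev.exists
  exact ⟨x + x ^ 2 * Complex.I, fun a ha => (hx (a, a) ⟨ha, ha⟩).1,
    fun a ha b hb => (hx (a, b) ⟨ha, hb⟩).2⟩

/-- The strands of a braid with winding numbers `p`. -/
def strandSet {m : ℕ} (p : Fin m → ℤ) : Set (Fin m × ℤ) := {x | 0 ≤ x.2 ∧ x.2 < |p x.1|}

lemma finite_strandSet {m : ℕ} (p : Fin m → ℤ) : (strandSet p).Finite := by
  refine Set.Finite.subset (Set.finite_iUnion fun i : Fin m =>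
    (Set.finite_Ico (0 : ℤ) |p i|).image fun n => (i, n)) ?_
  rintro ⟨i, n⟩ ⟨h1, h2⟩
  exact Set.mem_iUnion.2 ⟨i, n, ⟨h1, h2⟩, rfl⟩

lemma emod_mem_strandSet {m : ℕ} {p : Fin m → ℤ} (hp : ∀ i, p i ≠ 0) (i : Fin m) (n : ℤ) :
    (i, n % p i) ∈ strandSet p :=
  ⟨Int.emod_nonneg _ (hp i), Int.emod_lt_abs _ (hp i)⟩

/-- A braid with constant speed that does not move in the half-space `Re z < 0`, where its strands
have different directions. -/
structure IsFlatBraid {m : ℕ} (p : Fin m → ℤ) (u : Fin m → ℝ → ℂ) : Prop where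
  isPolar : IsPolar (linearAngle p) u p
  winding_ne : ∀ i, p i ≠ 0
  flat : ∀ i s t, Real.cos (linearAngle p i s) < 0 → Real.cos (linearAngle p i t) < 0 →
    ⌊p i * s⌋ = ⌊p i * t⌋ → u i s = u i t
  fibre_ne_zero : ∀ i t, Real.cos (linearAngle p i t) < 0 → u i t ≠ 0
  separated : ∀ i j s t (a : ℝ), Real.cos (linearAngle p i s) < 0 →
    Real.cos (linearAngle p j t) < 0 → u i s = a • u j t →
    i = j ∧ ∃ l : ℤ, ⌊p i * t⌋ = ⌊p i * s⌋ + p i * l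

/-- At angle `2π x` the new braid shows the cross-section of the old one at angle `2π χ(x)`, where
`χ` is constant near half-integers and commutes with integer translations; so cross-sections stay
free of collisions, even where `χ` is not injective. A final translation of the fibre moves the
finitely many resting values to distinct rays. -/
lemma IsPolar.exists_flat {m : ℕ} {p : Fin m → ℤ} {u : Fin m → ℝ → ℂ}
    (h : IsPolar (linearAngle p) u p) (hp : ∀ i, p i ≠ 0) :
    ∃ (u' : Fin m → ℝ → ℂ) (h' : IsFlatBraid p u'),
      (h.isConeLink le_rfl zero_lt_one zero_lt_one).toLink.Isotopic
        (h'.isPolar.isConeLink le_rfl zero_lt_one zero_lt_one).toLink := by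
  have hp' : ∀ i, (p i : ℝ) ≠ 0 := fun i => by exact_mod_cast hp i
  -- The fibre coordinate at the midpoint of the `n`-th traversal; it depends only on `n` modulo `p
  -- i`, so there are finitely many values.
  set V : Fin m × ℤ → ℂ := fun x => u x.1 ((x.2 + 1 / 2) / p x.1) with hV
  have hVmod : ∀ i n, V (i, n) = V (i, n % p i) := by
    intro i n
    simp only [hV]
    rw [← h.fibre_add_int i (((n % p i : ℤ) + 1 / 2) / p i) (n / p i)]
    congr 1
    have h1 : (n : ℝ) = (n % p i : ℤ) + p i * (n / p i : ℤ) := by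
      exact_mod_cast (Int.emod_add_mul_ediv n (p i)).symm
    have := hp' i
    rw [div_add' _ _ _ this, div_left_inj' this, h1]
    ring
  have hW : (Set.range V).Finite := by
    refine ((finite_strandSet p).image V).subset ?_
    rintro _ ⟨⟨i, n⟩, rfl⟩
    exact ⟨_, emod_mem_strandSet hp i n, (hVmod i n).symm⟩
  obtain ⟨c, hc0, hc⟩ := exists_separating_translation hW
  set χ : ℝ → ℝ → ℝ := fun s x => (1 - s) * x + s * (staircase (x - 1 / 2) + 1 / 2) with hχ
  have hχint : ∀ s x (k : ℤ), χ s (x + k) = χ s x + k := fun s x k => by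
    simp only [hχ]
    rw [show x + (k : ℝ) - 1 / 2 = x - 1 / 2 + k by ring, staircase_add_int]
    ring
  set U : ℝ → Fin m → ℝ → ℂ := fun s i t => u i (χ s (p i * t) / p i) + (s : ℂ) * c with hU
  have hχs : ContDiff ℝ ∞ (fun q : ℝ × ℝ => χ q.1 q.2) :=
    ((contDiff_const.sub contDiff_fst).mul contDiff_snd).add (contDiff_fst.mul
      ((contDiff_staircase.comp (contDiff_snd.sub contDiff_const)).add contDiff_const))
  have hUs : ∀ i, ContDiff ℝ ∞ (fun q : ℝ × ℝ => U q.1 i q.2) := fun i =>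
    ((h.smooth_fibre i).comp ((hχs.comp (contDiff_fst.prodMk
      (contDiff_const.mul contDiff_snd))).div_const _)).add
      ((Complex.ofRealCLM.contDiff.comp contDiff_fst).mul contDiff_const)
  have hpolar : ∀ s, IsPolar (linearAngle p) (U s) p := fun s => by
    refine ⟨h.smooth_angle, fun i => (hUs i).comp (contDiff_const.prodMk contDiff_id),
      h.angle_add_one, fun i t => ?_, fun i t h0 => ?_, fun i j x y k hk hu => ?_⟩
    · simp only [hU]
      rw [mul_add, mul_one, hχint, add_div, div_self (hp' i), h.fibre_periodic]
    · have : deriv (linearAngle p i) t = 2 * Real.pi * (p i * 1) :=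
        (((hasDerivAt_id t).const_mul (p i : ℝ)).const_mul (2 * Real.pi)).deriv
      rw [this, mul_one] at h0
      exact absurd h0 (mul_ne_zero Real.two_pi_pos.ne' (hp' i))
    · have hk' : p i * x = p j * y + k := by
        have : 2 * Real.pi * (p i * x) = 2 * Real.pi * (p j * y + k) := by
          simp only [linearAngle] at hk; linarith
        exact mul_left_cancel₀ Real.two_pi_pos.ne' this
      simp only [hU, add_left_inj] at hu
      obtain ⟨rfl, l, hl⟩ := h.injective i j _ _ k (by
        simp only [linearAngle]
        rw [mul_div_cancel₀ _ (hp' i), mul_div_cancel₀ _ (hp' j), hk', hχint]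
        ring) hu
      refine ⟨rfl, l, ?_⟩
      have h1 := hχint s (p i * y) k
      rw [← hk'] at h1
      rw [div_eq_iff (hp' i), add_mul, div_mul_cancel₀ _ (hp' i), h1] at hl
      have h2 : (p i : ℝ) * (y - x - l) = 0 := by linarith
      linarith [(mul_eq_zero.1 h2).resolve_left (hp' i)]
  have hflat : ∀ i t, Real.cos (linearAngle p i t) < 0 → U 1 i t = V (i, ⌊p i * t⌋) + c := by
    intro i t ht
    obtain ⟨h1, h2⟩ := floor_of_cos_neg ht
    simp only [hU, hV, hχ, Complex.ofReal_one, one_mul, sub_self, zero_mul, zero_add]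
    rw [staircase_eq_of_near (n := ⌊p i * t⌋) (by linarith) (by linarith)]
  have hfb : IsFlatBraid p (U 1) := by
    refine ⟨hpolar 1, hp, fun i s t hs ht hst => ?_, fun i t ht => ?_,
      fun i j s t a hs ht hst => ?_⟩
    · rw [hflat i s hs, hflat i t ht, hst]
    · rw [hflat i t ht]
      exact hc0 _ ⟨_, rfl⟩
    · rw [hflat i s hs, hflat j t ht] at hst
      have hVV := hc _ ⟨_, rfl⟩ _ ⟨_, rfl⟩ a hst
      obtain ⟨rfl, l, hl⟩ := h.injective i j _ _ (⌊p i * s⌋ - ⌊p j * t⌋) (by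
        simp only [linearAngle]
        rw [mul_div_cancel₀ _ (hp' i), mul_div_cancel₀ _ (hp' j)]
        push_cast
        ring) hVV
      refine ⟨rfl, l, ?_⟩
      rw [div_eq_iff (hp' i), add_mul, div_mul_cancel₀ _ (hp' i)] at hl
      have : (⌊p i * t⌋ : ℝ) = ⌊p i * s⌋ + p i * l := by linarith
      exact_mod_cast this
  refine ⟨U 1, hfb, ?_⟩
  refine IsPolar.isotopic_of_family (Θ := fun _ => linearAngle p) (u := U) (fun s _ => hpolar s)
    (fun i => (h.smooth_angle i).comp contDiff_snd) hUs (fun i t => ?_) hfb.isPolar rfl rfl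
  rw [IsConeLink.toLink_curve]
  congr 1
  simp only [polarCurve, hU, hχ, sub_zero, one_mul, zero_mul, add_zero, Complex.ofReal_zero]
  rw [mul_div_cancel_left₀ _ (hp' i)]

/-! ### Pulling strands across the axis -/

section Strands

variable {m : ℕ} {p : Fin m → ℤ}

/-- The strand that contains a point of the half-space `Re z < 0`. -/
noncomputable def strand (p : Fin m → ℤ) (i : Fin m) (t : ℝ) : Fin m × ℤ := (i, ⌊p i * t⌋ % p i)

lemma linearAngle_add_int (i : Fin m) (t : ℝ) (k : ℤ) :
    linearAngle p i (t + k) = linearAngle p i t + (p i * k : ℤ) * (2 * Real.pi) := by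
  simp only [linearAngle]; push_cast; ring

lemma cos_linearAngle_add_int (i : Fin m) (t : ℝ) (k : ℤ) :
    Real.cos (linearAngle p i (t + k)) = Real.cos (linearAngle p i t) := by
  rw [linearAngle_add_int, Real.cos_add_int_mul_two_pi]

lemma tan_linearAngle_add_int (i : Fin m) (t : ℝ) (k : ℤ) :
    Real.tan (linearAngle p i (t + k)) = Real.tan (linearAngle p i t) := by
  rw [Real.tan_eq_sin_div_cos, Real.tan_eq_sin_div_cos, cos_linearAngle_add_int,
    linearAngle_add_int, Real.sin_add_int_mul_two_pi]

lemma strand_add_int (i : Fin m) (t : ℝ) (k : ℤ) : strand p i (t + k) = strand p i t := by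
  have : (p i * (t + k) : ℝ) = p i * t + (p i * k : ℤ) := by push_cast; ring
  rw [strand, strand, this, Int.floor_add_intCast, Int.add_mul_emod_self_left]

lemma hasDerivAt_linearAngle (i : Fin m) (t : ℝ) :
    HasDerivAt (linearAngle p i) (2 * Real.pi * p i) t := by
  have := ((hasDerivAt_id t).const_mul (p i : ℝ)).const_mul (2 * Real.pi)
  rw [mul_one] at this
  exact this

lemma contDiff_linearAngle (i : Fin m) : ContDiff ℝ ∞ (linearAngle p i) :=
  contDiff_const.mul (contDiff_const.mul contDiff_id)

/-- A point of the half-space `Re z < 0` is determined by its strand and the tangent of its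
angle. -/
lemma exists_eq_add_int_of_strand_eq (hp : ∀ i, p i ≠ 0) {i : Fin m} {s t : ℝ}
    (hs : Real.cos (linearAngle p i s) < 0) (ht : Real.cos (linearAngle p i t) < 0)
    (hst : strand p i s = strand p i t)
    (htan : Real.tan (linearAngle p i s) = Real.tan (linearAngle p i t)) :
    ∃ l : ℤ, t = s + l := by
  have hp' : (p i : ℝ) ≠ 0 := by exact_mod_cast hp i
  have hpi := Real.pi_pos
  obtain ⟨hs1, hs2⟩ := floor_of_cos_neg hs
  obtain ⟨ht1, ht2⟩ := floor_of_cos_neg ht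
  obtain ⟨l, hl⟩ := Int.dvd_of_emod_eq_zero
    (Int.emod_eq_emod_iff_emod_sub_eq_zero.1 (congrArg Prod.snd hst))
  -- Subtracting an odd multiple of `π` brings the angle into `(-π/2, π/2)`, where the tangent is
  -- injective.
  have hred : ∀ x : ℝ, Real.tan (2 * Real.pi * (p i * x)) =
      Real.tan (2 * Real.pi * (p i * x - ⌊p i * x⌋ - 1 / 2)) := fun x => by
    rw [← Real.tan_sub_int_mul_pi _ (2 * ⌊p i * x⌋ + 1)]
    congr 1
    push_cast
    ring
  simp only [linearAngle] at htan
  rw [hred s, hred t] at htan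
  have h1 := Real.injOn_tan (by constructor <;> nlinarith) (by constructor <;> nlinarith) htan
  have h2 := mul_left_cancel₀ Real.two_pi_pos.ne' h1
  have h3 : (⌊p i * s⌋ : ℝ) - ⌊p i * t⌋ = p i * l := by exact_mod_cast hl
  refine ⟨-l, ?_⟩
  push_cast
  apply mul_left_cancel₀ hp'
  linarith

lemma eq_of_mem_Ico_of_eq_add_int {s t : ℝ} (hs : s ∈ Set.Ico (0 : ℝ) 1)
    (ht : t ∈ Set.Ico (0 : ℝ) 1) {l : ℤ} (h : t = s + l) : s = t := by
  simp only [Set.mem_Ico] at hs ht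
  have h1 : (l : ℝ) < 1 := by linarith
  have h2 : (-1 : ℝ) < l := by linarith
  have h3 : l < 1 := by exact_mod_cast h1
  have h4 : -1 < l := by exact_mod_cast h2
  have : l = 0 := by omega
  simp [h, this]

/-- Every strand has a point with a given tangent of the angle. -/
lemma exists_mem_strand (hp : ∀ i, p i ≠ 0) {x : Fin m × ℤ} (hx : x ∈ strandSet p) (y : ℝ) :
    ∃ t ∈ Set.Ico (0 : ℝ) 1, Real.cos (linearAngle p x.1 t) < 0 ∧ strand p x.1 t = x ∧
      -Real.tan (linearAngle p x.1 t) = y := by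
  obtain ⟨i, n⟩ := x
  have hp' : (p i : ℝ) ≠ 0 := by exact_mod_cast hp i
  have hpi := Real.pi_pos
  -- The angle becomes `π - arctan y` plus a multiple of `2π`: in the left half-plane, with `-tan`
  -- equal to `y`.
  set x : ℝ := n + 1 / 2 - Real.arctan y / (2 * Real.pi) with hxdef
  have h1 : -(1 / 4) < Real.arctan y / (2 * Real.pi) := by
    rw [lt_div_iff₀ Real.two_pi_pos]; linarith [Real.neg_pi_div_two_lt_arctan y]
  have h2 : Real.arctan y / (2 * Real.pi) < 1 / 4 := by
    rw [div_lt_iff₀ Real.two_pi_pos]; linarith [Real.arctan_lt_pi_div_two y]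
  have hang : linearAngle p i (x / p i) = -Real.arctan y + Real.pi + n * (2 * Real.pi) := by
    rw [linearAngle, mul_div_cancel₀ _ hp', hxdef]
    field_simp
    ring
  have hfl : ⌊x⌋ = n := by
    rw [Int.floor_eq_iff]; constructor <;> linarith
  refine ⟨x / p i + (-⌊x / p i⌋ : ℤ), ?_, ?_, ?_, ?_⟩
  · push_cast
    constructor
    · linarith [Int.floor_le (x / p i)]
    · linarith [Int.lt_floor_add_one (x / p i)]
  · rw [cos_linearAngle_add_int, hang, Real.cos_add_int_mul_two_pi, Real.cos_add_pi, Real.cos_neg]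
    linarith [Real.cos_arctan_pos y]
  · rw [strand_add_int, strand, mul_div_cancel₀ _ hp', hfl, ← Int.emod_abs,
      Int.emod_eq_of_lt hx.1 hx.2]
  · rw [tan_linearAngle_add_int, hang]
    have : -Real.arctan y + Real.pi + n * (2 * Real.pi) =
        -Real.arctan y + ((2 * n + 1 : ℤ) : ℝ) * Real.pi := by push_cast; ring
    rw [this, Real.tan_add_int_mul_pi, Real.tan_neg, Real.tan_arctan, neg_neg]

lemma strand_mem (hp : ∀ i, p i ≠ 0) (i : Fin m) (t : ℝ) : strand p i t ∈ strandSet p :=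
  emod_mem_strandSet hp i _

end Strands

namespace IsFlatBraid

variable {m : ℕ} {p : Fin m → ℤ} {u : Fin m → ℝ → ℂ}

lemma fibre_eq_of_strand_eq (h : IsFlatBraid p u) {i : Fin m} {s t : ℝ}
    (hs : Real.cos (linearAngle p i s) < 0) (ht : Real.cos (linearAngle p i t) < 0)
    (hst : strand p i s = strand p i t) : u i s = u i t := by
  obtain ⟨l, hl⟩ := Int.dvd_of_emod_eq_zero
    (Int.emod_eq_emod_iff_emod_sub_eq_zero.1 (congrArg Prod.snd hst))
  rw [← h.isPolar.fibre_add_int i t l]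
  refine h.flat i _ _ hs (by rwa [cos_linearAngle_add_int]) ?_
  have : (p i * (t + l) : ℝ) = p i * t + (p i * l : ℤ) := by push_cast; ring
  rw [this, Int.floor_add_intCast]
  linarith

/-- Over the half-space the fibre takes finitely many values, all non-zero, while the fibre is
bounded everywhere. The factor `2η` will bound `|z|` on the part of a finger that has crossed into
`0 ≤ Re z`. -/
lemma exists_small (h : IsFlatBraid p u) :
    ∃ η > 0, ∀ i j s t, Real.cos (linearAngle p i s) < 0 → 2 * η * ‖u j t‖ < ‖u i s‖ := by
  have hM : ∀ i, ∃ M > 0, ∀ t, ‖u i t‖ ≤ M := fun i => by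
    obtain ⟨M, hM, hM'⟩ := exists_abs_le_of_periodic (f := fun t => ‖u i t‖)
      (h.isPolar.smooth_fibre i).continuous.norm (fun t => by rw [h.isPolar.fibre_periodic])
    exact ⟨M, hM, fun t => by simpa using hM' t⟩
  choose M hM0 hM using hM
  have hx : ∀ x ∈ strandSet p, ∀ᶠ η in nhdsWithin (0 : ℝ) (Set.Ioi 0), ∀ j,
      ∀ s, Real.cos (linearAngle p x.1 s) < 0 → strand p x.1 s = x →
        2 * η * M j < ‖u x.1 s‖ := by
    intro x hx
    obtain ⟨s₀, -, hs₀, hxs, -⟩ := exists_mem_strand h.winding_ne hx 0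
    refine Filter.eventually_all.2 fun j => ?_
    have hpos := norm_pos_iff.2 (h.fibre_ne_zero x.1 s₀ hs₀)
    have hpos' : 0 < ‖u x.1 s₀‖ / (2 * M j) := div_pos hpos (mul_pos two_pos (hM0 j))
    filter_upwards [Ioo_mem_nhdsGT hpos'] with η hη s hs hss
    rw [h.fibre_eq_of_strand_eq hs hs₀ (hss.trans hxs.symm)]
    have := (lt_div_iff₀ (mul_pos two_pos (hM0 j))).1 hη.2
    linarith
  obtain ⟨η, hη, hη0⟩ := (((Filter.eventually_all_finite (finite_strandSet p)).2 hx).and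
    self_mem_nhdsWithin).exists
  have hη0 : 0 < η := hη0
  refine ⟨η, hη0, fun i j s t hs => lt_of_le_of_lt ?_
    (hη _ (strand_mem h.winding_ne i s) j s hs rfl)⟩
  exact mul_le_mul_of_nonneg_left (hM j t) (by positivity)

end IsFlatBraid

/-! ### The displaced braid and its isotopy -/

/-- The displacement of the strands in the direction of the real axis. -/
noncomputable def fingerShift {m : ℕ} (p : Fin m → ℤ) (Y : Fin m × ℤ → ℝ → ℝ) (i : Fin m)
    (t : ℝ) : ℝ :=
  if Real.cos (linearAngle p i t) < 0 then
    -Real.cos (linearAngle p i t) * Y (strand p i t) (-Real.tan (linearAngle p i t)) else 0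

section Finger

variable {m : ℕ} {p : Fin m → ℤ} {Y : Fin m × ℤ → ℝ → ℝ} {η : ℝ} {k : Fin m × ℤ → ℕ}

lemma eventually_cos_neg {i : Fin m} {t : ℝ} (ht : Real.cos (linearAngle p i t) < 0) :
    ∀ᶠ s in nhds t, Real.cos (linearAngle p i s) < 0 ∧ ⌊p i * s⌋ = ⌊p i * t⌋ := by
  obtain ⟨h1, h2⟩ := floor_of_cos_neg ht
  have hc : Continuous fun s => Real.cos (linearAngle p i s) :=
    Real.continuous_cos.comp (contDiff_linearAngle i).continuous
  have hc' : Continuous fun s : ℝ => (p i : ℝ) * s := continuous_const.mul continuous_id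
  filter_upwards [hc.continuousAt.eventually (gt_mem_nhds ht),
    hc'.continuousAt.eventually (Ioo_mem_nhds (show (⌊p i * t⌋ : ℝ) < p i * t by linarith)
      (show p i * t < (⌊p i * t⌋ : ℝ) + 1 by linarith))] with s hs1 hs2
  refine ⟨hs1, ?_⟩
  rw [Int.floor_eq_iff]
  exact ⟨hs2.1.le, hs2.2⟩

lemma fingerShift_eventuallyEq {i : Fin m} {t : ℝ} (ht : Real.cos (linearAngle p i t) < 0) :
    fingerShift p Y i =ᶠ[nhds t] fun s => -Real.cos (linearAngle p i s) *
      Y (strand p i t) (-Real.tan (linearAngle p i s)) := by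
  filter_upwards [eventually_cos_neg ht] with s hs
  rw [fingerShift, if_pos hs.1, strand, strand, hs.2]

/-- Towards the boundary of the half-space the tangent tends to infinity and leaves the support of
the profiles, so the case distinction in `fingerShift` is smooth. -/
lemma fingerShift_eventuallyEq_zero (hY : ∀ x, IsProfile (k x) η (Y x)) {i : Fin m}
    {t : ℝ} (ht : 0 ≤ Real.cos (linearAngle p i t)) :
    fingerShift p Y i =ᶠ[nhds t] fun _ => 0 := by
  have hc : Continuous fun s => Real.cos (linearAngle p i s) :=
    Real.continuous_cos.comp (contDiff_linearAngle i).continuous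
  have hs : Continuous fun s => Real.sin (linearAngle p i s) :=
    Real.continuous_sin.comp (contDiff_linearAngle i).continuous
  have hev : ∀ᶠ s in nhds t, 0 < Real.cos (linearAngle p i s) ∨
      η * |Real.cos (linearAngle p i s)| < |Real.sin (linearAngle p i s)| := by
    rcases eq_or_lt_of_le ht with h0 | h0
    · have : η * |Real.cos (linearAngle p i t)| < |Real.sin (linearAngle p i t)| := by
        rw [← h0, abs_zero, mul_zero, abs_pos]
        intro h1
        have := Real.sin_sq_add_cos_sq (linearAngle p i t)
        rw [← h0, h1] at this
        norm_num at this
      filter_upwards [(continuous_const.mul hc.abs).continuousAt.eventually_lt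
        hs.abs.continuousAt this] with s hs using Or.inr hs
    · filter_upwards [hc.continuousAt.eventually (lt_mem_nhds h0)] with s hs using Or.inl hs
  filter_upwards [hev] with s hs
  rw [fingerShift]
  split_ifs with hneg
  · rcases hs with h1 | h1
    · linarith
    · rw [(hY _).eq_zero, mul_zero]
      rw [abs_neg, Real.tan_eq_sin_div_cos, abs_div, le_div_iff₀ (abs_pos.2 hneg.ne)]
      exact h1.le
  · rfl

lemma contDiff_fingerShift (hY : ∀ x, IsProfile (k x) η (Y x)) (i : Fin m) :
    ContDiff ℝ ∞ (fingerShift p Y i) := by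
  rw [contDiff_iff_contDiffAt]
  intro t
  rcases lt_or_ge (Real.cos (linearAngle p i t)) 0 with h | h
  · refine ContDiffAt.congr_of_eventuallyEq ?_ (fingerShift_eventuallyEq h)
    have h1 := (contDiff_linearAngle (p := p) i).contDiffAt (x := t)
    exact (Real.contDiff_cos.contDiffAt.comp t h1).neg.mul
      ((hY _).smooth.contDiffAt.comp t ((Real.contDiffAt_tan.2 h.ne).comp t h1).neg)
  · exact contDiffAt_const.congr_of_eventuallyEq (fingerShift_eventuallyEq_zero hY h)

lemma fingerShift_add_one (i : Fin m) (t : ℝ) :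
    fingerShift p Y i (t + 1) = fingerShift p Y i t := by
  have h1 := cos_linearAngle_add_int (p := p) i t 1
  have h2 := tan_linearAngle_add_int (p := p) i t 1
  have h3 := strand_add_int (p := p) i t 1
  rw [Int.cast_one] at h1 h2 h3
  rw [fingerShift, fingerShift, h1, h2, h3]

lemma fingerShift_nonneg (hY : ∀ x, IsProfile (k x) η (Y x)) (i : Fin m) (t : ℝ) :
    0 ≤ fingerShift p Y i t := by
  rw [fingerShift]
  split_ifs with h
  · exact mul_nonneg (by linarith) ((hY _).nonneg _)
  · exact le_rfl

lemma fingerShift_of_nonneg {i : Fin m} {t : ℝ} (ht : 0 ≤ Real.cos (linearAngle p i t)) :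
    fingerShift p Y i t = 0 := by
  rw [fingerShift, if_neg (not_lt.2 ht)]

/-- The braid with its strands displaced along the real axis. -/
noncomputable def fingerCurve (p : Fin m → ℤ) (u : Fin m → ℝ → ℂ) (Y : Fin m × ℤ → ℝ → ℝ) (s : ℝ)
    (i : Fin m) (t : ℝ) : ℂ × ℂ :=
  (Complex.exp (linearAngle p i t * Complex.I) + ((s * fingerShift p Y i t : ℝ) : ℂ), u i t)

variable {u : Fin m → ℝ → ℂ}

lemma fingerCurve_re (s : ℝ) (i : Fin m) (t : ℝ) : (fingerCurve p u Y s i t).1.re =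
    Real.cos (linearAngle p i t) + s * fingerShift p Y i t := by
  simp only [fingerCurve, Complex.add_re, Complex.exp_ofReal_mul_I_re, Complex.ofReal_re]

lemma fingerCurve_im (s : ℝ) (i : Fin m) (t : ℝ) : (fingerCurve p u Y s i t).1.im =
    Real.sin (linearAngle p i t) := by
  simp only [fingerCurve, Complex.add_im, Complex.exp_ofReal_mul_I_im, Complex.ofReal_im, add_zero]

lemma fingerCurve_of_nonneg (s : ℝ) {i : Fin m} {t : ℝ}
    (ht : 0 ≤ Real.cos (linearAngle p i t)) :
    fingerCurve p u Y s i t = polarCurve (linearAngle p) u 0 1 i t := by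
  rw [fingerCurve, fingerShift_of_nonneg ht, polarCurve, one_smul, mul_zero]

lemma norm_polarCurve_zero_fst (Θ : Fin m → ℝ → ℝ) (i : Fin m) (t : ℝ) :
    ‖(polarCurve Θ u 0 1 i t).1‖ = 1 := by
  rw [polarCurve, Complex.ofReal_zero, add_zero, Complex.norm_exp_ofReal_mul_I]

lemma tan_eq_tan_of_sin_eq {x y : ℝ} (hx : Real.cos x < 0) (hy : Real.cos y < 0)
    (h : Real.sin x = Real.sin y) : Real.tan x = Real.tan y := by
  have h1 := Real.sin_sq_add_cos_sq x
  have h2 := Real.sin_sq_add_cos_sq y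
  have h3 : (Real.cos x - Real.cos y) * (Real.cos x + Real.cos y) = 0 := by
    rw [h] at h1; linarith
  have h4 : Real.cos x = Real.cos y := by
    rcases mul_eq_zero.1 h3 with h | h <;> linarith
  rw [Real.tan_eq_sin_div_cos, Real.tan_eq_sin_div_cos, h, h4]

/-- A displaced strand does not meet the part of the braid in the half-space `0 ≤ Re z`. -/
lemma fingerCurve_ne_smul (hη : 0 < η) (hY : ∀ x, IsProfile (k x) η (Y x))
    (hsmall : ∀ i j s t, Real.cos (linearAngle p i s) < 0 → 2 * η * ‖u j t‖ < ‖u i s‖)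
    {s : ℝ} (hs1 : s ≤ 1) {i j : Fin m} {x y a : ℝ} (ha : 0 < a)
    (hx : Real.cos (linearAngle p i x) < 0) (hy : 0 ≤ Real.cos (linearAngle p j y))
    (h : fingerCurve p u Y s i x = a • fingerCurve p u Y s j y) : False := by
  have h1 := congrArg Prod.fst h
  have h2 : u i x = a • u j y := congrArg Prod.snd h
  have hρ := fingerShift_nonneg (p := p) hY i x
  have hre := congrArg Complex.re h1
  have him := fingerCurve_im (p := p) (u := u) (Y := Y) s i x
  rw [fingerCurve_re, Prod.smul_fst, Complex.smul_re, fingerCurve_re, fingerShift_of_nonneg hy,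
    mul_zero, add_zero, smul_eq_mul] at hre
  have hre0 : 0 ≤ Real.cos (linearAngle p i x) + s * fingerShift p Y i x := by
    rw [hre]; positivity
  have hne : fingerShift p Y i x ≠ 0 := fun h0 => by
    rw [h0] at hre0; linarith
  rw [fingerShift, if_pos hx] at hne
  -- Only a displaced point can have non-negative real part, so the point lies in the thin sector
  -- where the profile is supported; there both `|Re z|` and `|Im z|` are at most `η`.
  have htan : |Real.tan (linearAngle p i x)| < η := by
    by_contra! hle
    exact hne (by rw [(hY _).eq_zero _ (by rwa [abs_neg]), mul_zero])
  have hcos := Real.neg_one_le_cos (linearAngle p i x)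
  have hre1 : Real.cos (linearAngle p i x) + s * fingerShift p Y i x ≤ η := by
    have h3 : fingerShift p Y i x ≤ -Real.cos (linearAngle p i x) * (1 + η) := by
      rw [fingerShift, if_pos hx]
      exact mul_le_mul_of_nonneg_left ((hY _).le _) (by linarith)
    have h4 : s * fingerShift p Y i x ≤ fingerShift p Y i x := mul_le_of_le_one_left hρ hs1
    nlinarith
  have him1 : |Real.sin (linearAngle p i x)| ≤ η := by
    have : Real.sin (linearAngle p i x) =
        Real.tan (linearAngle p i x) * Real.cos (linearAngle p i x) :=
      (Real.tan_mul_cos hx.ne).symm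
    rw [this, abs_mul, abs_of_neg hx]
    nlinarith [abs_nonneg (Real.tan (linearAngle p i x))]
  -- The undisplaced point has `|z| = 1`, so the factor of proportionality is the modulus of the
  -- displaced one.
  have hnorm : ‖(fingerCurve p u Y s i x).1‖ = a := by
    rw [h1, Prod.smul_fst, norm_smul, fingerCurve_of_nonneg s hy, norm_polarCurve_zero_fst,
      mul_one, Real.norm_of_nonneg ha.le]
  have hale : a ≤ 2 * η := by
    rw [← hnorm]
    refine (Complex.norm_le_abs_re_add_abs_im _).trans ?_
    rw [fingerCurve_re, him, abs_of_nonneg hre0]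
    linarith
  have h5 := hsmall i j x y hx
  rw [h2, norm_smul, Real.norm_of_nonneg ha.le] at h5
  exact absurd h5 (not_lt.2 (mul_le_mul_of_nonneg_right hale (norm_nonneg _)))

/-- Over the half-space the constant fibre coordinates identify the strand and force the factor `1`;
the displacement preserves `Im z`, which then identifies the point on the strand. Elsewhere the
braid is unchanged, and mixed coincidences are excluded by `fingerCurve_ne_smul`. -/
lemma isConeLink_fingerCurve (h : IsFlatBraid p u) (hη : 0 < η)
    (hY : ∀ x, IsProfile (k x) η (Y x))
    (hsmall : ∀ i j s t, Real.cos (linearAngle p i s) < 0 → 2 * η * ‖u j t‖ < ‖u i s‖)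
    {s : ℝ} (hs1 : s ≤ 1) : IsConeLink (fingerCurve p u Y s) := by
  have hcl := h.isPolar.isConeLink le_rfl zero_lt_one zero_lt_one
  have hp' : ∀ i, (p i : ℝ) ≠ 0 := fun i => by exact_mod_cast h.winding_ne i
  have hsmooth : ∀ i, ContDiff ℝ ∞ (fun t => Complex.exp (linearAngle p i t * Complex.I) +
      ((s * fingerShift p Y i t : ℝ) : ℂ)) := fun i =>
    (contDiff_exp_angle (contDiff_linearAngle i)).add
      (Complex.ofRealCLM.contDiff.comp (contDiff_const.mul (contDiff_fingerShift hY i)))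
  refine ⟨fun i => (hsmooth i).prodMk (h.isPolar.smooth_fibre i), fun i t => ?_, fun i t h0 => ?_,
    fun i t a ha => ?_, fun i j x y a ha hxy => ?_⟩
  · have h1 := congrArg Prod.fst (hcl.periodic i t)
    simp only [polarCurve, add_left_inj] at h1
    rw [fingerCurve, fingerCurve, h1, fingerShift_add_one, h.isPolar.fibre_periodic]
  · rcases lt_or_ge (Real.cos (linearAngle p i t)) 0 with ht | ht
    · exact h.fibre_ne_zero i t ht (congrArg Prod.snd h0)
    · rw [fingerCurve_of_nonneg s ht] at h0
      exact hcl.ne_zero i t h0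
  · rcases lt_or_ge (Real.cos (linearAngle p i t)) 0 with ht | ht
    · have hu : u i =ᶠ[nhds t] fun _ => u i t := by
        filter_upwards [eventually_cos_neg ht] with x hx
        exact h.flat i x t hx.1 ht hx.2
      have hd : HasDerivAt (fingerCurve p u Y s i) _ t :=
        ((hsmooth i).differentiable (by simp) t).hasDerivAt.prodMk
          ((h.isPolar.smooth_fibre i).differentiable (by simp) t).hasDerivAt
      rw [hd.deriv] at ha
      have h2 : deriv (u i) t = a • u i t := congrArg Prod.snd ha
      -- The fibre is locally constant and non-zero, so a radial velocity must vanish; but `Im z =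
      -- sin θ` has non-zero derivative where `cos θ < 0`.
      rw [hu.deriv_eq, deriv_const, eq_comm, smul_eq_zero] at h2
      have ha0 := h2.resolve_right (h.fibre_ne_zero i t ht)
      rw [ha0, zero_smul] at ha
      have h1 := congrArg Prod.fst ha
      have h3 : HasDerivAt (fun t => Real.sin (linearAngle p i t)) (0 : ℂ).im t := by
        have h4 := ((hsmooth i).differentiable (by simp) t).hasDerivAt
        simp only at h1
        rw [h1] at h4
        have h5 := Complex.imCLM.hasFDerivAt.comp_hasDerivAt t h4
        refine h5.congr_of_eventuallyEq (Filter.Eventually.of_forall fun x => ?_)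
        exact (fingerCurve_im (u := u) (Y := Y) s i x).symm
      have h4 := h3.unique (hasDerivAt_linearAngle i t).sin
      rw [Complex.zero_im, eq_comm] at h4
      exact mul_ne_zero ht.ne (mul_ne_zero Real.two_pi_pos.ne' (hp' i)) h4
    · have he : fingerCurve p u Y s i =ᶠ[nhds t] polarCurve (linearAngle p) u 0 1 i := by
        filter_upwards [fingerShift_eventuallyEq_zero (p := p) hY ht] with x hx
        rw [fingerCurve, hx, polarCurve, one_smul, mul_zero]
      rw [he.deriv_eq, he.eq_of_nhds] at ha
      exact hcl.immersion i t a ha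
  · rcases lt_or_ge (Real.cos (linearAngle p i x)) 0 with hx | hx <;>
      rcases lt_or_ge (Real.cos (linearAngle p j y)) 0 with hy | hy
    · have h2 : u i x = a • u j y := congrArg Prod.snd hxy
      obtain ⟨rfl, l, hl⟩ := h.separated i j x y a hx hy h2
      refine ⟨rfl, ?_⟩
      have hst : strand p i x = strand p i y := by
        rw [strand, strand, hl, Int.add_mul_emod_self_left]
      rw [← h.fibre_eq_of_strand_eq hx hy hst] at h2
      have ha1 : a = 1 := by
        have h3 : (1 - a) • u i x = 0 := by rw [sub_smul, one_smul, ← h2, sub_self]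
        have := (smul_eq_zero.1 h3).resolve_right (h.fibre_ne_zero i x hx)
        linarith
      rw [ha1, one_smul] at hxy
      have him := congrArg (fun q : ℂ × ℂ => q.1.im) hxy
      simp only [fingerCurve_im] at him
      exact exists_eq_add_int_of_strand_eq h.winding_ne hx hy hst (tan_eq_tan_of_sin_eq hx hy him)
    · exact (fingerCurve_ne_smul hη hY hsmall hs1 ha hx hy hxy).elim
    · refine (fingerCurve_ne_smul hη hY hsmall hs1 (inv_pos.2 ha) hy hx ?_).elim
      rw [hxy, smul_smul, inv_mul_cancel₀ ha.ne', one_smul]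
    · rw [fingerCurve_of_nonneg s hx, fingerCurve_of_nonneg s hy] at hxy
      exact hcl.injective i j x y a ha hxy

lemma isotopic_fingerCurve (h : IsFlatBraid p u) (hη : 0 < η)
    (hY : ∀ x, IsProfile (k x) η (Y x))
    (hsmall : ∀ i j s t, Real.cos (linearAngle p i s) < 0 → 2 * η * ‖u j t‖ < ‖u i s‖) :
    (h.isPolar.isConeLink le_rfl zero_lt_one zero_lt_one).toLink.Isotopic
      (isConeLink_fingerCurve h hη hY hsmall le_rfl).toLink := by
  refine SmoothLink.isotopic_of_isConeLink (fun s => fingerCurve p u Y s)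
    (fun s hs => isConeLink_fingerCurve h hη hY hsmall hs.2) (fun i => ?_) (fun i t => ?_)
    (fun i t => rfl)
  · exact ((contDiff_exp_angle ((contDiff_linearAngle i).comp contDiff_snd)).add
      (Complex.ofRealCLM.contDiff.comp (contDiff_fst.mul
        ((contDiff_fingerShift hY i).comp contDiff_snd)))).prodMk
      ((h.isPolar.smooth_fibre i).comp contDiff_snd)
  · rw [IsConeLink.toLink_curve, fingerCurve, polarCurve]
    simp

end Finger

/-! ### Critical points and intersections of the displaced braid -/

section Profile

variable {Y : ℝ → ℝ} {k : ℕ} {η : ℝ}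

/-- The derivative of the angle along the curve `y ↦ (-1 + Y y) + i y`. -/
noncomputable def profileAngleDeriv (Y : ℝ → ℝ) (y : ℝ) : ℝ :=
  -(y * deriv Y y - Y y + 1) / ((-1 + Y y) ^ 2 + y ^ 2)

lemma IsProfile.denominator_ne_zero (h : IsProfile k η Y) (y : ℝ) :
    (-1 + Y y) ^ 2 + y ^ 2 ≠ 0 := by
  intro h0
  have h1 : y = 0 := by nlinarith [sq_nonneg (-1 + Y y), sq_nonneg y]
  subst h1
  apply h.center_ne
  nlinarith [sq_nonneg (-1 + Y 0)]

lemma IsProfile.angleDeriv_eq_zero_iff (h : IsProfile k η Y) (y : ℝ) :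
    profileAngleDeriv Y y = 0 ↔ y * deriv Y y - Y y + 1 = 0 := by
  rw [profileAngleDeriv, div_eq_zero_iff, or_iff_left (h.denominator_ne_zero y), neg_eq_zero]

/-- At a zero of the quotient only the derivative of the numerator matters; the terms in `Y'` cancel
and leave `y Y''`. -/
lemma IsProfile.hasDerivAt_angleDeriv (h : IsProfile k η Y) {y : ℝ}
    (hy : y * deriv Y y - Y y + 1 = 0) :
    ∃ b ≠ 0, HasDerivAt (profileAngleDeriv Y) b y := by
  have h1 := (h.smooth.differentiable (by simp) y).hasDerivAt
  have h2 := ((contDiff_infty_iff_deriv.1 h.smooth).2.differentiable (by simp) y).hasDerivAt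
  have hn := ((((hasDerivAt_id y).fun_mul h2).fun_sub h1).add_const 1).fun_neg
  have hd := ((h1.const_add (-1)).fun_pow 2).fun_add ((hasDerivAt_id y).fun_pow 2)
  have hq := hn.fun_div hd (h.denominator_ne_zero y)
  refine ⟨_, ?_, hq⟩
  have h3 := h.denominator_ne_zero y
  simp only [id]
  rw [hy, neg_zero, zero_mul, sub_zero]
  refine div_ne_zero (mul_ne_zero (neg_ne_zero.2 ?_) h3) (pow_ne_zero 2 h3)
  rw [one_mul, add_sub_cancel_left]
  exact h.nondegenerate y hy

end Profile

section Finger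

variable {m : ℕ} {p : Fin m → ℤ} {Y : Fin m × ℤ → ℝ → ℝ} {η : ℝ} {k : Fin m × ℤ → ℕ}
  {u : Fin m → ℝ → ℂ}

/-- For `y = -tan θ` one has `exp (i θ) = -cos θ · (-1 + i y)`. Since the displacement carries the
same positive factor `-cos θ`, the projection to the `z`-plane is the profile curve up to rescaling,
and both have the same angle. -/
lemma fingerCurve_fst_eventuallyEq {i : Fin m} {t : ℝ}
    (ht : Real.cos (linearAngle p i t) < 0) :
    (fun s => (fingerCurve p u Y 1 i s).1) =ᶠ[nhds t] fun s => (-Real.cos (linearAngle p i s)) •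
      (((-1 + Y (strand p i t) (-Real.tan (linearAngle p i s)) : ℝ) : ℂ) +
        ((-Real.tan (linearAngle p i s) : ℝ) : ℂ) * Complex.I) := by
  filter_upwards [fingerShift_eventuallyEq ht, eventually_cos_neg ht] with s hs hs'
  apply Complex.ext
  · rw [fingerCurve_re, hs]
    simp only [Complex.smul_re, Complex.add_re, Complex.re_ofReal_mul, Complex.ofReal_re,
      Complex.I_re, smul_eq_mul]
    ring
  · rw [fingerCurve_im, ← Real.tan_mul_cos hs'.1.ne]
    simp only [Complex.smul_im, Complex.add_im, Complex.im_ofReal_mul, Complex.ofReal_im,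
      Complex.I_im, smul_eq_mul]
    ring

lemma hasDerivAt_neg_tan_linearAngle {i : Fin m} {t : ℝ}
    (ht : Real.cos (linearAngle p i t) < 0) :
    HasDerivAt (fun s => -Real.tan (linearAngle p i s))
      (-(1 / Real.cos (linearAngle p i t) ^ 2 * (2 * Real.pi * p i))) t :=
  ((Real.hasDerivAt_tan ht.ne).comp t (hasDerivAt_linearAngle i t)).fun_neg

lemma im_logDeriv_profile {Y : ℝ → ℝ} (hY : Differentiable ℝ Y) {y : ℝ → ℝ} {y' t : ℝ}
    (hy : HasDerivAt y y' t) :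
    (deriv (fun s => ((-1 + Y (y s) : ℝ) : ℂ) + ((y s : ℝ) : ℂ) * Complex.I) t /
      (((-1 + Y (y t) : ℝ) : ℂ) + ((y t : ℝ) : ℂ) * Complex.I)).im =
      y' * profileAngleDeriv Y (y t) := by
  have h1 := (((hY (y t)).hasDerivAt.comp t hy).const_add (-1)).ofReal_comp
  have h2 := h1.fun_add (hy.ofReal_comp.mul_const Complex.I)
  simp only [Function.comp_apply] at h2
  rw [h2.deriv, Complex.div_im, Complex.normSq_apply, profileAngleDeriv]
  simp only [Complex.add_re, Complex.add_im, Complex.re_ofReal_mul, Complex.im_ofReal_mul,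
    Complex.ofReal_re, Complex.ofReal_im, Complex.I_re, Complex.I_im, mul_zero, mul_one, add_zero,
    zero_add]
  rw [← sub_div, mul_div_assoc']
  congr 1 <;> ring

lemma angleDeriv_of_nonneg (hY : ∀ x, IsProfile (k x) η (Y x))
    (hL : IsConeLink (fingerCurve p u Y 1)) {i : Fin m} {t : ℝ}
    (ht : 0 ≤ Real.cos (linearAngle p i t)) : hL.toLink.angleDeriv i t = 2 * Real.pi * p i := by
  have he : (fun s => (fingerCurve p u Y 1 i s).1) =ᶠ[nhds t] fun s =>
      Complex.exp (linearAngle p i s * Complex.I) := by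
    filter_upwards [fingerShift_eventuallyEq_zero (p := p) hY ht] with x hx
    simp [fingerCurve, hx]
  have hv : (fingerCurve p u Y 1 i t).1 = Complex.exp (linearAngle p i t * Complex.I) :=
    he.eq_of_nhds
  rw [hL.toLink_angleDeriv, he.deriv_eq, hv,
    (hasDerivAt_exp_angle (hasDerivAt_linearAngle i t)).deriv,
    mul_div_cancel_right₀ _ (Complex.exp_ne_zero _), Complex.im_ofReal_mul, Complex.I_im, mul_one]

lemma angleDeriv_eventuallyEq (hY : ∀ x, IsProfile (k x) η (Y x))
    (hL : IsConeLink (fingerCurve p u Y 1)) {i : Fin m} {t : ℝ}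
    (ht : Real.cos (linearAngle p i t) < 0) :
    hL.toLink.angleDeriv i =ᶠ[nhds t] fun s =>
      -(1 / Real.cos (linearAngle p i s) ^ 2 * (2 * Real.pi * p i)) *
        profileAngleDeriv (Y (strand p i t)) (-Real.tan (linearAngle p i s)) := by
  filter_upwards [(fingerCurve_fst_eventuallyEq (u := u) (Y := Y) ht).eventually_nhds,
    eventually_cos_neg ht] with s hs hs'
  have hY' := (hY (strand p i t)).smooth.differentiable (by simp)
  have hy := hasDerivAt_neg_tan_linearAngle hs'.1
  have hv := Filter.Eventually.self_of_nhds hs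
  rw [hL.toLink_angleDeriv, Filter.EventuallyEq.deriv_eq hs, hv, ← im_logDeriv_profile hY' hy]
  refine im_logDeriv_smul (hasDerivAt_linearAngle i s).cos.fun_neg.differentiableAt ?_
    (neg_ne_zero.2 hs'.1.ne)
  have h1 := (((hY' _).hasDerivAt.comp s hy).const_add (-1)).ofReal_comp
  exact (h1.fun_add (hy.ofReal_comp.mul_const Complex.I)).differentiableAt

lemma angleDeriv_eq_zero_iff (hY : ∀ x, IsProfile (k x) η (Y x))
    (hL : IsConeLink (fingerCurve p u Y 1)) (hp : ∀ i, p i ≠ 0) (i : Fin m) (t : ℝ) :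
    hL.toLink.angleDeriv i t = 0 ↔ Real.cos (linearAngle p i t) < 0 ∧
      (-Real.tan (linearAngle p i t)) * deriv (Y (strand p i t)) (-Real.tan (linearAngle p i t)) -
        Y (strand p i t) (-Real.tan (linearAngle p i t)) + 1 = 0 := by
  have hp' : 2 * Real.pi * (p i : ℝ) ≠ 0 :=
    mul_ne_zero Real.two_pi_pos.ne' (by exact_mod_cast hp i)
  rcases lt_or_ge (Real.cos (linearAngle p i t)) 0 with ht | ht
  · rw [(angleDeriv_eventuallyEq hY hL ht).eq_of_nhds, mul_eq_zero,
      (hY _).angleDeriv_eq_zero_iff, or_iff_right]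
    · simp [ht]
    · exact neg_ne_zero.2 (mul_ne_zero (one_div_ne_zero (pow_ne_zero 2 ht.ne)) hp')
  · rw [angleDeriv_of_nonneg hY hL ht]
    simp only [hp', not_lt.2 ht, false_and]

lemma isBooklink_fingerCurve (hY : ∀ x, IsProfile (k x) η (Y x))
    (hL : IsConeLink (fingerCurve p u Y 1)) (hp : ∀ i, p i ≠ 0) : hL.toLink.IsBooklink := by
  refine ⟨hL.toLink_avoidsBinding fun i t h0 => ?_, fun i t h0 => ?_⟩
  · rcases lt_or_ge (Real.cos (linearAngle p i t)) 0 with ht | ht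
    · have hre := congrArg Complex.re h0
      have him := congrArg Complex.im h0
      rw [fingerCurve_re, Complex.zero_re, fingerShift, if_pos ht, Real.tan_eq_sin_div_cos] at hre
      rw [fingerCurve_im, Complex.zero_im] at him
      rw [him, zero_div, neg_zero, one_mul] at hre
      have h1 : Real.cos (linearAngle p i t) * (1 - Y (strand p i t) 0) = 0 := by linarith
      have h2 := (mul_eq_zero.1 h1).resolve_left ht.ne
      exact (hY (strand p i t)).center_ne (by linarith)
    · rw [fingerCurve_of_nonneg 1 ht] at h0
      have := norm_polarCurve_zero_fst (u := u) (linearAngle p) i t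
      rw [h0, norm_zero] at this
      norm_num at this
  · obtain ⟨ht, hz⟩ := (angleDeriv_eq_zero_iff hY hL hp i t).1 h0
    rw [(angleDeriv_eventuallyEq hY hL ht).deriv_eq]
    obtain ⟨b, hb, hR⟩ := (hY (strand p i t)).hasDerivAt_angleDeriv hz
    have hy := hasDerivAt_neg_tan_linearAngle ht
    have hcos : DifferentiableAt ℝ (fun s =>
        -(1 / Real.cos (linearAngle p i s) ^ 2 * (2 * Real.pi * p i))) t :=
      ((((differentiableAt_const 1).fun_div
        ((hasDerivAt_linearAngle i t).cos.differentiableAt.fun_pow 2)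
        (pow_ne_zero 2 ht.ne))).mul_const _).fun_neg
    have h1 := (hcos.hasDerivAt.fun_mul (hR.comp t hy)).deriv
    simp only [Function.comp_apply] at h1
    rw [h1, ((hY _).angleDeriv_eq_zero_iff _).2 hz, mul_zero, zero_add]
    have hp' : 2 * Real.pi * (p i : ℝ) ≠ 0 :=
      mul_ne_zero Real.two_pi_pos.ne' (by exact_mod_cast hp i)
    have hA : -(1 / Real.cos (linearAngle p i t) ^ 2 * (2 * Real.pi * p i)) ≠ 0 :=
      neg_ne_zero.2 (mul_ne_zero (one_div_ne_zero (pow_ne_zero 2 ht.ne)) hp')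
    exact mul_ne_zero hA (mul_ne_zero hb hA)

lemma encard_sigma_finset {α β : Type*} [DecidableEq α] (S : Finset α) (Z : α → Set β) :
    {q : α × β | q.1 ∈ S ∧ q.2 ∈ Z q.1}.encard = ∑ x ∈ S, (Z x).encard := by
  induction S using Finset.induction_on with
  | empty => simp
  | insert a S ha ih =>
    have h1 : {q : α × β | q.1 ∈ insert a S ∧ q.2 ∈ Z q.1} =
        (fun b => (a, b)) '' Z a ∪ {q : α × β | q.1 ∈ S ∧ q.2 ∈ Z q.1} := by
      ext ⟨x, y⟩
      simp only [Set.mem_ofPred_eq, Finset.mem_insert, Set.mem_union, Set.mem_image,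
        Prod.mk.injEq]
      constructor
      · rintro ⟨rfl | h, h'⟩
        · exact Or.inl ⟨y, h', rfl, rfl⟩
        · exact Or.inr ⟨h, h'⟩
      · rintro (⟨b, hb, rfl, rfl⟩ | ⟨h, h'⟩)
        · exact ⟨Or.inl rfl, hb⟩
        · exact ⟨Or.inr h, h'⟩
    rw [Finset.sum_insert ha, h1, Set.encard_union_eq, ih,
      Function.Injective.encard_image (fun b c h => congrArg Prod.snd h)]
    rw [Set.disjoint_left]
    rintro _ ⟨b, -, rfl⟩ ⟨h, -⟩
    exact ha h

/-- A critical point is recorded by its strand and by `y = -tan θ`; this is a bijection onto the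
pairs of a strand and a critical angle of its profile. -/
lemma numCritical_fingerCurve (hY : ∀ x, IsProfile (k x) η (Y x))
    (hL : IsConeLink (fingerCurve p u Y 1)) (hp : ∀ i, p i ≠ 0) :
    hL.toLink.numCritical = 2 * ((∑ x ∈ (finite_strandSet p).toFinset, k x : ℕ) : ℕ∞) := by
  classical
  have hsum : (2 * ((∑ x ∈ (finite_strandSet p).toFinset, k x : ℕ) : ℕ∞)) =
      ∑ x ∈ (finite_strandSet p).toFinset,
        {y | y * deriv (Y x) y - Y x y + 1 = 0}.encard := by
    simp only [(hY _).encard_zeros]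
    rw [Nat.cast_sum, Finset.mul_sum]
  rw [hsum, ← encard_sigma_finset, SmoothLink.numCritical,
    ← Set.InjOn.encard_image (s := {q : Fin m × ℝ | q.2 ∈ Set.Ico (0 : ℝ) 1 ∧
      hL.toLink.angleDeriv q.1 q.2 = 0})
      (f := fun q => (strand p q.1 q.2, -Real.tan (linearAngle p q.1 q.2)))]
  · congr 1
    ext ⟨x, y⟩
    simp only [Set.mem_image, Set.mem_ofPred_eq, Set.Finite.mem_toFinset, Prod.mk.injEq]
    constructor
    · rintro ⟨⟨i, t⟩, ⟨-, h0⟩, rfl, rfl⟩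
      exact ⟨strand_mem hp i t, ((angleDeriv_eq_zero_iff hY hL hp i t).1 h0).2⟩
    · rintro ⟨hx, hy⟩
      obtain ⟨t, ht, hcos, hst, htan⟩ := exists_mem_strand hp hx y
      refine ⟨(x.1, t), ⟨ht, (angleDeriv_eq_zero_iff hY hL hp x.1 t).2 ⟨hcos, ?_⟩⟩, hst, htan⟩
      rw [htan, hst]
      exact hy
  · rintro ⟨i, s⟩ ⟨hs, hs0⟩ ⟨j, t⟩ ⟨ht, ht0⟩ h
    simp only [Prod.mk.injEq] at h
    obtain ⟨h1, h2⟩ := h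
    obtain rfl : i = j := congrArg Prod.fst h1
    obtain ⟨l, hl⟩ := exists_eq_add_int_of_strand_eq hp
      ((angleDeriv_eq_zero_iff hY hL hp i s).1 hs0).1
      ((angleDeriv_eq_zero_iff hY hL hp i t).1 ht0).1 h1 (neg_injective h2)
    have hst : s = t := eq_of_mem_Ico_of_eq_add_int hs ht hl
    rw [hst]

/-- The page `θ = π` is reached only where `y = 0`, once per strand, and a strand with a finger has
`Y 0 > 1` there and crosses the positive real axis instead. -/
lemma pageCount_fingerCurve_le (hY : ∀ x, IsProfile (k x) η (Y x))
    (hL : IsConeLink (fingerCurve p u Y 1)) (hp : ∀ i, p i ≠ 0) :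
    hL.toLink.pageCount Real.pi ≤ {x | x ∈ strandSet p ∧ k x = 0}.encard := by
  have key : ∀ q : Fin m × ℝ, (∃ r : ℝ, 0 < r ∧ (fingerCurve p u Y 1 q.1 q.2).1 =
      r * Complex.exp ((Real.pi : ℝ) * Complex.I)) → Real.cos (linearAngle p q.1 q.2) < 0 ∧
      Real.tan (linearAngle p q.1 q.2) = 0 ∧ k (strand p q.1 q.2) = 0 := by
    rintro ⟨i, t⟩ ⟨r, hr, h⟩
    rw [Complex.exp_pi_mul_I] at h
    have hre := congrArg Complex.re h
    have him := congrArg Complex.im h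
    rw [fingerCurve_re, Complex.re_ofReal_mul, Complex.neg_re, Complex.one_re] at hre
    rw [fingerCurve_im, Complex.im_ofReal_mul, Complex.neg_im, Complex.one_im, neg_zero,
      mul_zero] at him
    have htan : Real.tan (linearAngle p i t) = 0 := by rw [Real.tan_eq_sin_div_cos, him, zero_div]
    have hnn := fingerShift_nonneg (p := p) hY i t
    have hcos : Real.cos (linearAngle p i t) < 0 := by linarith
    refine ⟨hcos, htan, ?_⟩
    rw [fingerShift, if_pos hcos, htan, neg_zero] at hre
    by_contra hk
    have := (hY (strand p i t)).center (Nat.pos_of_ne_zero hk)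
    nlinarith
  rw [hL.toLink_pageCount]
  refine Set.encard_le_encard_of_injOn (f := fun q => strand p q.1 q.2) ?_ ?_
  · rintro q ⟨-, hq⟩
    exact ⟨strand_mem hp _ _, (key q hq).2.2⟩
  · rintro ⟨i, s⟩ ⟨hs, hs0⟩ ⟨j, t⟩ ⟨ht, ht0⟩ h1
    simp only at h1
    obtain rfl : i = j := congrArg Prod.fst h1
    obtain ⟨hc1, ht1, -⟩ := key _ hs0
    obtain ⟨hc2, ht2, -⟩ := key _ ht0
    obtain ⟨l, hl⟩ := exists_eq_add_int_of_strand_eq hp hc1 hc2 h1 (ht1.trans ht2.symm)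
    have hst : s = t := eq_of_mem_Ico_of_eq_add_int hs ht hl
    rw [hst]

/-- Each strand contains a point with `tan θ = 0` and `cos θ < 0`, that is, a point of the page `θ =
π`. -/
lemma encard_strandSet_le (hp : ∀ i, p i ≠ 0) : (strandSet p).encard ≤
    {q : Fin m × ℝ | q.2 ∈ Set.Ico (0 : ℝ) 1 ∧
      Real.cos (linearAngle p q.1 q.2 - Real.pi) = 1}.encard := by
  choose! f hf hcos hst htan using fun x hx => exists_mem_strand hp (x := x) hx 0
  refine Set.encard_le_encard_of_injOn (f := fun x => (x.1, f x)) (fun x hx => ⟨hf x hx, ?_⟩)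
    fun x hx y hy hxy => ?_
  · have h1 := htan x hx
    rw [neg_eq_zero, Real.tan_eq_sin_div_cos, div_eq_zero_iff,
      or_iff_left (hcos x hx).ne] at h1
    have h2 := Real.sin_sq_add_cos_sq (linearAngle p x.1 (f x))
    have h3 := hcos x hx
    rw [h1] at h2
    rw [Real.cos_sub_pi]
    nlinarith
  · simp only [Prod.mk.injEq] at hxy
    rw [← hst x hx, ← hst y hy, hxy.1, hxy.2]

end Finger

/-! ### Assembly of the two bounds -/

/-- A distribution of `d` fingers over the strands. -/
lemma exists_distribution {α : Type*} [DecidableEq α] {S : Finset α} (hS : S.Nonempty) (d : ℕ) :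
    ∃ k : α → ℕ, ∑ x ∈ S, k x = d ∧ {x | x ∈ S ∧ k x = 0}.encard ≤ ((S.card - d : ℕ) : ℕ∞) := by
  rcases le_or_gt d S.card with h | h
  · obtain ⟨T, hT, rfl⟩ := Finset.exists_subset_card_eq h
    refine ⟨fun x => if x ∈ T then 1 else 0, ?_, ?_⟩
    · rw [Finset.sum_ite_mem, Finset.inter_eq_right.2 hT]
      simp
    · rw [← Finset.card_sdiff_of_subset hT, ← Set.encard_coe_eq_coe_finsetCard]
      refine Set.encard_le_encard ?_
      rintro x ⟨h1, h2⟩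
      simpa [h1] using h2
  -- Every element receives one, and the surplus is put on a single element.
  · obtain ⟨a, ha⟩ := hS
    refine ⟨fun x => 1 + if x = a then d - S.card else 0, ?_, ?_⟩
    · rw [Finset.sum_add_distrib, Finset.sum_ite_eq' S a, if_pos ha]
      simp
      omega
    · have : {x | x ∈ S ∧ (1 + if x = a then d - S.card else 0) = 0} = ∅ := by
        ext x
        simp
      rw [this]
      simp

/-- A closed braid with `n` strands has representatives with `d` pairs of critical points that meet
some page in at most `n - d` points. -/
theorem SmoothLink.IsClosedBraid.exists_isRepresentative {m : ℕ} (hm : 0 < m) {K : SmoothLink m}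
    {n : ℕ} (hK : K.IsClosedBraid n) (d : ℕ) :
    ∃ K' : SmoothLink m, K.Isotopic K' ∧ K'.IsBooklink ∧ K'.numCritical = 2 * (d : ℕ∞) ∧
      K'.pageCount Real.pi ≤ ((n - d : ℕ) : ℕ∞) := by
  classical
  obtain ⟨p, u, hpol, hp, hiso, hcount⟩ := hK.exists_linear
  obtain ⟨u', hflat, hiso'⟩ := hpol.exists_flat hp
  obtain ⟨η, hη, hsmall⟩ := hflat.exists_small
  have hmem : ∀ x, x ∈ (finite_strandSet p).toFinset ↔ x ∈ strandSet p := fun x =>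
    Set.Finite.mem_toFinset _
  have hcard : (finite_strandSet p).toFinset.card ≤ n := by
    have h1 := (encard_strandSet_le hp).trans hcount
    rw [(finite_strandSet p).encard_eq_coe_toFinset_card] at h1
    exact_mod_cast h1
  obtain ⟨k, hk, hk0⟩ := exists_distribution (S := (finite_strandSet p).toFinset)
    -- A link with at least one component has a strand, which can carry surplus fingers.
    ⟨strand p ⟨0, hm⟩ 0, (hmem _).2 (strand_mem hp _ _)⟩ d
  choose Y hY using fun x => exists_isProfile (k x) hη
  have hL := isConeLink_fingerCurve hflat hη hY hsmall le_rfl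
  refine ⟨hL.toLink, (hiso.trans hiso').trans (isotopic_fingerCurve hflat hη hY hsmall),
    isBooklink_fingerCurve hY hL hp, ?_, ?_⟩
  · rw [numCritical_fingerCurve hY hL hp, hk]
  · refine (pageCount_fingerCurve_le hY hL hp).trans ?_
    simp only [hmem] at hk0
    refine hk0.trans ?_
    exact_mod_cast Nat.sub_le_sub_right hcard d

theorem corollary5p4 (m : ℕ) (hm : 0 < m) (L : SmoothLink m) (𝔡 : ℕ)
    (hbridge : L.bridgeIndex = (𝔡 : ℕ∞)) (hbraid : L.braidIndex = (𝔡 : ℕ∞)) :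
    ∀ d : ℕ, L.bridgeBraidSpectrum d = ((𝔡 - d : ℕ) : ℕ∞) := by
  intro d
  apply le_antisymm
  -- The braid index is finite, so the infimum is taken over a non-empty set and is attained.
  · have hne : {n | ∃ K' : SmoothLink m, L.Isotopic K' ∧ K'.IsClosedBraid n}.Nonempty := by
      by_contra hempty
      rw [Set.not_nonempty_iff_eq_empty] at hempty
      rw [SmoothLink.braidIndex, hempty, sInf_empty] at hbraid
      exact ENat.top_ne_natCast 𝔡 hbraid
    obtain ⟨K, hLK, hK⟩ := csInf_mem hne
    change K.IsClosedBraid L.braidIndex at hK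
    rw [hbraid] at hK
    obtain ⟨K', hiso, hbook, hcrit, hpage⟩ := hK.exists_isRepresentative hm d
    refine le_trans (sInf_le ⟨K', hLK.trans hiso, hbook, hcrit, rfl⟩) ?_
    exact (iInf_le _ Real.pi).trans hpage
  · refine le_sInf ?_
    rintro n ⟨K, hLK, hK⟩
    have h := SmoothLink.bridgeIndex_le_of_isRepresentative hLK hK
    rw [hbridge] at h
    induction n using ENat.recTopCoe with
    | top => exact le_top
    | coe n =>
      -- Truncated subtraction also covers `d > 𝔡`, where the bound is vacuous.
      have h' : 𝔡 ≤ n + d := by exact_mod_cast h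
      exact_mod_cast (by omega : 𝔡 - d ≤ n)
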